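/- Let $p$ be a prime, let $L/\mathbb{Q}_p$ be a finite extension with ring of integers $\mathcal{O}_L$ (the integral closure of $\mathbb{Z}_p$ in $L$), let $\pi$ be a uniformizer of $\mathcal{O}_L$, and let $q=\#(\mathcal{O}_L/\pi)$. All rings are commutative. A $\delta_L$-algebra is an $\mathcal{O}_L$-algebra $A$ with a map of sets $\delta_L:A\to A$ such that $\delta_L(\alpha)=\frac{\alpha-\alpha^q}{\pi}$ for $\alpha\in\mathcal{O}_L$, and for all $x,y\in A$, $$\delta_L(xy)=\delta_L(x)y^q+x^q\delta_L(y)+\pi\delta_L(x)\delta_L(y),\qquad \delta_L(x+y)=\delta_L(x)+\delta_L(y)-\sum_{i=1}^{q-1}\tfrac1\pi\tbinom{q}{i}x^iy^{q-i}.$$ Then $\phi(x)=x^q+\pi\delta_L(x)$ is an $\mathcal{O}_L$-algebra endomorphism of $A$; $A$ is called perfect if $\phi$ is bijective. An $L$-typical prism is a pair $(A,I)$ of a $\delta_L$-algebra $A$ and an ideal $I\subseteq A$ that defines a Cartier divisor on $\operatorname{Spec}A$ (i.e. is Zariski-locally generated by a nonzerodivisor), such that $A$ is derived $(\pi,I)$-complete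 and $\pi\in I+\phi(I)A$. It is perfect if $A$ is perfect. An $\mathcal{O}_L$-algebra $R$ is called a perfectoid $\mathcal{O}_L$-algebra if $R\cong A/I$ as $\mathcal{O}_L$-algebras for some perfect $L$-typical prism $(A,I)$. A ring $R$ is called a perfectoid ring (in the sense of Bhatt--Morrow--Scholze) if there is $\varpi\in R$ such that $\varpi^p$ divides $p$ and $R$ is $\varpi$-adically complete and separated, the Frobenius $x\mapsto x^p$ of $R/p$ is surjective, and the kernel of Fontaine's map $\theta:W(R^\flat)\to R$ is principal, where $R^\flat=\varprojlim_{x\mapsto x^p}R/p$. Theorem. Let $R$ be an $\mathcal{O}_L$-algebra. Then $R$ is a perfectoid $\mathcal{O}_L$-algebra if and only if the ring $R$ is a perfectoid ring. -/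

import Mathlib

noncomputable section

namespace LTypical

/-! ### Exact division by a uniformizer

In this part `O` stands for the ring of integers of a finite extension of `ℚ_p`
and `π` for a uniformizer; `q` is the number of elements of `O / π`. -/

/-- The quotient `a / π`, for `a` divisible by `π` (and the junk value `0` otherwise).
It is unique when `O` is a domain and `π ≠ 0`. -/
def divBy {O : Type*} [CommRing O] (π a : O) : O :=
  open Classical in if h : π ∣ a then h.choose else 0

theorem mul_divBy {O : Type*} [CommRing O] {π a : O} (h : π ∣ a) : π * divBy π a = a := by
  unfold divBy
  rw [dif_pos h]
  exact h.choose_spec.symm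

/-- The number `q` of elements of the residue field `O / π`. -/
def resCard {O : Type*} [CommRing O] (π : O) : ℕ := Nat.card (O ⧸ Ideal.span {π})

/-- `(α - α ^ q) / π` makes sense in `O`. -/
theorem dvd_sub_pow_resCard {O : Type*} [CommRing O] {π : O}
    (hmax : (Ideal.span {π}).IsMaximal) [Finite (O ⧸ Ideal.span {π})] (α : O) :
    π ∣ α - α ^ resCard π := by
  let _ : Field (O ⧸ Ideal.span {π}) := Ideal.Quotient.field _
  have := Fintype.ofFinite (O ⧸ Ideal.span {π})
  rw [← Ideal.mem_span_singleton, ← Ideal.Quotient.eq_zero_iff_mem, map_sub, map_pow, resCard,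
    Nat.card_eq_fintype_card, FiniteField.pow_card, sub_self]

/-- `(1 / π) * (q.choose i)` makes sense in `O` for `0 < i < q`. -/
theorem dvd_choose_resCard {O : Type*} [CommRing O] {π : O}
    (hmax : (Ideal.span {π}).IsMaximal) [Finite (O ⧸ Ideal.span {π})] {i : ℕ}
    (hi : i ∈ Finset.Ioo 0 (resCard π)) : π ∣ ((resCard π).choose i : O) := by
  let _ : Field (O ⧸ Ideal.span {π}) := Ideal.Quotient.field _
  have := Fintype.ofFinite (O ⧸ Ideal.span {π})
  obtain ⟨n, hp, hc⟩ := FiniteField.card (O ⧸ Ideal.span {π}) (ringChar (O ⧸ Ideal.span {π}))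
  have hq : resCard π = ringChar (O ⧸ Ideal.span {π}) ^ (n : ℕ) := by
    rw [resCard, Nat.card_eq_fintype_card, hc]
  rw [Finset.mem_Ioo] at hi
  rw [← Ideal.mem_span_singleton, ← Ideal.Quotient.eq_zero_iff_mem, map_natCast,
    ringChar.spec, hq]
  exact hp.dvd_choose_pow (by omega) (by omega)

/-! ### `δ_L`-algebras -/

/-- A `δ_L`-structure on an `O`-algebra `A`, with respect to the uniformizer `π`. -/
structure DeltaStructure {O : Type*} [CommRing O] (π : O) (A : Type*) [CommRing A]
    [Algebra O A] where
  /-- the map of sets `δ_L : A → A` -/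
  δ : A → A
  δ_algebraMap : ∀ α : O, δ (algebraMap O A α) = algebraMap O A (divBy π (α - α ^ resCard π))
  δ_mul : ∀ x y : A, δ (x * y) =
    δ x * y ^ resCard π + x ^ resCard π * δ y + algebraMap O A π * δ x * δ y
  δ_add : ∀ x y : A, δ (x + y) = δ x + δ y -
    ∑ i ∈ Finset.Ioo 0 (resCard π),
      algebraMap O A (divBy π ((resCard π).choose i : O)) * x ^ i * y ^ (resCard π - i)

/-- The lift `φ(x) = x ^ q + π δ_L(x)` of the `q`-Frobenius. -/
def DeltaStructure.φ {O : Type*} [CommRing O] {π : O} {A : Type*} [CommRing A] [Algebra O A]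
    (D : DeltaStructure π A) (x : A) : A :=
  x ^ resCard π + algebraMap O A π * D.δ x

/-- A `δ_L`-algebra is perfect if `φ` (which is a ring homomorphism) is an isomorphism. -/
def DeltaStructure.IsPerfect {O : Type*} [CommRing O] {π : O} {A : Type*} [CommRing A]
    [Algebra O A] (D : DeltaStructure π A) : Prop :=
  Function.Bijective D.φ

/-! ### `L`-typical prisms -/

/-- The ideal `I` defines an (effective) Cartier divisor on `Spec A`: Zariski-locally on `Spec A`
it is generated by a nonzerodivisor. -/
def IsCartierDivisor {A : Type*} [CommRing A] (I : Ideal A) : Prop :=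
  ∃ s : Set A, Ideal.span s = ⊤ ∧ ∀ f ∈ s, ∃ d ∈ nonZeroDivisors (Localization.Away f),
    I.map (algebraMap A (Localization.Away f)) = Ideal.span {d}

/-- Derived `J`-completeness of an `A`-module `M`: for each `f ∈ J` the derived limit of
`⋯ → M → M → M` (all maps multiplication by `f`) vanishes. This derived limit is computed by the
two-term complex `∏ M → ∏ M`, `(xₙ)ₙ ↦ (xₙ - f xₙ₊₁)ₙ`. -/
def IsDerivedComplete {A : Type*} [CommRing A] (J : Ideal A) (M : Type*) [AddCommGroup M]
    [Module A M] : Prop :=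
  ∀ f ∈ J, Function.Bijective (fun (x : ℕ → M) (n : ℕ) ↦ x n - f • x (n + 1))

/-- `(A, I)` is an `L`-typical prism, for the `δ_L`-structure `D` on `A`. -/
structure IsPrism {O : Type*} [CommRing O] {π : O} {A : Type*} [CommRing A] [Algebra O A]
    (D : DeltaStructure π A) (I : Ideal A) : Prop where
  isCartierDivisor : IsCartierDivisor I
  isDerivedComplete : IsDerivedComplete (Ideal.span {algebraMap O A π} ⊔ I) A
  mem : algebraMap O A π ∈ I ⊔ Ideal.span (D.φ '' (I : Set A))

/-- The `O`-algebra `R` is a perfectoid `O_L`-algebra: it is isomorphic to `A / I` for some perfect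
`L`-typical prism `(A, I)`. (As `A` can be recovered from `A / I` by a construction that stays in
the same universe, the choice of universe for `A` is no restriction.) -/
def IsPerfectoidAlgebra.{v, u} {O : Type v} [CommRing O] (π : O) (R : Type u) [CommRing R]
    [Algebra O R] : Prop :=
  ∃ (A : Type u) (_ : CommRing A) (_ : Algebra O A) (D : DeltaStructure π A) (I : Ideal A),
    IsPrism D I ∧ D.IsPerfect ∧ Nonempty (R ≃ₐ[O] A ⧸ I)

/-! ### Perfectoid rings -/

theorem smodEq_span_singleton_iff {S : Type*} [CommRing S] {a : S} {n : ℕ} {x y : S} :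
    x ≡ y [SMOD (Ideal.span {a} ^ n • ⊤ : Submodule S S)] ↔ a ^ n ∣ x - y := by
  rw [SModEq.sub_mem, Ideal.span_singleton_pow, smul_eq_mul, Ideal.mul_top,
    Ideal.mem_span_singleton]

/-- A ring which is `ϖ`-adically complete is `a`-adically complete for every multiple `a` of `ϖ`. -/
theorem isAdicComplete_of_dvd {S : Type*} [CommRing S] {ϖ a : S} (h : ϖ ∣ a)
    (hc : IsAdicComplete (Ideal.span {ϖ}) S) : IsAdicComplete (Ideal.span {a}) S := by
  have hpow (n : ℕ) : ϖ ^ n ∣ a ^ n := pow_dvd_pow_of_dvd h n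
  refine { haus' := fun x hx ↦ hc.haus' x fun n ↦ ?_, prec' := fun f hf ↦ ?_ }
  · exact smodEq_span_singleton_iff.2 ((hpow n).trans (smodEq_span_singleton_iff.1 (hx n)))
  · have hstep : ∀ n, ∃ g, f (n + 1) - f n = a ^ n * g := fun n ↦ by
      obtain ⟨g, hg⟩ := smodEq_span_singleton_iff.1 (hf (Nat.le_succ n))
      exact ⟨-g, by rw [mul_neg, ← hg]; ring⟩
    choose g hg using hstep
    have key (n : ℕ) : ∃ y : S, ∀ m, ϖ ^ m ∣ (∑ k ∈ Finset.range m, a ^ k * g (n + k)) - y := by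
      obtain ⟨y, hy⟩ := hc.prec' (fun m ↦ ∑ k ∈ Finset.range m, a ^ k * g (n + k))
        (fun {m l} hml ↦ by
          rw [smodEq_span_singleton_iff, ← dvd_neg, neg_sub, ← Finset.sum_Ico_eq_sub _ hml]
          refine Finset.dvd_sum fun k hk ↦ Dvd.dvd.mul_right ?_ _
          exact (pow_dvd_pow ϖ (Finset.mem_Ico.1 hk).1).trans (hpow k))
      exact ⟨y, fun m ↦ smodEq_span_singleton_iff.1 (hy m)⟩
    choose y hy using key
    have hsum (n m : ℕ) : a ^ n * ∑ k ∈ Finset.range m, a ^ k * g (n + k) = f (n + m) - f n := by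
      induction m with
      | zero => simp
      | succ m ih =>
        rw [Finset.sum_range_succ, mul_add, ih, ← mul_assoc, ← pow_add, ← hg (n + m)]
        ring_nf
    refine ⟨f 0 + y 0, fun n ↦ smodEq_span_singleton_iff.2 ⟨-y n, ?_⟩⟩
    rw [← sub_eq_zero]
    refine hc.haus' _ fun m ↦ smodEq_span_singleton_iff.2 ?_
    have h1 := hy 0 (n + m)
    have h2 := hy n m
    have h3 := hsum 0 (n + m)
    have h4 := hsum n m
    rw [pow_zero, one_mul, zero_add] at h3
    rw [h3] at h1
    have h5 : ϖ ^ m ∣ f (n + m) - f 0 - y 0 := (pow_dvd_pow ϖ (Nat.le_add_left m n)).trans h1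
    have h6 : ϖ ^ m ∣ f (n + m) - f n - a ^ n * y n := by
      rw [← h4, ← mul_sub]; exact h2.mul_left _
    convert h5.sub h6 using 1
    ring

/-- If `p` is invertible in a ring that is `p`-adically complete, then the ring is zero. -/
theorem subsingleton_of_isUnit {S : Type*} [CommRing S] {a : S} (h : IsUnit a)
    (hc : IsAdicComplete (Ideal.span {a}) S) : Subsingleton S := by
  rw [Ideal.span_singleton_eq_top.2 h] at hc
  exact hc.toIsHausdorff.subsingleton

/-- Perfectoid rings in the sense of Bhatt, Morrow and Scholze: `S` is `ϖ`-adically complete for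
some `ϖ` with `ϖ ^ p ∣ p`, the Frobenius of `S / p` is surjective, and the kernel of Fontaine's map
`θ : A_inf(S) = W(S♭) → S` is principal.

Mathlib's `θ` needs that `p` is not a unit of `S`. By `subsingleton_of_isUnit` only the zero ring is
excluded by this; there `θ` is the identity of the zero ring, whose kernel is principal. -/
structure IsPerfectoidRing (p : ℕ) [Fact p.Prime] (S : Type*) [CommRing S] : Prop where
  exists_complete : ∃ ϖ : S, ϖ ^ p ∣ (p : S) ∧ IsAdicComplete (Ideal.span {ϖ}) S
  surjective_frobenius : Function.Surjective fun x : S ⧸ Ideal.span {(p : S)} ↦ x ^ p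
  isPrincipal_ker_theta : ∀ hp : ¬ IsUnit (p : S),
    haveI : Fact (¬ IsUnit (p : S)) := ⟨hp⟩
    haveI : IsAdicComplete (Ideal.span {(p : S)}) S :=
      isAdicComplete_of_dvd ((dvd_pow_self _ (Fact.out : p.Prime).ne_zero).trans
        exists_complete.choose_spec.1) exists_complete.choose_spec.2
    (RingHom.ker (WittVector.fontaineTheta S p)).IsPrincipal

end LTypical

end

noncomputable section

namespace LTypical

/-! ### Adic and derived completeness along one element. -/

section Completeness

variable {A : Type*} [CommRing A]

/-- The map `(xₙ) ↦ (xₙ - f xₙ₊₁)` computing the derived limit along `f` is bijective. -/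
def DerivedCompleteAt (f : A) : Prop :=
  Function.Bijective (fun (x : ℕ → A) (n : ℕ) ↦ x n - f * x (n + 1))

/-- Cauchy sequences are traded for power series in `f` with arbitrary coefficients, the form in
which completeness is used below. -/
theorem isAdicComplete_span_iff {f : A} :
    IsAdicComplete (Ideal.span {f}) A ↔ (∀ x : A, (∀ n, f ^ n ∣ x) → x = 0) ∧
      ∀ g : ℕ → A, ∃ y, ∀ n, f ^ n ∣ (∑ k ∈ Finset.range n, f ^ k * g k) - y := by
  constructor
  · intro h
    refine ⟨fun x hx ↦ h.haus' x fun n ↦ smodEq_span_singleton_iff.2 (by simpa using hx n),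
      fun g ↦ ?_⟩
    obtain ⟨y, hy⟩ := h.prec' (fun m ↦ ∑ k ∈ Finset.range m, f ^ k * g k)
      (fun {m l} hml ↦ by
        rw [smodEq_span_singleton_iff, ← dvd_neg, neg_sub, ← Finset.sum_Ico_eq_sub _ hml]
        exact Finset.dvd_sum fun k hk ↦
          Dvd.dvd.mul_right (pow_dvd_pow f (Finset.mem_Ico.1 hk).1) _)
    exact ⟨y, fun n ↦ smodEq_span_singleton_iff.1 (hy n)⟩
  · rintro ⟨h1, h2⟩
    refine { haus' := fun x hx ↦ h1 x fun n ↦ by simpa using smodEq_span_singleton_iff.1 (hx n),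
             prec' := fun F hF ↦ ?_ }
    have hstep : ∀ n, ∃ g, F (n + 1) - F n = f ^ n * g := fun n ↦ by
      obtain ⟨g, hg⟩ := smodEq_span_singleton_iff.1 (hF (Nat.le_succ n))
      exact ⟨-g, by rw [mul_neg, ← hg]; ring⟩
    choose g hg using hstep
    obtain ⟨y, hy⟩ := h2 g
    refine ⟨F 0 + y, fun n ↦ smodEq_span_singleton_iff.2 ?_⟩
    have : ∑ k ∈ Finset.range n, f ^ k * g k = F n - F 0 := by
      simp_rw [← hg]
      exact Finset.sum_range_sub F n
    have h3 := hy n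
    rw [this] at h3
    convert h3 using 1
    ring

theorem mem_jacobson_of_isAdicComplete {f : A} (h : IsAdicComplete (Ideal.span {f}) A) :
    f ∈ (⊥ : Ideal A).jacobson :=
  IsAdicComplete.le_jacobson_bot (Ideal.span {f}) (Ideal.mem_span_singleton_self f)

theorem isUnit_one_sub_of_mem_jacobson {f : A} (h : f ∈ (⊥ : Ideal A).jacobson) :
    IsUnit (1 - f) := by
  have := Ideal.mem_jacobson_bot.1 h (-1)
  rwa [mul_neg_one, neg_add_eq_sub] at this

theorem isUnit_of_isUnit_mk {f : A} (hf : f ∈ (⊥ : Ideal A).jacobson) {u : A}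
    (h : IsUnit (Ideal.Quotient.mk (Ideal.span {f}) u)) : IsUnit u := by
  obtain ⟨v, hv⟩ := h.exists_right_inv
  obtain ⟨v, rfl⟩ := Ideal.Quotient.mk_surjective v
  rw [← map_mul, ← map_one (Ideal.Quotient.mk _), Ideal.Quotient.eq,
    Ideal.mem_span_singleton] at hv
  obtain ⟨c, hc⟩ := hv
  have := Ideal.mem_jacobson_bot.1 hf c
  rw [← hc, sub_add_cancel] at this
  exact isUnit_of_mul_isUnit_left this

theorem isUnit_of_sub_mem_jacobson {u v : A} (hv : IsUnit v)
    (h : u - v ∈ (⊥ : Ideal A).jacobson) : IsUnit u := by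
  obtain ⟨w, hw⟩ := hv.exists_right_inv
  have := Ideal.mem_jacobson_bot.1 h w
  rw [sub_mul, hw, sub_add_cancel] at this
  exact isUnit_of_mul_isUnit_left this

/-- A solution of `y n - f * y (n + 1) = 1` remains one after a shift, so by uniqueness it is
constant and inverts `1 - f`. -/
theorem DerivedCompleteAt.isUnit_one_sub {f : A} (h : DerivedCompleteAt f) : IsUnit (1 - f) := by
  obtain ⟨y, hy⟩ := h.2 fun _ ↦ 1
  have hy' (n : ℕ) : y n - f * y (n + 1) = 1 := congrFun hy n
  have : y = fun n ↦ y (n + 1) := h.1 (by ext n; simp only [hy'])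
  have h0 := hy' 0
  rw [← congrFun this 0] at h0
  exact IsUnit.of_mul_eq_one (y 0) (by linear_combination h0)

theorem mem_jacobson_of_derivedCompleteAt {f : A} (h : ∀ c, DerivedCompleteAt (c * f)) :
    f ∈ (⊥ : Ideal A).jacobson := by
  refine Ideal.mem_jacobson_bot.2 fun y ↦ ?_
  have := (h (-y)).isUnit_one_sub
  convert this using 1
  ring

/-- Derived completeness gives the sums of power series at once, but separatedness needs bounded
torsion: the quotients of `x` by `f ^ n` are compatible only up to `f`-torsion. -/
theorem DerivedCompleteAt.isAdicComplete {f : A} (h : DerivedCompleteAt f)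
    (hf : ∀ (n : ℕ) (x : A), f ^ n * x = 0 → f * x = 0) : IsAdicComplete (Ideal.span {f}) A := by
  refine isAdicComplete_span_iff.2 ⟨fun x hx ↦ ?_, fun g ↦ ?_⟩
  · choose y hy using hx
    have h1 (n : ℕ) : f * (y n - f * y (n + 1)) = 0 := by
      refine hf n _ ?_
      rw [mul_sub, ← hy n, ← mul_assoc, ← pow_succ, ← hy (n + 1), sub_self]
    have : (fun n ↦ f * y (n + 1)) = 0 := by
      refine h.1 ?_
      ext n
      simp only [Pi.zero_apply, mul_zero, sub_zero]
      rw [← mul_sub, h1]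
    rw [hy 1, pow_one]
    exact congrFun this 0
  · obtain ⟨y, hy⟩ := h.2 g
    refine ⟨y 0, fun n ↦ ⟨-y n, ?_⟩⟩
    have : ∀ n, ∑ k ∈ Finset.range n, f ^ k * g k = y 0 - f ^ n * y n := by
      intro n
      induction n with
      | zero => simp
      | succ n ih =>
        rw [Finset.sum_range_succ, ih, ← hy]
        ring
    rw [this]
    ring

/-- Derived completeness passes to the cokernel of multiplication by any `ϖ`: an error divisible by
`ϖ` is absorbed by solving the system for its quotient by `ϖ`. -/
theorem DerivedCompleteAt.quotient {f : A} (h : DerivedCompleteAt f) (ϖ : A) :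
    DerivedCompleteAt (Ideal.Quotient.mk (Ideal.span {ϖ}) f) := by
  constructor
  · intro x y hxy
    choose x' hx' using fun n ↦ Ideal.Quotient.mk_surjective (x n)
    choose y' hy' using fun n ↦ Ideal.Quotient.mk_surjective (y n)
    have h1 (n : ℕ) : ϖ ∣ (x' n - y' n) - f * (x' (n + 1) - y' (n + 1)) := by
      have := congrFun hxy n
      simp only [← hx', ← hy'] at this
      rw [← map_mul, ← map_mul, ← map_sub, ← map_sub, Ideal.Quotient.eq,
        Ideal.mem_span_singleton] at this
      convert this using 1
      ring
    choose z hz using h1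
    obtain ⟨w, hw⟩ := h.2 z
    have : (fun n ↦ x' n - y' n) = fun n ↦ ϖ * w n := by
      refine h.1 ?_
      ext n
      simp only [hz n, ← hw]
      ring
    ext n
    rw [← hx', ← hy', Ideal.Quotient.eq, Ideal.mem_span_singleton]
    exact ⟨w n, congrFun this n⟩
  · intro y
    choose y' hy' using fun n ↦ Ideal.Quotient.mk_surjective (y n)
    obtain ⟨x, hx⟩ := h.2 y'
    refine ⟨fun n ↦ Ideal.Quotient.mk _ (x n), ?_⟩
    ext n
    rw [← hy', ← hx, map_sub, map_mul]

/-- Successive approximation: solve the system modulo `ϖ`, divide the error by `ϖ`, repeat, and sum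
the resulting series. -/
theorem DerivedCompleteAt.of_quotient {f ϖ : A} (hc : IsAdicComplete (Ideal.span {ϖ}) A)
    (hϖ : ∀ x : A, ϖ * x = 0 → x = 0)
    (h : DerivedCompleteAt (Ideal.Quotient.mk (Ideal.span {ϖ}) f)) : DerivedCompleteAt f := by
  obtain ⟨hc1, hc2⟩ := isAdicComplete_span_iff.1 hc
  have hinj (m : ℕ) : ∀ x : ℕ → A, (∀ n, x n - f * x (n + 1) = 0) → ∀ n, ϖ ^ m ∣ x n := by
    induction m with
    | zero => simp
    | succ m ih =>
      intro x hx
      have h0 : (fun n ↦ Ideal.Quotient.mk (Ideal.span {ϖ}) (x n)) = 0 := by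
        refine h.1 ?_
        ext n
        simp only [← map_mul, ← map_sub, hx, Pi.zero_apply, map_zero, mul_zero, sub_zero]
      have h1 (n : ℕ) : ϖ ∣ x n := by
        rw [← Ideal.mem_span_singleton, ← Ideal.Quotient.eq_zero_iff_mem]
        exact congrFun h0 n
      choose y hy using h1
      intro n
      rw [hy, pow_succ']
      refine mul_dvd_mul_left _ (ih y (fun n ↦ hϖ _ ?_) n)
      rw [← hx n, hy n, hy (n + 1)]
      ring
  constructor
  · intro x y hxy
    ext n
    refine sub_eq_zero.1 (hc1 _ fun m ↦ hinj m (fun n ↦ x n - y n) (fun n ↦ ?_) n)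
    have := congrFun hxy n
    simp only at this
    linear_combination this
  · intro y
    have hstep (z : ℕ → A) : ∃ x z' : ℕ → A, ∀ n, z n = x n - f * x (n + 1) + ϖ * z' n := by
      obtain ⟨x, hx⟩ := h.2 fun n ↦ Ideal.Quotient.mk _ (z n)
      choose x' hx' using fun n ↦ Ideal.Quotient.mk_surjective (x n)
      have h1 (n : ℕ) : ϖ ∣ z n - (x' n - f * x' (n + 1)) := by
        rw [← Ideal.mem_span_singleton, ← Ideal.Quotient.eq, map_sub, map_mul, hx', hx']
        exact (congrFun hx n).symm
      choose z' hz' using h1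
      exact ⟨x', z', fun n ↦ by rw [← hz']; ring⟩
    choose X Z hXZ using hstep
    let z : ℕ → ℕ → A := fun m ↦ Z^[m] y
    have hz (m : ℕ) : z (m + 1) = Z (z m) := Function.iterate_succ_apply' _ _ _
    choose w hw using fun n ↦ hc2 fun m ↦ X (z m) n
    have hsum (n m : ℕ) : ∑ k ∈ Finset.range m, ϖ ^ k * X (z k) n -
        f * ∑ k ∈ Finset.range m, ϖ ^ k * X (z k) (n + 1) = y n - ϖ ^ m * z m n := by
      induction m with
      | zero => simp [z]
      | succ m ih =>
        rw [Finset.sum_range_succ, Finset.sum_range_succ, hz]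
        have := hXZ (z m) n
        rw [this] at ih
        linear_combination ih
    refine ⟨w, ?_⟩
    ext n
    refine sub_eq_zero.1 (hc1 _ fun m ↦ ?_)
    have h1 := (hw n m).sub ((hw (n + 1) m).mul_left f)
    have h2 := hsum n m
    have h3 : w n - f * w (n + 1) - y n =
      -(∑ k ∈ Finset.range m, ϖ ^ k * X (z k) n - w n -
        f * (∑ k ∈ Finset.range m, ϖ ^ k * X (z k) (n + 1) - w (n + 1))) - ϖ ^ m * z m n := by
      linear_combination h2
    rw [h3]
    exact (h1.neg_right).sub (Dvd.intro _ rfl)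

/-- The elements `f` and `g` define the same topology, so a subsequence of an `f`-adic Cauchy
sequence is `g`-adically Cauchy. -/
theorem isAdicComplete_of_dvd_pow {f g : A} {k : ℕ} (hk : k ≠ 0) (hfg : f ∣ g) (hgf : g ∣ f ^ k)
    (h : IsAdicComplete (Ideal.span {g}) A) : IsAdicComplete (Ideal.span {f}) A := by
  have hpow (n : ℕ) : f ^ n ∣ g ^ n := pow_dvd_pow_of_dvd hfg n
  refine { haus' := fun x hx ↦ h.haus' x fun n ↦ ?_, prec' := fun F hF ↦ ?_ }
  · rw [smodEq_span_singleton_iff]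
    refine (pow_dvd_pow_of_dvd hgf n).trans ?_
    rw [← pow_mul]
    exact smodEq_span_singleton_iff.1 (hx (k * n))
  · obtain ⟨y, hy⟩ := h.prec' (fun n ↦ F (k * n)) (fun {m n} hmn ↦ by
      rw [smodEq_span_singleton_iff]
      refine (pow_dvd_pow_of_dvd hgf m).trans ?_
      rw [← pow_mul]
      exact smodEq_span_singleton_iff.1 (hF (Nat.mul_le_mul_left k hmn)))
    refine ⟨y, fun n ↦ (hF (Nat.le_mul_of_pos_left n (Nat.pos_of_ne_zero hk))).trans ?_⟩
    exact smodEq_span_singleton_iff.2 ((hpow n).trans (smodEq_span_singleton_iff.1 (hy n)))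

end Completeness

/-! ### Perfections in characteristic `p`. -/

section CharP

variable {p : ℕ} [Fact p.Prime]

/-- A thickening of a perfect ring by an ideal killed by a power of Frobenius has a section. -/
theorem exists_section_of_perfect {C D : Type*} [CommRing C] [CharP C p] [CommRing D]
    {g : C →+* D} (hg : Function.Surjective g) {k : ℕ} (hN : ∀ x, g x = 0 → x ^ p ^ k = 0)
    (hbij : Function.Bijective fun x : D ↦ x ^ p) :
    ∃ σ : D →+* C, ∀ x, g (σ x) = x := by
  -- The `p ^ k`-power map of `C` factors through `D`. Followed by `g` it is the `k`-fold Frobenius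
  -- of `D`, so precomposing with the inverse of that Frobenius gives the section.
  let h : D →+* C := RingHom.liftOfSurjective g hg ⟨iterateFrobenius C p k, fun x hx ↦ by
    rw [RingHom.mem_ker, iterateFrobenius_def, hN x hx]⟩
  have hh (x : C) : h (g x) = x ^ p ^ k := RingHom.liftOfSurjective_comp_apply ..
  let F : D →+* D := g.comp h
  have hF : ⇑F = (fun x : D ↦ x ^ p)^[k] := by
    ext x
    obtain ⟨x, rfl⟩ := hg x
    rw [pow_iterate]
    simp [F, hh]
  have hFb : Function.Bijective F := hF ▸ hbij.iterate k
  let e := RingEquiv.ofBijective F hFb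
  exact ⟨h.comp e.symm, fun x ↦ e.apply_symm_apply x⟩

/-- Each element of `T` is a `p ^ k`-th power, and raising to that power kills the difference of the
two images of the root. -/
theorem ringHom_eq_of_comp_eq {T C D : Type*} [CommRing T] [CharP T p] [PerfectRing T p]
    [CommRing C] [CharP C p] [CommRing D] {g : C →+* D} {k : ℕ}
    (hN : ∀ x, g x = 0 → x ^ p ^ k = 0) {f f' : T →+* C} (h : ∀ t, g (f t) = g (f' t)) :
    f = f' := by
  ext t
  obtain ⟨s, rfl⟩ := (bijective_iterateFrobenius (R := T) (p := p) (n := k)).2 t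
  rw [iterateFrobenius_def, map_pow, map_pow, ← sub_eq_zero, ← sub_pow_char_pow]
  exact hN _ (by rw [map_sub, h s, sub_self])

/-- The perfection does not change under thickenings killed by a power of Frobenius. -/
theorem bijective_comp_coeff {C D : Type*} [CommRing C] [CharP C p] [CommRing D]
    {g : C →+* D} (hg : Function.Surjective g) {k : ℕ} (hN : ∀ x, g x = 0 → x ^ p ^ k = 0)
    (hbij : Function.Bijective fun x : D ↦ x ^ p) :
    Function.Bijective (g.comp (Perfection.coeff C p 0)) := by
  have hpow : ∀ (n : ℕ), Function.Bijective fun x : D ↦ x ^ p ^ n := fun n ↦ by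
    have := hbij.iterate n
    rwa [pow_iterate] at this
  constructor
  · rw [injective_iff_map_eq_zero]
    intro t ht
    have h0 (n : ℕ) : g (Perfection.coeff C p n t) = 0 := by
      refine (hpow n).1 ?_
      simp only [zero_pow (pow_ne_zero n (Fact.out : p.Prime).ne_zero)]
      rw [← map_pow, ← ht]
      have : Perfection.coeff C p n t ^ p ^ n = Perfection.coeff C p 0 t := by
        simpa using Perfection.coeffMonoidHom_pow_p_pow' t 0 n
      simp [this]
    ext n
    rw [map_zero, ← hN _ (h0 (n + k))]
    exact (Perfection.coeffMonoidHom_pow_p_pow' t n k).symm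
  · intro s
    choose r hr using fun n ↦ (hpow n).2 s
    simp only at hr
    choose c hc using fun n ↦ hg (r n)
    have hr' (n : ℕ) : r (n + 1) ^ p = r n := (hpow n).1 (by
      simp only [← pow_mul, ← pow_succ', hr])
    -- The power `p ^ k` removes the dependence on the chosen lifts `c`; the index shift by `k`
    -- compensates for it.
    refine ⟨⟨fun n ↦ c (n + k) ^ p ^ k, fun n ↦ ?_⟩, ?_⟩
    · rw [← pow_mul, ← pow_succ, pow_succ', pow_mul, ← sub_eq_zero, ← sub_pow_char_pow]
      apply hN
      rw [map_sub, map_pow, hc, hc, sub_eq_zero, ← hr' (n + k)]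
      congr 2
      omega
    · change g (c (0 + k) ^ p ^ k) = s
      rw [map_pow, hc, zero_add, hr]

/-- A perfect ring which is adically complete along `a` is the perfection of its quotients
between `T / a ^ m` and `T / a`. -/
theorem bijective_perfectionLift {T C : Type*} [CommRing T] [CharP T p] [PerfectRing T p]
    [CommRing C] [CharP C p] {f : T →+* C} (hf : Function.Surjective f) {a : T}
    (ha : IsAdicComplete (Ideal.span {a}) T) (hker : ∀ t, f t = 0 → a ∣ t) {m : ℕ}
    (hm : f a ^ m = 0) : Function.Bijective (Perfection.lift p T C f) := by
  have hcoeff (n : ℕ) (t : T) :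
      Perfection.coeff C p n (Perfection.lift p T C f (t ^ p ^ n)) = f t := by
    rw [map_pow, map_pow]
    have h1 := Perfection.coeffMonoidHom_pow_p_pow' (Perfection.lift p T C f t) 0 n
    rw [zero_add] at h1
    refine h1.trans ?_
    have : (Perfection.lift p T C).symm (Perfection.lift p T C f) = f := by simp
    exact congrArg (fun g : T →+* C ↦ g t) this
  have hroot (n : ℕ) (t : T) : ∃ s, s ^ p ^ n = t := by
    obtain ⟨s, hs⟩ := (bijective_iterateFrobenius (R := T) (p := p) (n := n)).2 t
    exact ⟨s, by rwa [iterateFrobenius_def] at hs⟩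
  have hp1 : 1 < p := (Fact.out : p.Prime).one_lt
  constructor
  · rw [injective_iff_map_eq_zero]
    intro t ht
    refine (isAdicComplete_span_iff.1 ha).1 t fun n ↦ ?_
    obtain ⟨s, rfl⟩ := hroot n t
    have h1 := hcoeff n s
    rw [ht, map_zero] at h1
    exact (pow_dvd_pow a (Nat.lt_pow_self hp1).le).trans (pow_dvd_pow_of_dvd (hker s h1.symm) _)
  · intro c
    choose s hs using fun n ↦ hf (Perfection.coeff C p n c)
    have h1 (n : ℕ) : a ∣ s (n + 1) ^ p - s n := by
      apply hker
      rw [map_sub, map_pow, hs, hs, sub_eq_zero]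
      exact Perfection.coeff_pow_p' c n
    have h2 (n : ℕ) : a ^ n ∣ s (n + 1) ^ p ^ (n + 1) - s n ^ p ^ n := by
      rw [pow_succ', pow_mul, ← sub_pow_char_pow]
      exact (pow_dvd_pow a (Nat.lt_pow_self hp1).le).trans (pow_dvd_pow_of_dvd (h1 n) _)
    choose g hg using h2
    -- The exponent `p ^ n`, sharper than the `n` used to form the limit, allows `p ^ n`-th roots of
    -- the divisibility to be taken later.
    have h3 (j n : ℕ) : a ^ p ^ n ∣ s (n + j) ^ p ^ (n + j) - s n ^ p ^ n := by
      induction j with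
      | zero => simp
      | succ j ih =>
        have : a ^ p ^ n ∣ s (n + j + 1) ^ p ^ (n + j + 1) - s (n + j) ^ p ^ (n + j) := by
          rw [pow_succ' p (n + j), pow_mul, ← sub_pow_char_pow]
          exact (pow_dvd_pow a (Nat.pow_le_pow_right hp1.le (Nat.le_add_right n j))).trans
            (pow_dvd_pow_of_dvd (h1 _) _)
        have := this.add ih
        rwa [sub_add_sub_cancel] at this
    obtain ⟨y, hy⟩ := (isAdicComplete_span_iff.1 ha).2 g
    have h4 (n : ℕ) : a ^ n ∣ s n ^ p ^ n - (s 0 ^ p ^ 0 + y) := by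
      have := hy n
      simp_rw [← hg] at this
      rw [Finset.sum_range_sub (fun n ↦ s n ^ p ^ n)] at this
      convert this using 1
      ring
    set t := s 0 ^ p ^ 0 + y with ht
    refine ⟨t, ?_⟩
    have h5 (n : ℕ) : a ^ p ^ n ∣ s n ^ p ^ n - t := by
      have h6 := h4 (n + p ^ n)
      have h7 := (h3 (p ^ n) n)
      have h8 := (pow_dvd_pow a (Nat.le_add_left (p ^ n) n)).trans h6
      have := h8.sub h7
      rwa [sub_sub_sub_cancel_left, ] at this
    -- Working at level `n + r`, the approximation and the root `u` of the limit differ by a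
    -- multiple of `a`; its `p ^ r`-th power vanishes under `f` because `f a ^ m = 0`.
    obtain ⟨r, hr⟩ : ∃ r, m ≤ p ^ r := ⟨m, (Nat.lt_pow_self hp1).le⟩
    ext n
    obtain ⟨u, hu⟩ := hroot (n + r) t
    have h6 : a ∣ s (n + r) - u := by
      obtain ⟨z, hz⟩ := h5 (n + r)
      rw [← hu, ← sub_pow_char_pow] at hz
      obtain ⟨z', rfl⟩ := hroot (n + r) z
      rw [← mul_pow] at hz
      refine ⟨z', (bijective_iterateFrobenius (R := T) (p := p) (n := n + r)).1 ?_⟩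
      simpa only [iterateFrobenius_def] using hz
    have h7 : f (s (n + r) ^ p ^ r) = f (u ^ p ^ r) := by
      rw [← sub_eq_zero, ← map_sub, ← sub_pow_char_pow, map_pow]
      obtain ⟨z, hz⟩ := h6
      rw [hz, map_mul, mul_pow, pow_eq_zero_of_le hr hm, zero_mul]
    have h8 : t = (u ^ p ^ r) ^ p ^ n := by
      rw [← pow_mul, ← pow_add, add_comm r n, hu]
    rw [h8, hcoeff, ← h7, map_pow, hs]
    exact Perfection.coeffMonoidHom_pow_p_pow' c n r

end CharP

/-! ### Witt vectors of perfect rings and distinguished elements. -/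

section Witt

variable {p : ℕ} [Fact p.Prime] {T : Type*} [CommRing T] [CharP T p] [PerfectRing T p]

local notation "τ" => WittVector.teichmuller p

theorem exists_eq_teichmuller_add (x : WittVector p T) :
    ∃ y, x = τ (x.coeff 0) + p * y := by
  have h : (x - τ (x.coeff 0)).coeff 0 = 0 := by
    rw [← WittVector.constantCoeff_apply, map_sub]
    simp
  rw [← WittVector.mem_span_p_iff_coeff_zero_eq_zero, Ideal.mem_span_singleton] at h
  obtain ⟨y, hy⟩ := h
  exact ⟨y, by rw [← hy]; ring⟩

theorem p_mem_jacobson_wittVector : (p : WittVector p T) ∈ (⊥ : Ideal (WittVector p T)).jacobson :=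
  mem_jacobson_of_isAdicComplete inferInstance

theorem isUnit_of_isUnit_coeff_zero {x : WittVector p T} (h : IsUnit (x.coeff 0)) :
    IsUnit x := by
  obtain ⟨y, hy⟩ := exists_eq_teichmuller_add x
  refine isUnit_of_sub_mem_jacobson (v := τ (x.coeff 0)) (h.map _) ?_
  nth_rewrite 1 [hy]
  rw [add_sub_cancel_left]
  exact Ideal.mul_mem_right _ _ p_mem_jacobson_wittVector

theorem teichmuller_mem_jacobson {c : T} (h : c ∈ (⊥ : Ideal T).jacobson) :
    τ c ∈ (⊥ : Ideal (WittVector p T)).jacobson := by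
  refine Ideal.mem_jacobson_bot.2 fun y ↦ isUnit_of_isUnit_coeff_zero ?_
  rw [← WittVector.constantCoeff_apply, map_add, map_mul]
  simpa using Ideal.mem_jacobson_bot.1 h (y.coeff 0)

theorem wittVector_p_mul_cancel {x y : WittVector p T} (h : p * x = p * y) : x = y := by
  rw [← sub_eq_zero]
  refine WittVector.eq_zero_of_p_mul_eq_zero _ ?_
  rw [mul_comm, mul_sub, h, sub_self]

/-- A factor of the distinguished element `p - [c] y` with topologically nilpotent cofactor is
a unit. -/
theorem isUnit_of_p_sub_eq_mul {c : T} (hc : c ∈ (⊥ : Ideal T).jacobson)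
    {y h ξ : WittVector p T} (hξ : ξ.coeff 0 ∈ (⊥ : Ideal T).jacobson)
    (heq : p - τ c * y = h * ξ) : IsUnit h := by
  obtain ⟨y', hy⟩ := exists_eq_teichmuller_add y
  obtain ⟨h', hh⟩ := exists_eq_teichmuller_add h
  obtain ⟨ξ', hξ'⟩ := exists_eq_teichmuller_add ξ
  -- For `p = 2` the Teichmüller lift of `-1` is not `-1`, so `-1` needs an expansion of its own.
  obtain ⟨m, hm⟩ := exists_eq_teichmuller_add (-1 : WittVector p T)
  set y₀ := y.coeff 0
  set h₀ := h.coeff 0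
  set ξ₀ := ξ.coeff 0
  have hm0 : (-1 : WittVector p T).coeff 0 = -1 := by
    rw [← WittVector.constantCoeff_apply, map_neg, map_one]
  rw [hm0] at hm
  have e0 : -(c * y₀) = h₀ * ξ₀ := by
    have := congrArg (WittVector.constantCoeff (p := p) (R := T)) heq
    rw [map_sub, map_mul, map_mul] at this
    simpa using this
  have e1 : τ (-1) * (τ c * τ y₀) = τ h₀ * τ ξ₀ := by
    rw [← map_mul, ← map_mul, ← map_mul, ← e0]
    ring_nf
  -- The Teichmüller parts of both sides cancel up to the correction `m`, after which the equation
  -- can be divided by `p`. Its zeroth coefficient gives `h₀ * ξ'.coeff 0 = 1` modulo the Jacobson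
  -- radical.
  have e2 : 1 - τ c * y' + τ c * τ y₀ * m = τ h₀ * ξ' + τ ξ₀ * h' + p * h' * ξ' := by
    apply wittVector_p_mul_cancel
    rw [hy, hh, hξ'] at heq
    linear_combination heq - e1 - τ c * τ y₀ * hm
  have e3 := congrArg (WittVector.constantCoeff (p := p) (R := T)) e2
  simp only [map_add, map_sub, map_mul, map_one, map_natCast, CharP.cast_eq_zero, zero_mul,
    add_zero, WittVector.constantCoeff_apply, WittVector.teichmuller_coeff_zero] at e3
  refine isUnit_of_isUnit_coeff_zero
    (isUnit_of_mul_isUnit_left (y := ξ'.coeff 0) (isUnit_of_sub_mem_jacobson isUnit_one ?_))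
  have : h₀ * ξ'.coeff 0 - 1 = c * (y₀ * m.coeff 0 - y'.coeff 0) - ξ₀ * h'.coeff 0 := by
    linear_combination -e3
  rw [this]
  exact sub_mem (Ideal.mul_mem_right _ _ hc) (Ideal.mul_mem_right _ _ hξ)

/-- Ring homomorphisms out of the Witt vectors of a perfect ring into a `p`-adically separated
ring are determined modulo `p`. -/
theorem wittVector_ringHom_ext {R : Type*} [CommRing R]
    (hR : ∀ x : R, (∀ n, (p : R) ^ n ∣ x) → x = 0) {f g : WittVector p T →+* R}
    (h : ∀ t : T, (p : R) ∣ f (τ t) - g (τ t)) : f = g := by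
  ext x
  rw [← sub_eq_zero]
  refine hR _ fun n ↦ ?_
  have key : (Ideal.Quotient.mk (Ideal.span {(p : R) ^ n})).comp f =
      (Ideal.Quotient.mk (Ideal.span {(p : R) ^ n})).comp g := by
    refine WittVector.eq_of_apply_teichmuller_eq _ _ ⟨n, ?_⟩ fun t ↦ ?_
    · rw [← map_natCast (Ideal.Quotient.mk _), ← map_pow]
      exact Ideal.Quotient.eq_zero_iff_mem.2 (Ideal.mem_span_singleton_self _)
    -- A congruence modulo `p` becomes one modulo `p ^ (n + 1)` after raising to the power `p ^ n`,
    -- and `t` is such a power.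
    · obtain ⟨s, rfl⟩ := (bijective_iterateFrobenius (R := T) (p := p) (n := n)).2 t
      simp only [RingHom.comp_apply]
      rw [iterateFrobenius_def, map_pow (τ), map_pow f, map_pow g, Ideal.Quotient.eq,
        Ideal.mem_span_singleton]
      exact (pow_dvd_pow _ n.le_succ).trans (dvd_sub_pow_of_dvd_sub (h s) n)
  have := congrArg (fun φ : WittVector p T →+* _ ↦ φ x) key
  simp only [RingHom.comp_apply] at this
  rwa [Ideal.Quotient.eq, Ideal.mem_span_singleton] at this

end Witt

/-! ### Norms and bases over a base ring. -/

section Norm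

variable {B A : Type*} [CommRing B] [CommRing A] [Algebra B A]

/-- If `A` is free over `B` and `B → A / d` is surjective, then its kernel is generated by the norm
of `d`. -/
theorem dvd_algebraMap_iff_norm_dvd {ι : Type*} [Fintype ι] [DecidableEq ι]
    (v : Module.Basis ι B A) {i₀ : ι} (hv : v i₀ = 1) {d : A}
    (hd : ∀ y : A, ∃ c : B, d ∣ y - algebraMap B A c) (j : B) :
    d ∣ algebraMap B A j ↔ Algebra.norm B d ∣ j := by
  constructor
  · rintro ⟨y, hy⟩
    choose c g hg using fun i ↦ hd (v i)
    -- With `v i = c i + d * g i`, composing `Y` with multiplication by `d` sends `v i₀` to `j` and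
    -- every other `v i` to `v i - c i`. This matrix is triangular up to the order of the basis and
    -- has determinant `j`, so multiplicativity of determinants shows that the norm of `d` divides
    -- `j`.
    let Y : A →ₗ[B] A := v.constr B fun i ↦ if i = i₀ then y else g i
    let M : Matrix ι ι B := fun k i ↦
      if i = i₀ then (if k = i₀ then j else 0) else (if k = i then 1 else if k = i₀ then -c i else 0)
    have hZ : LinearMap.toMatrix v v (LinearMap.mulLeft B d ∘ₗ Y) = M := by
      ext k i
      rw [LinearMap.toMatrix_apply]
      simp only [LinearMap.comp_apply, LinearMap.mulLeft_apply, Y, v.constr_basis, M]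
      split_ifs with h1 h2 h2 h3
      · rw [← hy, Algebra.algebraMap_eq_smul_one, ← hv]
        simp [h2]
      · rw [← hy, Algebra.algebraMap_eq_smul_one, ← hv]
        simp [Ne.symm h2]
      · rw [← hg, Algebra.algebraMap_eq_smul_one, ← hv]
        simp [h1, h2]
      · rw [← hg, Algebra.algebraMap_eq_smul_one, ← hv]
        simp [h1, h3]
      · rw [← hg, Algebra.algebraMap_eq_smul_one, ← hv]
        simp [Ne.symm h2, Ne.symm h3]
    have hM : M.det = j := by
      have : M = (1 : Matrix ι ι B).updateRow i₀ (fun i ↦ if i = i₀ then j else -c i) := by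
        ext k i
        by_cases hk : k = i₀
        · subst hk
          by_cases hi : i = k
          · simp [M, hi]
          · simp [M, hi, Ne.symm hi]
        · by_cases hi : i = i₀
          · subst hi
            simp [M, hk]
          · simp [M, hk, hi, Matrix.one_apply]
      rw [this]
      have h2 := Matrix.cramer_transpose_apply (1 : Matrix ι ι B)
        (fun i ↦ if i = i₀ then j else -c i) i₀
      rw [← h2]
      simp
    have h1 : LinearMap.det (LinearMap.mulLeft B d ∘ₗ Y) = j := by
      rw [← LinearMap.det_toMatrix v, hZ, hM]
    rw [← h1, LinearMap.det_comp]
    exact Dvd.intro _ rfl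
  · rintro ⟨r, rfl⟩
    rw [map_mul]
    refine Dvd.dvd.mul_right ?_ _
    -- The adjugate of multiplication by `d`, applied to `1`, is a cofactor exhibiting the norm as a
    -- multiple of `d`.
    let X := Algebra.leftMulMatrix v d
    have h1 : X * X.adjugate = X.det • 1 := Matrix.mul_adjugate X
    have h2 := congrArg (fun Z ↦ Matrix.toLin v v Z 1) h1
    simp only [Matrix.toLin_mul v v v, map_smul, Matrix.toLin_one, LinearMap.comp_apply,
      LinearMap.smul_apply, LinearMap.id_apply] at h2
    rw [← Algebra.norm_eq_matrix_det, ← Algebra.algebraMap_eq_smul_one] at h2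
    rw [← h2]
    simp only [X, Algebra.leftMulMatrix_apply, Matrix.toLin_toMatrix]
    exact Dvd.intro _ rfl

/-- A totally ramified extension of a `b`-adically complete ring is free on the powers of the
uniformizer. -/
theorem exists_basis_pow {b : B} {ϖ w : A} {e : ℕ} (he : e ≠ 0) (hw : IsUnit w)
    (hb : algebraMap B A b = w * ϖ ^ e)
    (hB : IsAdicComplete (Ideal.span {b}) B)
    (hAtf : ∀ x : A, ϖ * x = 0 → x = 0) (hA : ∀ x : A, (∀ n, ϖ ^ n ∣ x) → x = 0)
    (hsurj : ∀ y : A, ∃ x : B, ϖ ∣ y - algebraMap B A x)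
    (hinj : ∀ x : B, ϖ ∣ algebraMap B A x → b ∣ x) :
    ∃ v : Module.Basis (Fin e) B A, ∀ i, v i = ϖ ^ (i : ℕ) := by
  have hϖb : ϖ ^ e ∣ algebraMap B A b := hb ▸ Dvd.intro_left _ rfl
  have hbϖ : algebraMap B A b ∣ ϖ ^ e := by
    obtain ⟨w', hw'⟩ := hw.exists_right_inv
    exact ⟨w', by rw [hb]; linear_combination -ϖ ^ e * hw'⟩
  have hϖpow : ∀ (n : ℕ) (x : A), ϖ ^ n * x = 0 → x = 0 := by
    intro n
    induction n with
    | zero => simp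
    | succ n ih => exact fun x hx ↦ ih x (hAtf _ (by rw [← mul_assoc, ← pow_succ', hx]))
  have hbA : ∀ x : A, algebraMap B A b * x = 0 → x = 0 := fun x hx ↦ hϖpow e x (by
    refine (hw.mul_right_eq_zero).1 ?_
    rw [← mul_assoc, ← hb, hx])
  -- linear independence
  have hstep : ∀ x : Fin e → B, ∑ i, x i • ϖ ^ (i : ℕ) = 0 → ∀ i, b ∣ x i := by
    intro x hx
    suffices h : ∀ k (hk : k < e), b ∣ x ⟨k, hk⟩ from fun i ↦ h i i.2
    intro k
    induction k using Nat.strong_induction_on with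
    | _ k ih =>
      intro hk
      apply hinj
      -- Terms of index below `k` have coefficients divisible by `b`, hence by `ϖ ^ e` in `A`, and
      -- `k + 1 ≤ e`; terms above `k` carry a factor `ϖ ^ (k + 1)` themselves.
      have h1 : ϖ ^ (k + 1) ∣ ϖ ^ k * algebraMap B A (x ⟨k, hk⟩) := by
        have h2 : ∀ i ∈ Finset.univ.erase (⟨k, hk⟩ : Fin e), ϖ ^ (k + 1) ∣ x i • ϖ ^ (i : ℕ) := by
          intro i hi
          have hik : (i : ℕ) ≠ k := fun h ↦ (Finset.mem_erase.1 hi).1 (Fin.ext h)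
          rw [Algebra.smul_def]
          rcases lt_or_gt_of_ne hik with h | h
          · exact ((pow_dvd_pow ϖ hk).trans (hϖb.trans (map_dvd _ (ih i h i.2)))).mul_right _
          · exact (pow_dvd_pow ϖ h).mul_left _
        have h3 := Finset.dvd_sum h2
        rw [← Finset.add_sum_erase _ _ (Finset.mem_univ (⟨k, hk⟩ : Fin e)), add_eq_zero_iff_eq_neg,
          Algebra.smul_def, mul_comm] at hx
        rw [hx]
        exact h3.neg_right
      obtain ⟨z, hz⟩ := h1
      refine ⟨z, sub_eq_zero.1 (hϖpow k _ ?_)⟩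
      rw [mul_sub, hz]
      ring
  have hpow : ∀ (n : ℕ) (x : Fin e → B), ∑ i, x i • ϖ ^ (i : ℕ) = 0 → ∀ i, b ^ n ∣ x i := by
    intro n
    induction n with
    | zero => simp
    | succ n ih =>
      intro x hx i
      choose y hy using hstep x hx
      rw [hy i, pow_succ']
      refine mul_dvd_mul_left _ (ih y (hbA _ ?_) i)
      rw [← hx, Finset.mul_sum]
      refine Finset.sum_congr rfl fun i _ ↦ ?_
      rw [hy i, Algebra.smul_def, Algebra.smul_def, map_mul, mul_assoc]
  have hli : LinearIndependent B fun i : Fin e ↦ ϖ ^ (i : ℕ) := by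
    rw [Fintype.linearIndependent_iff]
    exact fun x hx i ↦ (isAdicComplete_span_iff.1 hB).1 _ fun n ↦ hpow n x hx i
  -- generation
  let F : (Fin e → B) →ₗ[B] A := Fintype.linearCombination B fun i : Fin e ↦ ϖ ^ (i : ℕ)
  have happrox : ∀ (k : ℕ) (hk : k ≤ e) (y : A), ∃ x : Fin e → B, ϖ ^ k ∣ y - F x := by
    intro k
    induction k with
    | zero => simp
    | succ k ih =>
      intro hk y
      obtain ⟨x, z, hz⟩ := ih (by omega) y
      obtain ⟨c, z', hz'⟩ := hsurj z
      refine ⟨x + Pi.single ⟨k, hk⟩ c, z', ?_⟩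
      have : F (Pi.single ⟨k, hk⟩ c) = c • ϖ ^ k := by
        simp [F, Fintype.linearCombination_apply_single]
      rw [map_add, this, Algebra.smul_def]
      linear_combination hz + ϖ ^ k * hz'
  have happrox' : ∀ y : A, ∃ x : Fin e → B, ∃ z, y = F x + algebraMap B A b * z := by
    intro y
    obtain ⟨x, z, hz⟩ := happrox e le_rfl y
    obtain ⟨r, hr⟩ := hbϖ
    exact ⟨x, r * z, by rw [← mul_assoc, ← hr, ← hz]; ring⟩
  choose X Z hXZ using happrox'
  have hsurjF : Function.Surjective F := by
    intro y
    let z : ℕ → A := fun n ↦ Z^[n] y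
    have hz (n : ℕ) : z (n + 1) = Z (z n) := Function.iterate_succ_apply' _ _ _
    choose s hs using fun i ↦ (isAdicComplete_span_iff.1 hB).2 fun n ↦ X (z n) i
    refine ⟨s, (sub_eq_zero.1 (hA _ fun n ↦ ?_)).symm⟩
    have h1 : ϖ ^ n ∣ algebraMap B A b ^ n :=
      pow_dvd_pow_of_dvd ((dvd_pow_self ϖ he).trans hϖb) n
    refine h1.trans ?_
    have h2 : y = F (∑ k ∈ Finset.range n, b ^ k • X (z k)) + algebraMap B A b ^ n * z n := by
      clear h1
      induction n with
      | zero => simp [z]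
      | succ n ih =>
        rw [Finset.sum_range_succ, map_add, map_smul, hz, Algebra.smul_def, map_pow]
        have := hXZ (z n)
        linear_combination ih + algebraMap B A b ^ n * this
    have h3 : ∃ t : Fin e → B, ∑ k ∈ Finset.range n, b ^ k • X (z k) - s = b ^ n • t := by
      choose t ht using fun i ↦ hs i n
      refine ⟨t, ?_⟩
      ext i
      simp [← ht]
    obtain ⟨t, ht⟩ := h3
    have h4 := congrArg F ht
    rw [map_sub, map_smul, Algebra.smul_def, map_pow] at h4
    exact ⟨F t + z n, by linear_combination h2 + h4⟩
  refine ⟨Module.Basis.mk hli ?_, fun i ↦ Module.Basis.mk_apply _ _ i⟩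
  rw [← Fintype.range_linearCombination]
  exact fun y _ ↦ hsurjF y

end Norm

/-! ### Strict rings, their tilts and primitive elements. -/

section Strict

/-- Strict rings: `ϖ`-torsion free and `ϖ`-adically complete rings with perfect reduction, where
`p` is a unit times a power of `ϖ`. -/
structure IsStrict (p : ℕ) {A : Type*} [CommRing A] (ϖ : A) : Prop where
  torsionFree : ∀ x : A, ϖ * x = 0 → x = 0
  complete : IsAdicComplete (Ideal.span {ϖ}) A
  exists_eq : ∃ (w : A) (e : ℕ), IsUnit w ∧ e ≠ 0 ∧ (p : A) = w * ϖ ^ e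
  perfect : Function.Bijective fun x : A ⧸ Ideal.span {ϖ} ↦ x ^ p

variable {p : ℕ} {A : Type*} [CommRing A] {ϖ : A}

theorem IsStrict.dvd (h : IsStrict p ϖ) : ϖ ∣ (p : A) := by
  obtain ⟨w, e, -, he, hp⟩ := h.exists_eq
  exact hp ▸ (dvd_pow_self ϖ he).mul_left w

theorem IsStrict.isAdicComplete_p (h : IsStrict p ϖ) : IsAdicComplete (Ideal.span {(p : A)}) A :=
  isAdicComplete_of_dvd h.dvd h.complete

/-- The reduction `A / p → A / ϖ`. -/
def reduction {ϖ : A} (h : ϖ ∣ (p : A)) : ModP A p →+* A ⧸ Ideal.span {ϖ} :=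
  Ideal.Quotient.factor (Ideal.span_singleton_le_span_singleton.2 h)

theorem reduction_mk (h : ϖ ∣ (p : A)) (x : A) :
    reduction h (Ideal.Quotient.mk _ x) = Ideal.Quotient.mk _ x := rfl

theorem reduction_surjective (h : ϖ ∣ (p : A)) : Function.Surjective (reduction h) :=
  Ideal.Quotient.factor_surjective _

theorem IsStrict.exists_dvd_pow (h : IsStrict p ϖ) : ∃ k, (p : A) ∣ ϖ ^ k := by
  obtain ⟨w, e, hw, -, hp⟩ := h.exists_eq
  obtain ⟨w', hw'⟩ := hw.exists_right_inv
  exact ⟨e, w', by rw [hp]; linear_combination -ϖ ^ e * hw'⟩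

variable [Fact p.Prime]

theorem pow_eq_zero_of_reduction_eq_zero (h : ϖ ∣ (p : A)) {k : ℕ} (hk : (p : A) ∣ ϖ ^ k)
    (x : ModP A p) (hx : reduction h x = 0) : x ^ p ^ k = 0 := by
  obtain ⟨x, rfl⟩ := Ideal.Quotient.mk_surjective x
  rw [reduction_mk, Ideal.Quotient.eq_zero_iff_mem, Ideal.mem_span_singleton] at hx
  rw [← map_pow, Ideal.Quotient.eq_zero_iff_mem, Ideal.mem_span_singleton]
  exact hk.trans ((pow_dvd_pow ϖ (Nat.lt_pow_self (Fact.out : p.Prime).one_lt).le).trans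
    (pow_dvd_pow_of_dvd hx _))

variable [Fact ¬IsUnit (p : A)]

theorem IsStrict.bijective_reduction_comp_coeff (h : IsStrict p ϖ) :
    Function.Bijective ((reduction h.dvd).comp (PreTilt.coeff (p := p) (O := A) 0)) := by
  obtain ⟨k, hk⟩ := h.exists_dvd_pow
  exact bijective_comp_coeff (reduction_surjective h.dvd)
    (pow_eq_zero_of_reduction_eq_zero h.dvd hk) h.perfect

/-- The tilt of a strict ring is its reduction. -/
def IsStrict.tiltEquiv (h : IsStrict p ϖ) : PreTilt A p ≃+* A ⧸ Ideal.span {ϖ} :=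
  RingEquiv.ofBijective _ h.bijective_reduction_comp_coeff

variable [IsAdicComplete (Ideal.span {(p : A)}) A]

open WittVector in
theorem IsStrict.tiltEquiv_coeff_zero (h : IsStrict p ϖ) (x : WittVector p (PreTilt A p)) :
    h.tiltEquiv (x.coeff 0) = Ideal.Quotient.mk _ (fontaineTheta A p x) := by
  exact (congrArg (reduction h.dvd) (mk_fontaineTheta x)).symm

theorem IsStrict.tiltEquiv_apply (h : IsStrict p ϖ) (t : PreTilt A p) :
    h.tiltEquiv t = Ideal.Quotient.mk _ t.untilt := by
  rw [← WittVector.fontaineTheta_teichmuller, ← h.tiltEquiv_coeff_zero,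
    WittVector.teichmuller_coeff_zero]

variable (h : IsStrict p ϖ)
include h

open WittVector

/-- Together with `IsStrict.p_dvd_of_dvd_fontaineTheta` this identifies `W(A♭) / p` with `A / ϖ`, as
`exists_basis_pow` requires. -/
theorem IsStrict.exists_dvd_sub_fontaineTheta (y : A) :
    ∃ x : WittVector p (PreTilt A p), ϖ ∣ y - fontaineTheta A p x := by
  obtain ⟨t, ht⟩ := h.tiltEquiv.surjective (Ideal.Quotient.mk _ y)
  refine ⟨teichmuller p t, ?_⟩
  rw [← Ideal.mem_span_singleton, ← Ideal.Quotient.eq, ← ht, ← h.tiltEquiv_coeff_zero,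
    teichmuller_coeff_zero]

theorem IsStrict.p_dvd_of_dvd_fontaineTheta (x : WittVector p (PreTilt A p))
    (hx : ϖ ∣ fontaineTheta A p x) : (p : WittVector p (PreTilt A p)) ∣ x := by
  rw [← Ideal.mem_span_singleton, ← Ideal.Quotient.eq_zero_iff_mem, ← h.tiltEquiv_coeff_zero,
    map_eq_zero_iff _ h.tiltEquiv.injective] at hx
  rwa [← Ideal.mem_span_singleton, mem_span_p_iff_coeff_zero_eq_zero]

section Primitive

variable {a : PreTilt A p} {d u : A} (ha : a ∈ (⊥ : Ideal (PreTilt A p)).jacobson)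
  (hu : IsUnit u) (hd : d = a.untilt + ϖ * u)

open Classical in
include ha hu hd in
/-- The quotient of a strict ring by a primitive element `d` of degree one is a quotient of the Witt
vectors of the tilt by a principal ideal. -/
theorem IsStrict.quotient_primitive :
    (∀ y : A, ∃ x : WittVector p (PreTilt A p), d ∣ y - fontaineTheta A p x) ∧
      ∃ x : WittVector p (PreTilt A p), ∀ j, d ∣ fontaineTheta A p j ↔ x ∣ j := by
  let _ : Algebra (WittVector p (PreTilt A p)) A := (fontaineTheta A p).toAlgebra
  obtain ⟨w, e, hw, he, hp⟩ := h.exists_eq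
  obtain ⟨v, hv⟩ := exists_basis_pow (B := WittVector p (PreTilt A p)) (b := p) he hw
    (by rw [map_natCast, hp]) inferInstance h.torsionFree
    (isAdicComplete_span_iff.1 h.complete).1 h.exists_dvd_sub_fontaineTheta
    h.p_dvd_of_dvd_fontaineTheta
  have h1 : ∀ y : A, ∃ x : WittVector p (PreTilt A p), d ∣ y - fontaineTheta A p x := by
    -- Modulo `d` the element `ϖ` is `-a.untilt` divided by `u`. Approximation modulo `ϖ` thus
    -- becomes approximation modulo `[a]`, and Nakayama applies because `A` is finite over the Witt
    -- vectors and `[a]` is in their Jacobson radical.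
    let N : Submodule (WittVector p (PreTilt A p)) A :=
      LinearMap.range (Algebra.linearMap (WittVector p (PreTilt A p)) A) ⊔
        (Ideal.span {d}).restrictScalars _
    have hfin : Module.Finite (WittVector p (PreTilt A p)) A := Module.Finite.of_basis v
    have hN : (⊤ : Submodule (WittVector p (PreTilt A p)) A) ≤ N := by
      refine Submodule.le_of_le_smul_of_le_jacobson_bot (I := Ideal.span {teichmuller p a})
        hfin.fg_top ?_ fun y _ ↦ ?_
      · rw [Ideal.span_singleton_le_iff_mem]
        exact teichmuller_mem_jacobson ha
      · obtain ⟨x, z, hz⟩ := h.exists_dvd_sub_fontaineTheta y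
        obtain ⟨u', hu'⟩ := hu.exists_right_inv
        have : y = (fontaineTheta A p x + d * (u' * z)) + teichmuller p a • (-(u' * z)) := by
          rw [Algebra.smul_def]
          change _ = _ + fontaineTheta A p (teichmuller p a) * _
          rw [fontaineTheta_teichmuller]
          linear_combination hz - ϖ * z * hu' - u' * z * hd
        rw [this]
        refine Submodule.add_mem_sup (Submodule.add_mem_sup ⟨x, rfl⟩ ?_) ?_
        · exact Ideal.mul_mem_right _ _ (Ideal.mem_span_singleton_self d)
        · exact Submodule.smul_mem_smul (Ideal.mem_span_singleton_self _) trivial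
    intro y
    obtain ⟨_, ⟨x, rfl⟩, z, hz, hxz⟩ := Submodule.mem_sup.1 (hN (Submodule.mem_top (x := y)))
    refine ⟨x, ?_⟩
    rw [← hxz]
    change d ∣ fontaineTheta A p x + z - fontaineTheta A p x
    rw [add_sub_cancel_left]
    exact Ideal.mem_span_singleton.1 hz
  exact ⟨h1, _, dvd_algebraMap_iff_norm_dvd v (i₀ := ⟨0, Nat.pos_of_ne_zero he⟩)
    (by rw [hv, pow_zero]) h1⟩

-- This supplies a distinguished element in the kernel of `W(A♭) → A / d`: modulo `d`, `p = w * ϖ ^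
-- e` is a multiple of `a.untilt ^ e`, with a cofactor that lifts to the Witt vectors.
include ha hu hd in
theorem IsStrict.exists_dvd_fontaineTheta_p_sub :
    ∃ (m : ℕ) (_ : m ≠ 0) (Z : WittVector p (PreTilt A p)),
      d ∣ fontaineTheta A p (p - teichmuller p (a ^ m) * Z) := by
  obtain ⟨w, e, hw, he, hp⟩ := h.exists_eq
  obtain ⟨u', hu'⟩ := hu.exists_right_inv
  obtain ⟨Z, hZ⟩ := (h.quotient_primitive ha hu hd).1 (w * (-u') ^ e)
  refine ⟨e, he, Z, ?_⟩
  rw [map_sub, map_mul, map_natCast, fontaineTheta_teichmuller, map_pow]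
  have h1 : d ∣ ϖ - a.untilt * -u' := ⟨u', by linear_combination -ϖ * hu' - u' * hd⟩
  have h2 : d ∣ ϖ ^ e - (a.untilt * -u') ^ e := h1.trans (sub_dvd_pow_sub_pow _ _ e)
  have h3 : (p : A) - a.untilt ^ e * fontaineTheta A p Z =
      w * (ϖ ^ e - (a.untilt * -u') ^ e) +
        a.untilt ^ e * (w * (-u') ^ e - fontaineTheta A p Z) := by
    rw [hp, mul_pow]
    ring
  rw [h3]
  exact (h2.mul_left _).add (hZ.mul_left _)

end Primitive

end Strict

/-! ### Functoriality of tilts and of Fontaine's map. -/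

section TiltMap

variable {p : ℕ} [Fact p.Prime] {A R : Type*} [CommRing A] [CommRing R]

theorem exists_pow_eq_of_perfect {T : Type*} [CommRing T] [CharP T p] [PerfectRing T p] (t : T) :
    ∃ s, s ^ p = t := by
  obtain ⟨s, hs⟩ := (bijective_frobenius (R := T) (p := p)).2 t
  exact ⟨s, hs⟩

/-- The reduction modulo `p` of a ring homomorphism. -/
def modPMap (p : ℕ) (θ : A →+* R) : ModP A p →+* ModP R p :=
  Ideal.quotientMap _ θ (by
    rw [Ideal.span_singleton_le_iff_mem, Ideal.mem_comap, map_natCast]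
    exact Ideal.mem_span_singleton_self _)

omit [Fact p.Prime] in
theorem modPMap_mk (θ : A →+* R) (x : A) :
    modPMap p θ (Ideal.Quotient.mk _ x) = Ideal.Quotient.mk _ (θ x) := rfl

variable [Fact ¬IsUnit (p : A)] [Fact ¬IsUnit (p : R)]

/-- The map induced on tilts by a ring homomorphism. -/
def tiltMap (p : ℕ) [Fact p.Prime] [Fact ¬IsUnit (p : A)] [Fact ¬IsUnit (p : R)] (θ : A →+* R) :
    PreTilt A p →+* PreTilt R p :=
  Perfection.map p (modPMap p θ)

theorem coeff_tiltMap (θ : A →+* R) (n : ℕ) (t : PreTilt A p) :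
    PreTilt.coeff n (tiltMap p θ t) = modPMap p θ (PreTilt.coeff n t) := rfl

variable [IsAdicComplete (Ideal.span {(p : A)}) A]

theorem coeff_zero_tiltMap (θ : A →+* R) (t : PreTilt A p) :
    PreTilt.coeff 0 (tiltMap p θ t) = Ideal.Quotient.mk (Ideal.span {(p : R)}) (θ t.untilt) := by
  rw [coeff_tiltMap, ← modPMap_mk]
  exact congrArg (modPMap p θ) (PreTilt.mk_untilt_eq_coeff_zero t).symm

variable [IsAdicComplete (Ideal.span {(p : R)}) R]

open WittVector

theorem fontaineTheta_map_tiltMap (θ : A →+* R) (x : WittVector p (PreTilt A p)) :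
    fontaineTheta R p (WittVector.map (tiltMap p θ) x) = θ (fontaineTheta A p x) := by
  have hR : IsAdicComplete (Ideal.span {(p : R)}) R := inferInstance
  have := wittVector_ringHom_ext (isAdicComplete_span_iff.1 hR).1
    (f := (fontaineTheta R p).comp (WittVector.map (tiltMap p θ)))
    (g := θ.comp (fontaineTheta A p)) fun t ↦ by
      simp only [RingHom.comp_apply, map_teichmuller, fontaineTheta_teichmuller]
      rw [← Ideal.mem_span_singleton, ← Ideal.Quotient.eq]
      exact (PreTilt.mk_untilt_eq_coeff_zero _).trans (coeff_zero_tiltMap θ t)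
  exact congrArg (fun f : _ →+* R ↦ f x) this

/-- An isomorphism of tilts identifies the Witt vectors, and naturality turns Fontaine's map of `R`
into `θ` after that of `A`. -/
theorem isPrincipal_ker_fontaineTheta_iff {θ : A →+* R}
    (hθ : Function.Bijective (tiltMap p θ)) :
    (RingHom.ker (fontaineTheta R p)).IsPrincipal ↔
      ∃ x, ∀ j, θ (fontaineTheta A p j) = 0 ↔ x ∣ j := by
  have hb : Function.Bijective (WittVector.map (p := p) (tiltMap p θ)) :=
    ⟨WittVector.map_injective _ hθ.1, WittVector.map_surjective _ hθ.2⟩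
  let E := RingEquiv.ofBijective _ hb
  constructor
  · rintro ⟨ξ, hξ⟩
    obtain ⟨x, rfl⟩ := hb.2 ξ
    refine ⟨x, fun j ↦ ?_⟩
    rw [← fontaineTheta_map_tiltMap, ← RingHom.mem_ker, hξ, ← Ideal.span,
      Ideal.mem_span_singleton]
    exact map_dvd_iff E
  · rintro ⟨x, hx⟩
    refine ⟨E x, ?_⟩
    ext j
    obtain ⟨j, rfl⟩ := hb.2 j
    rw [RingHom.mem_ker, fontaineTheta_map_tiltMap, hx, ← Ideal.span, Ideal.mem_span_singleton]
    exact (map_dvd_iff E).symm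

end TiltMap

/-! ### Quotients of strict rings by primitive elements. -/

section Primitive

variable {p : ℕ} [Fact p.Prime] {A : Type*} [CommRing A] {ϖ : A}

theorem isPerfectoidRing_of_subsingleton (R : Type*) [CommRing R] [Subsingleton R] :
    IsPerfectoidRing p R where
  exists_complete := ⟨0, ⟨0, Subsingleton.elim _ _⟩, inferInstance⟩
  surjective_frobenius x := by
    obtain ⟨x, rfl⟩ := Ideal.Quotient.mk_surjective x
    exact ⟨0, by rw [Subsingleton.elim x 0, map_zero]; exact zero_pow (Fact.out : p.Prime).ne_zero⟩
  isPrincipal_ker_theta hp := (hp (isUnit_of_subsingleton _)).elim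

omit [Fact p.Prime] in
theorem IsStrict.not_isUnit (h : IsStrict p ϖ) [Nontrivial A] : ¬IsUnit (p : A) := fun hu ↦
  not_subsingleton A (subsingleton_of_isUnit hu h.isAdicComplete_p)

/-- The reduction is perfect, hence reduced. -/
theorem IsStrict.dvd_of_pow_dvd (h : IsStrict p ϖ) {n : ℕ} {x : A}
    (hx : ϖ ∣ x ^ n) : ϖ ∣ x := by
  rw [← Ideal.mem_span_singleton, ← Ideal.Quotient.eq_zero_iff_mem, map_pow] at hx
  have hp1 : 1 < p := (Fact.out : p.Prime).one_lt
  have := h.perfect.iterate n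
  rw [pow_iterate] at this
  rw [← Ideal.mem_span_singleton, ← Ideal.Quotient.eq_zero_iff_mem]
  refine this.1 ?_
  simp only [zero_pow (pow_ne_zero n (by omega : p ≠ 0))]
  exact pow_eq_zero_of_le (Nat.lt_pow_self hp1).le hx

variable [Fact ¬IsUnit (p : A)] [IsAdicComplete (Ideal.span {(p : A)}) A]
  (h : IsStrict p ϖ) {a : PreTilt A p} {d u : A} (hu : IsUnit u) (hd : d = a.untilt + ϖ * u)
include h hu hd

/-- Multiplication by `d` loses at most one power of `ϖ`; hence `d` is a nonzerodivisor and its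
ideal is closed. Let `y = t.untilt + ϖ * y'`. If `ϖ` divides `d * y` then `a * t = 0` in the tilt,
so the product of the untilts is exactly `0` and `d * y = ϖ * (a.untilt * y' + u * y)`. Multiplying
the bracket by `y` shows that `ϖ` divides `u * y ^ 2`, hence `y` because the reduction is reduced.
-/
theorem IsStrict.pow_dvd_of_pow_succ_dvd_primitive_mul (n : ℕ) :
    ∀ y : A, ϖ ^ (n + 1) ∣ d * y → ϖ ^ n ∣ y := by
  induction n with
  | zero => simp
  | succ n ih =>
    intro y hy
    obtain ⟨t, ht⟩ := h.tiltEquiv.surjective (Ideal.Quotient.mk _ y)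
    have h1 : ϖ ∣ y - t.untilt := by
      rw [← Ideal.mem_span_singleton, ← Ideal.Quotient.eq, ← ht, h.tiltEquiv_apply]
    obtain ⟨y', hy'⟩ := h1
    have hϖd : ϖ ∣ d * y := (dvd_pow_self ϖ (by omega)).trans hy
    have hat : a * t = 0 := by
      apply h.tiltEquiv.injective
      rw [map_mul, map_zero, ht, h.tiltEquiv_apply, ← map_mul, Ideal.Quotient.eq_zero_iff_mem,
        Ideal.mem_span_singleton]
      have := hϖd.sub (Dvd.intro (u * y) rfl)
      convert this using 1
      rw [hd]
      ring
    have hat' : a.untilt * t.untilt = 0 := by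
      rw [← map_mul, hat]
      have : (0 : PreTilt A p).untilt = 0 := by
        rw [← WittVector.fontaineTheta_teichmuller, WittVector.teichmuller_zero, map_zero]
      exact this
    have h2 : d * y = ϖ * (a.untilt * y' + u * y) := by
      rw [hd]
      linear_combination a.untilt * hy' + hat'
    have h3 : ϖ ^ (n + 1) ∣ a.untilt * y' + u * y := by
      obtain ⟨z, hz⟩ := hy
      refine ⟨z, sub_eq_zero.1 (h.torsionFree _ ?_)⟩
      rw [mul_sub, ← h2, hz]
      ring
    have h4 : ϖ ∣ u * y ^ 2 := by
      have h5 := ((dvd_pow_self ϖ (Nat.succ_ne_zero n)).trans h3).mul_right y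
      have h6 : u * y ^ 2 = (a.untilt * y' + u * y) * y - ϖ * (a.untilt * y' ^ 2) := by
        linear_combination -a.untilt * y' * hy' - y' * hat'
      rw [h6]
      exact h5.sub (Dvd.intro _ rfl)
    obtain ⟨y'', rfl⟩ := h.dvd_of_pow_dvd (hu.dvd_mul_left.1 h4)
    rw [pow_succ']
    refine mul_dvd_mul_left _ (ih y'' ?_)
    obtain ⟨z, hz⟩ := hy
    refine ⟨z, sub_eq_zero.1 (h.torsionFree _ ?_)⟩
    linear_combination hz

theorem IsStrict.quotient_primitive_isAdicComplete {R : Type*} [CommRing R] {θ : A →+* R}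
    (hθ : Function.Surjective θ) (hker : ∀ x, θ x = 0 ↔ d ∣ x) :
    IsAdicComplete (Ideal.span {θ ϖ}) R := by
  obtain ⟨hc1, hc2⟩ := isAdicComplete_span_iff.1 h.complete
  have key := h.pow_dvd_of_pow_succ_dvd_primitive_mul hu hd
  refine isAdicComplete_span_iff.2 ⟨fun x hx ↦ ?_, fun g ↦ ?_⟩
  · obtain ⟨y, rfl⟩ := hθ x
    have h1 (n : ℕ) : ∃ z v, y = ϖ ^ n * z + d * v := by
      obtain ⟨z, hz⟩ := hx n
      obtain ⟨z, rfl⟩ := hθ z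
      rw [← map_pow, ← map_mul, ← sub_eq_zero, ← map_sub, hker] at hz
      obtain ⟨v, hv⟩ := hz
      exact ⟨z, v, by rw [← hv]; ring⟩
    choose z v hzv using h1
    -- The cofactors of `d` form a Cauchy sequence because dividing by `d` costs only one power of
    -- `ϖ`; the limit exhibits `y` as a multiple of `d`.
    have h2 (n : ℕ) : ϖ ^ n ∣ v (n + 1 + 1) - v (n + 1) := by
      refine key n _ ⟨z (n + 1) - ϖ * z (n + 1 + 1), ?_⟩
      linear_combination hzv (n + 1) - hzv (n + 1 + 1)
    choose g hg using h2
    obtain ⟨L, hL⟩ := hc2 g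
    have h3 (n : ℕ) : ϖ ^ n ∣ v (n + 1) - (v 1 + L) := by
      have := hL n
      simp_rw [← hg] at this
      rw [Finset.sum_range_sub (fun n ↦ v (n + 1))] at this
      convert this using 1
      ring
    rw [hker]
    refine ⟨v 1 + L, sub_eq_zero.1 (hc1 _ fun n ↦ ?_)⟩
    have : y - d * (v 1 + L) = ϖ ^ n * (ϖ * z (n + 1)) + d * (v (n + 1) - (v 1 + L)) := by
      linear_combination hzv (n + 1)
    rw [this]
    exact (Dvd.intro _ rfl).add ((h3 n).mul_left d)
  · choose g' hg' using fun n ↦ hθ (g n)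
    obtain ⟨y, hy⟩ := hc2 g'
    refine ⟨θ y, fun n ↦ ?_⟩
    have := map_dvd θ (hy n)
    simpa only [map_sub, map_sum, map_mul, map_pow, hg'] using this

/-- The map `t ↦ θ t.untilt` modulo `p` presents `R / p` as a quotient of `A♭` whose kernel lies in
`(a)` and contains a power of `a`. Completeness of `A♭` along `a` then makes it the perfection of
this quotient. -/
theorem IsStrict.bijective_tiltMap
    (ha : IsAdicComplete (Ideal.span {a}) (PreTilt A p)) {R : Type*} [CommRing R]
    [Fact ¬IsUnit (p : R)] [IsAdicComplete (Ideal.span {(p : R)}) R] {θ : A →+* R}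
    (hθ : Function.Surjective θ) (hker : ∀ x, θ x = 0 ↔ d ∣ x) :
    Function.Bijective (tiltMap p θ) := by
  let f : PreTilt A p →+* ModP R p := (PreTilt.coeff 0).comp (tiltMap p θ)
  have hf (t : PreTilt A p) : f t = Ideal.Quotient.mk (Ideal.span {(p : R)}) (θ t.untilt) :=
    coeff_zero_tiltMap θ t
  have hlift : Perfection.lift p (PreTilt A p) (ModP R p) f = tiltMap p θ :=
    (Perfection.lift p (PreTilt A p) (ModP R p)).apply_symm_apply (tiltMap p θ)
  rw [← hlift]
  obtain ⟨k, hk⟩ := h.exists_dvd_pow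
  refine bijective_perfectionLift (m := k) ?_ ha ?_ ?_
  · intro r
    obtain ⟨r, rfl⟩ := Ideal.Quotient.mk_surjective r
    obtain ⟨y, rfl⟩ := hθ r
    obtain ⟨x, hx⟩ := (h.quotient_primitive (mem_jacobson_of_isAdicComplete ha) hu hd).1 y
    obtain ⟨x', hx'⟩ := exists_eq_teichmuller_add x
    refine ⟨x.coeff 0, ?_⟩
    rw [hf, Ideal.Quotient.eq, Ideal.mem_span_singleton]
    rw [← hker, map_sub, sub_eq_zero] at hx
    rw [hx]
    nth_rewrite 2 [hx']
    rw [map_add, map_mul, map_natCast, WittVector.fontaineTheta_teichmuller, map_add, map_mul,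
      map_natCast, sub_add_cancel_left]
    exact (Dvd.intro _ rfl).neg_right
  · intro t ht
    rw [hf, Ideal.Quotient.eq_zero_iff_mem, Ideal.mem_span_singleton] at ht
    obtain ⟨r, hr⟩ := ht
    obtain ⟨y, rfl⟩ := hθ r
    rw [← map_natCast θ, ← map_mul, ← sub_eq_zero, ← map_sub, hker] at hr
    obtain ⟨z, hz⟩ := hr
    obtain ⟨s, hs⟩ := h.tiltEquiv.surjective (Ideal.Quotient.mk _ z)
    refine ⟨s, h.tiltEquiv.injective ?_⟩
    rw [map_mul, hs, h.tiltEquiv_apply, h.tiltEquiv_apply, ← map_mul, Ideal.Quotient.eq,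
      Ideal.mem_span_singleton]
    obtain ⟨c, hc⟩ := h.dvd
    refine ⟨c * y + u * z, ?_⟩
    linear_combination hz + z * hd + y * hc
  · rw [hf, ← map_pow, Ideal.Quotient.eq_zero_iff_mem, Ideal.mem_span_singleton]
    have h1 : θ a.untilt = θ (ϖ * -u) := by
      rw [← sub_eq_zero, ← map_sub, hker]
      exact ⟨1, by rw [hd]; ring⟩
    rw [h1, ← map_pow, mul_pow, ← map_natCast θ]
    exact map_dvd θ (hk.mul_right _)

end Primitive

/-- The quotient of a strict ring by a primitive element of degree one is a perfectoid ring. -/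
theorem IsStrict.isPerfectoidRing {p : ℕ} [Fact p.Prime] {A : Type*} [CommRing A] {ϖ : A}
    [Fact ¬IsUnit (p : A)] [IsAdicComplete (Ideal.span {(p : A)}) A]
    (h : IsStrict p ϖ) {a : PreTilt A p} {d u : A} (hu : IsUnit u) (hd : d = a.untilt + ϖ * u)
    (ha : IsAdicComplete (Ideal.span {a}) (PreTilt A p)) {R : Type*} [CommRing R] {θ : A →+* R}
    (hθ : Function.Surjective θ) (hker : ∀ x, θ x = 0 ↔ d ∣ x) : IsPerfectoidRing p R := by
  have hR := h.quotient_primitive_isAdicComplete hu hd hθ hker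
  have haj := mem_jacobson_of_isAdicComplete ha
  refine ⟨?_, ?_, fun hp ↦ ?_⟩
  -- The `p`-th power of `θ b.untilt` is `θ a.untilt = -θ (ϖ * u)`, so `θ b.untilt` is a `p`-th root
  -- of a unit multiple of `θ ϖ`, which divides `p`.
  · obtain ⟨b, hb⟩ := exists_pow_eq_of_perfect (p := p) a
    obtain ⟨u', hu'⟩ := hu.exists_right_inv
    have h1 : θ b.untilt ^ p = θ ϖ * -θ u := by
      rw [← map_pow, ← map_pow, hb, ← map_neg, ← map_mul, ← sub_eq_zero, ← map_sub, hker]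
      exact ⟨1, by rw [hd]; ring⟩
    have h2 : θ b.untilt ^ p ∣ θ ϖ := by
      have h3 : θ u * θ u' = 1 := by rw [← map_mul, hu', map_one]
      exact ⟨-θ u', by rw [h1]; linear_combination -θ ϖ * h3⟩
    have hp0 : p ≠ 0 := (Fact.out : p.Prime).ne_zero
    refine ⟨θ b.untilt, h2.trans ?_, isAdicComplete_of_dvd_pow hp0 ((dvd_pow_self _ hp0).trans h2)
      (h1 ▸ Dvd.intro _ rfl) hR⟩
    rw [← map_natCast θ]
    exact map_dvd θ h.dvd
  · intro r
    obtain ⟨r, rfl⟩ := Ideal.Quotient.mk_surjective r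
    obtain ⟨y, rfl⟩ := hθ r
    obtain ⟨x, hx⟩ := (h.quotient_primitive haj hu hd).1 y
    obtain ⟨x', hx'⟩ := exists_eq_teichmuller_add x
    obtain ⟨b, hb⟩ := exists_pow_eq_of_perfect (p := p) (x.coeff 0)
    refine ⟨Ideal.Quotient.mk _ (θ b.untilt), ?_⟩
    simp only
    rw [← map_pow, ← map_pow, ← map_pow, hb, Ideal.Quotient.eq, Ideal.mem_span_singleton]
    rw [← hker, map_sub, sub_eq_zero] at hx
    rw [hx]
    nth_rewrite 2 [hx']
    rw [map_add, map_mul, map_natCast, WittVector.fontaineTheta_teichmuller, map_add, map_mul,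
      map_natCast, sub_add_cancel_left]
    exact (Dvd.intro _ rfl).neg_right
  · have : Fact ¬IsUnit (p : R) := ⟨hp⟩
    have hRp : IsAdicComplete (Ideal.span {(p : R)}) R :=
      isAdicComplete_of_dvd (by rw [← map_natCast θ]; exact map_dvd θ h.dvd) hR
    rw [isPrincipal_ker_fontaineTheta_iff (h.bijective_tiltMap hu hd ha hθ hker)]
    simp only [hker]
    exact (h.quotient_primitive haj hu hd).2

/-! ### The coefficient ring. -/

section Base

/-- `O` is a discrete valuation ring of mixed characteristic with uniformizer `π` and finite residue
field. -/
structure IsUniformizer (p : ℕ) {O : Type*} [CommRing O] (π : O) : Prop where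
  isMaximal : (Ideal.span {π}).IsMaximal
  finite : Finite (O ⧸ Ideal.span {π})
  torsionFree : ∀ x : O, π * x = 0 → x = 0
  exists_eq : ∃ (w : O) (e : ℕ), IsUnit w ∧ e ≠ 0 ∧ (p : O) = w * π ^ e

variable {p : ℕ} [Fact p.Prime] {O : Type*} [CommRing O] {π : O}

omit [Fact p.Prime] in
theorem IsUniformizer.dvd (h : IsUniformizer p π) : π ∣ (p : O) := by
  obtain ⟨w, e, -, he, hp⟩ := h.exists_eq
  exact hp ▸ (dvd_pow_self π he).mul_left w

theorem IsUniformizer.exists_resCard_eq (h : IsUniformizer p π) :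
    ∃ f, f ≠ 0 ∧ resCard π = p ^ f := by
  have := h.isMaximal
  have := h.finite
  let _ : Field (O ⧸ Ideal.span {π}) := Ideal.Quotient.field _
  have := Fintype.ofFinite (O ⧸ Ideal.span {π})
  have hdvd : ringChar (O ⧸ Ideal.span {π}) ∣ p := by
    rw [← ringChar.spec, ← map_natCast (Ideal.Quotient.mk _), Ideal.Quotient.eq_zero_iff_mem,
      Ideal.mem_span_singleton]
    exact h.dvd
  have hchar : ringChar (O ⧸ Ideal.span {π}) = p :=
    ((Nat.dvd_prime Fact.out).1 hdvd).resolve_left CharP.ringChar_ne_one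
  have : CharP (O ⧸ Ideal.span {π}) p := ringChar.of_eq hchar
  obtain ⟨n, hp, hc⟩ := FiniteField.card (O ⧸ Ideal.span {π}) p
  exact ⟨n, n.ne_zero, by rw [resCard, Nat.card_eq_fintype_card, hc]⟩

theorem IsUniformizer.two_le_resCard (h : IsUniformizer p π) : 2 ≤ resCard π := by
  obtain ⟨f, hf, hq⟩ := h.exists_resCard_eq
  have hp1 : 1 < p := (Fact.out : p.Prime).one_lt
  rw [hq]
  exact hp1.trans_le (Nat.le_self_pow hf p)

theorem IsUniformizer.dvd_resCard (h : IsUniformizer p π) : π ∣ (resCard π : O) := by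
  obtain ⟨f, hf, hq⟩ := h.exists_resCard_eq
  rw [hq, Nat.cast_pow]
  exact h.dvd.trans (dvd_pow_self _ hf)

omit [Fact p.Prime] in
theorem IsUniformizer.mul_divBy_sub_pow (h : IsUniformizer p π) (α : O) :
    π * divBy π (α - α ^ resCard π) = α - α ^ resCard π := by
  have := h.finite
  exact mul_divBy (dvd_sub_pow_resCard h.isMaximal α)

omit [Fact p.Prime] in
theorem IsUniformizer.mul_divBy_choose (h : IsUniformizer p π) {i : ℕ}
    (hi : i ∈ Finset.Ioo 0 (resCard π)) :
    π * divBy π ((resCard π).choose i : O) = (resCard π).choose i := by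
  have := h.finite
  exact mul_divBy (dvd_choose_resCard h.isMaximal hi)

omit [Fact p.Prime] in
theorem IsUniformizer.eq_of_mul_eq (h : IsUniformizer p π) {x y : O} (hxy : π * x = π * y) :
    x = y :=
  sub_eq_zero.1 (h.torsionFree _ (by rw [mul_sub, hxy, sub_self]))

end Base

/-! ### Perfect `δ_L`-algebras are strict rings. -/

section Delta

theorem add_pow_eq_sum_Ioo {A : Type*} [CommRing A] (x y : A) {n : ℕ} (hn : n ≠ 0) :
    (x + y) ^ n = x ^ n + y ^ n +
      ∑ i ∈ Finset.Ioo 0 n, (n.choose i : A) * x ^ i * y ^ (n - i) := by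
  obtain ⟨n, rfl⟩ := Nat.exists_eq_succ_of_ne_zero hn
  rw [add_pow, Finset.sum_range_succ, Finset.sum_range_eq_add_Ico _ (Nat.succ_pos n)]
  have : Finset.Ico 1 (n + 1) = Finset.Ioo 0 (n + 1) := rfl
  rw [this]
  have h2 : ∑ i ∈ Finset.Ioo 0 (n + 1), x ^ i * y ^ (n + 1 - i) * ((n + 1).choose i : A) =
      ∑ i ∈ Finset.Ioo 0 (n + 1), ((n + 1).choose i : A) * x ^ i * y ^ (n + 1 - i) :=
    Finset.sum_congr rfl fun i _ ↦ by ring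
  simp only [Nat.succ_eq_add_one, h2]
  simp
  ring

variable {p : ℕ} [Fact p.Prime] {O : Type*} [CommRing O] {π : O} (hπ : IsUniformizer p π)
  {A : Type*} [CommRing A] [Algebra O A] (D : DeltaStructure π A)
include hπ

omit [Fact p.Prime] in
theorem DeltaStructure.φ_algebraMap (α : O) : D.φ (algebraMap O A α) = algebraMap O A α := by
  rw [φ, D.δ_algebraMap, ← map_mul, hπ.mul_divBy_sub_pow, ← map_pow, ← map_add]
  ring_nf

omit [Fact p.Prime] hπ in
theorem DeltaStructure.φ_mul (x y : A) : D.φ (x * y) = D.φ x * D.φ y := by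
  simp only [φ, D.δ_mul]
  ring

theorem DeltaStructure.φ_add (x y : A) : D.φ (x + y) = D.φ x + D.φ y := by
  have hq : resCard π ≠ 0 := by have := hπ.two_le_resCard; omega
  have h2 : ∑ i ∈ Finset.Ioo 0 (resCard π), ((resCard π).choose i : A) * x ^ i *
      y ^ (resCard π - i) = algebraMap O A π * ∑ i ∈ Finset.Ioo 0 (resCard π),
      algebraMap O A (divBy π ((resCard π).choose i : O)) * x ^ i * y ^ (resCard π - i) := by
    rw [Finset.mul_sum]
    refine Finset.sum_congr rfl fun i hi ↦ ?_
    rw [← mul_assoc, ← mul_assoc, ← map_mul, hπ.mul_divBy_choose hi, map_natCast]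
  simp only [φ, D.δ_add]
  rw [add_pow_eq_sum_Ioo x y hq, h2]
  ring

/-- The Frobenius lift of a `δ_L`-algebra as a ring homomorphism. -/
def DeltaStructure.φHom : A →+* A where
  toFun := D.φ
  map_one' := by rw [← map_one (algebraMap O A), D.φ_algebraMap hπ]
  map_mul' := D.φ_mul
  map_zero' := by rw [← map_zero (algebraMap O A), D.φ_algebraMap hπ]
  map_add' := D.φ_add hπ

theorem DeltaStructure.φHom_apply (x : A) : D.φHom hπ x = x ^ resCard π + algebraMap O A π * D.δ x :=
  rfl

omit [Fact p.Prime] in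
theorem DeltaStructure.δ_zero : D.δ 0 = 0 := by
  have := hπ.finite
  have : Nonempty (O ⧸ Ideal.span {π}) := ⟨0⟩
  have hq : resCard π ≠ 0 := Nat.card_pos.ne'
  have h0 : divBy π ((0 : O) - 0 ^ resCard π) = 0 := hπ.torsionFree _ (by
    rw [hπ.mul_divBy_sub_pow, zero_pow hq, sub_zero])
  have := D.δ_algebraMap 0
  rwa [h0, map_zero] at this

/-- When `π` lies in the Jacobson radical this value is a unit, so `δ_L` detects divisibility by `π`
exactly once. -/
theorem DeltaStructure.δ_uniformizer :
    D.δ (algebraMap O A π) = 1 - algebraMap O A π ^ (resCard π - 1) := by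
  have hq := hπ.two_le_resCard
  rw [D.δ_algebraMap, ← map_pow, ← map_one (algebraMap O A), ← map_sub]
  congr 1
  apply hπ.eq_of_mul_eq
  rw [hπ.mul_divBy_sub_pow, mul_sub, ← pow_succ', mul_one, Nat.sub_add_cancel (by omega)]

variable (hjac : algebraMap O A π ∈ (⊥ : Ideal A).jacobson)
include hjac

theorem DeltaStructure.isUnit_δ_uniformizer : IsUnit (D.δ (algebraMap O A π)) := by
  have hq := hπ.two_le_resCard
  rw [D.δ_uniformizer hπ]
  exact isUnit_one_sub_of_mem_jacobson (Ideal.pow_mem_of_mem _ hjac _ (by omega))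

variable (hperf : D.IsPerfect)
include hperf

/-- If `π x = 0`, then also `π φ(x) = 0`, and the expansion of `δ_L(π x) = 0` reduces to `δ_L(π)
φ(x) = 0`. The first factor is a unit and `φ` is injective. -/
theorem DeltaStructure.torsionFree (x : A) (hx : algebraMap O A π * x = 0) : x = 0 := by
  have hq := hπ.two_le_resCard
  have h1 : D.δ (algebraMap O A π * x) = 0 := by rw [hx, D.δ_zero hπ]
  rw [D.δ_mul] at h1
  have h2 : algebraMap O A π * D.φHom hπ x = 0 := by
    have : D.φHom hπ (algebraMap O A π * x) = 0 := by rw [hx, map_zero]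
    rw [map_mul] at this
    rwa [show D.φHom hπ (algebraMap O A π) = algebraMap O A π from D.φ_algebraMap hπ π] at this
  obtain ⟨k, hk⟩ : ∃ k, resCard π = k + 2 := ⟨resCard π - 2, by omega⟩
  have h3 : D.δ (algebraMap O A π) * D.φHom hπ x = 0 := by
    rw [D.φHom_apply] at h2 ⊢
    rw [hk] at h1 h2 ⊢
    linear_combination h1 - algebraMap O A π ^ k * h2 +
      algebraMap O A π ^ k * x ^ (k + 1) * hx
  rw [(D.isUnit_δ_uniformizer hπ hjac).mul_right_eq_zero] at h3
  exact hperf.1 (h3.trans (map_zero (D.φHom hπ)).symm)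

omit hjac in
-- The bijection `φ` fixes `π` and induces the `q`-power map modulo `π`.
theorem DeltaStructure.bijective_pow_resCard :
    Function.Bijective fun x : A ⧸ Ideal.span {algebraMap O A π} ↦ x ^ resCard π := by
  have hφ (x : A) : Ideal.Quotient.mk (Ideal.span {algebraMap O A π}) (D.φHom hπ x) =
      Ideal.Quotient.mk _ x ^ resCard π := by
    rw [← map_pow, Ideal.Quotient.eq, D.φHom_apply, add_sub_cancel_left]
    exact Ideal.mul_mem_right _ _ (Ideal.mem_span_singleton_self _)
  constructor
  · intro x y hxy
    obtain ⟨x, rfl⟩ := Ideal.Quotient.mk_surjective x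
    obtain ⟨y, rfl⟩ := Ideal.Quotient.mk_surjective y
    simp only at hxy
    rw [← hφ, ← hφ, Ideal.Quotient.eq, Ideal.mem_span_singleton, ← map_sub] at hxy
    obtain ⟨z, hz⟩ := hxy
    obtain ⟨z, rfl⟩ := hperf.2 z
    rw [Ideal.Quotient.eq, Ideal.mem_span_singleton]
    refine ⟨z, hperf.1 ?_⟩
    rw [D.φ_mul, D.φ_algebraMap hπ]
    exact hz
  · intro x
    obtain ⟨x, rfl⟩ := Ideal.Quotient.mk_surjective x
    obtain ⟨x, rfl⟩ := hperf.2 x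
    exact ⟨Ideal.Quotient.mk _ x, (hφ x).symm⟩

theorem DeltaStructure.isStrict (hc : DerivedCompleteAt (algebraMap O A π)) :
    IsStrict p (algebraMap O A π) where
  torsionFree := D.torsionFree hπ hjac hperf
  complete := by
    have htf := D.torsionFree hπ hjac hperf
    refine hc.isAdicComplete fun n ↦ ?_
    induction n with
    | zero => exact fun x hx ↦ by rw [pow_zero, one_mul] at hx; rw [hx, mul_zero]
    | succ n ih => exact fun x hx ↦ ih x (htf _ (by rw [← mul_assoc, ← pow_succ', hx]))
  exists_eq := by
    obtain ⟨w, e, hw, he, hp⟩ := hπ.exists_eq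
    exact ⟨algebraMap O A w, e, hw.map _, he, by rw [← map_pow, ← map_mul, ← hp, map_natCast]⟩
  perfect := by
    obtain ⟨f, hf, hq⟩ := hπ.exists_resCard_eq
    obtain ⟨f, rfl⟩ := Nat.exists_eq_succ_of_ne_zero hf
    have hb := D.bijective_pow_resCard hπ hperf
    rw [hq] at hb
    constructor
    · intro x y hxy
      apply hb.1
      simp only at hxy ⊢
      rw [pow_succ', pow_mul, pow_mul, hxy]
    · intro x
      obtain ⟨y, hy⟩ := hb.2 x
      exact ⟨y ^ p ^ f, by rw [← hy]; simp only; rw [← pow_mul, ← pow_succ]⟩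

end Delta
end LTypical

noncomputable section

namespace LTypical

/-! ### Distinguished generators of the ideal of a perfect prism. -/

section Distinguished

variable {p : ℕ} [Fact p.Prime] {O : Type*} [CommRing O] {π : O} (hπ : IsUniformizer p π)
  {A : Type*} [CommRing A] [Algebra O A] (D : DeltaStructure π A) {I : Ideal A}
include hπ

-- With `DeltaStructure.δ_mul_sub_mem` this says that, modulo `π` and `I`, `δ_L` restricted to `I`
-- is additive and semilinear for the `q`-Frobenius.
omit [Fact p.Prime] hπ in
theorem DeltaStructure.δ_add_sub_mem {x : A} (hx : x ∈ I) (y : A) :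
    D.δ (x + y) - (D.δ x + D.δ y) ∈ Ideal.span {algebraMap O A π} ⊔ I := by
  rw [D.δ_add, sub_sub_cancel_left, neg_mem_iff]
  refine Ideal.mem_sup_right (Ideal.sum_mem _ fun i hi ↦ Ideal.mul_mem_right _ _
    (Ideal.mul_mem_left _ _ (Ideal.pow_mem_of_mem _ hx _ (Finset.mem_Ioo.1 hi).1)))

theorem DeltaStructure.δ_mul_sub_mem {x : A} (hx : x ∈ I) (c : A) :
    D.δ (c * x) - c ^ resCard π * D.δ x ∈ Ideal.span {algebraMap O A π} ⊔ I := by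
  have hq := hπ.two_le_resCard
  rw [D.δ_mul, show D.δ c * x ^ resCard π + c ^ resCard π * D.δ x +
    algebraMap O A π * D.δ c * D.δ x - c ^ resCard π * D.δ x =
    algebraMap O A π * (D.δ c * D.δ x) + D.δ c * x ^ resCard π by ring]
  exact Submodule.add_mem_sup (Ideal.mul_mem_right _ _ (Ideal.mem_span_singleton_self _))
    (Ideal.mul_mem_left _ _ (Ideal.pow_mem_of_mem _ hx _ (by omega)))

variable (hperf : D.IsPerfect)
  (hjac : Ideal.span {algebraMap O A π} ⊔ I ≤ (⊥ : Ideal A).jacobson)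
include hperf

/-- The ideal of values of `δ_L` on `I`, modulo `π` and `I`. -/
def DeltaStructure.δIdeal (I : Ideal A) : Ideal A where
  carrier := {m | ∃ x ∈ I, m - D.δ x ∈ Ideal.span {algebraMap O A π} ⊔ I}
  zero_mem' := ⟨0, zero_mem _, by rw [D.δ_zero hπ, sub_zero]; exact zero_mem _⟩
  add_mem' := by
    rintro m n ⟨x, hx, hm⟩ ⟨y, hy, hn⟩
    refine ⟨x + y, add_mem hx hy, ?_⟩
    have := sub_mem (add_mem hm hn) (D.δ_add_sub_mem hx y)
    convert this using 1
    ring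
  smul_mem' := by
    rintro c m ⟨x, hx, hm⟩
    -- Semilinearity only allows scaling by `q`-th powers; surjectivity of `φ` writes every scalar
    -- as such a power modulo `π`.
    obtain ⟨b, rfl⟩ := hperf.2 c
    refine ⟨b * x, Ideal.mul_mem_left _ _ hx, ?_⟩
    have h1 : algebraMap O A π * (D.δ b * D.δ x) ∈ Ideal.span {algebraMap O A π} ⊔ I :=
      Ideal.mem_sup_left (Ideal.mul_mem_right _ _ (Ideal.mem_span_singleton_self _))
    have := sub_mem (add_mem (Ideal.mul_mem_left _ (D.φ b) hm) h1) (D.δ_mul_sub_mem hπ hx b)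
    convert this using 1
    rw [smul_eq_mul, φ]
    ring

theorem DeltaStructure.le_δIdeal :
    Ideal.span {algebraMap O A π} ⊔ I ≤ D.δIdeal hπ hperf I := fun m hm ↦
  ⟨0, zero_mem _, by rwa [D.δ_zero hπ, sub_zero]⟩

theorem DeltaStructure.exists_eq_of_mem_span_φ {y : A}
    (hy : y ∈ Ideal.span (D.φ '' (I : Set A))) :
    ∃ y' ∈ I, ∃ m ∈ D.δIdeal hπ hperf I, y = y' + algebraMap O A π * m := by
  have hq := hπ.two_le_resCard
  induction hy using Submodule.span_induction with
  | mem x hx =>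
    obtain ⟨z, hz, rfl⟩ := hx
    exact ⟨z ^ resCard π, Ideal.pow_mem_of_mem _ hz _ (by omega), D.δ z,
      ⟨z, hz, by rw [sub_self]; exact zero_mem _⟩, rfl⟩
  | zero => exact ⟨0, zero_mem _, 0, zero_mem _, by ring⟩
  | add x y _ _ hx hy =>
    obtain ⟨x', hx', m, hm, rfl⟩ := hx
    obtain ⟨y', hy', n, hn, rfl⟩ := hy
    exact ⟨x' + y', add_mem hx' hy', m + n, add_mem hm hn, by ring⟩
  | smul c x _ hx =>
    obtain ⟨x', hx', m, hm, rfl⟩ := hx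
    exact ⟨c * x', Ideal.mul_mem_left _ _ hx', c * m, Ideal.mul_mem_left _ _ hm, by
      rw [smul_eq_mul]; ring⟩

include hjac

/-- Expanding `φ(z) = z ^ q + π δ_L(z)` in the prism condition gives `π * (1 - m) ∈ I` with `m` in
`δIdeal`. Applying `δ_L` puts `(1 - m) ^ q` into `δIdeal` as well, so this ideal contains `1`. -/
theorem DeltaStructure.exists_isUnit_δ
    (hmem : algebraMap O A π ∈ I ⊔ Ideal.span (D.φ '' (I : Set A))) :
    ∃ d ∈ I, IsUnit (D.δ d) := by
  obtain ⟨x, hx, y, hy, hxy⟩ := Submodule.mem_sup.1 hmem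
  obtain ⟨y', hy', m, hm, rfl⟩ := D.exists_eq_of_mem_span_φ hπ hperf hy
  have hπjac : algebraMap O A π ∈ (⊥ : Ideal A).jacobson :=
    hjac (Ideal.mem_sup_left (Ideal.mem_span_singleton_self _))
  have h1 : algebraMap O A π * (1 - m) = x + y' := by linear_combination -hxy
  have h2 : D.δ (algebraMap O A π * (1 - m)) ∈ D.δIdeal hπ hperf I :=
    ⟨x + y', add_mem hx hy', by rw [h1, sub_self]; exact zero_mem _⟩
  have h3 : algebraMap O A π ∈ D.δIdeal hπ hperf I :=
    D.le_δIdeal hπ hperf (Ideal.mem_sup_left (Ideal.mem_span_singleton_self _))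
  obtain ⟨k, hk⟩ : ∃ k, resCard π = k + 1 := ⟨resCard π - 1, by
    have := hπ.two_le_resCard; omega⟩
  have h4 : D.δ (algebraMap O A π) * (1 - m) ^ resCard π ∈ D.δIdeal hπ hperf I := by
    rw [D.δ_mul, hk] at h2
    have h5 := sub_mem h2 (Ideal.mul_mem_right (algebraMap O A π ^ k * D.δ (1 - m) +
      D.δ (algebraMap O A π) * D.δ (1 - m)) _ h3)
    convert h5 using 1
    rw [hk]
    ring
  rw [(D.δIdeal hπ hperf I).unit_mul_mem_iff_mem (D.isUnit_δ_uniformizer hπ hπjac)] at h4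
  have h5 : (1 : A) ∈ D.δIdeal hπ hperf I := by
    have h6 : m ∣ 1 ^ resCard π - (1 - m) ^ resCard π := by
      refine Dvd.dvd.trans ?_ (sub_dvd_pow_sub_pow _ _ _)
      rw [sub_sub_cancel]
    have := add_mem (Ideal.mem_of_dvd _ h6 hm) h4
    rwa [sub_add_cancel, one_pow] at this
  obtain ⟨d, hd, h6⟩ := h5
  refine ⟨d, hd, isUnit_of_sub_mem_jacobson isUnit_one ?_⟩
  rw [← neg_mem_iff, neg_sub]
  exact hjac h6

omit hperf in
/-- An invertible ideal containing a distinguished element is generated by it. -/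
theorem DeltaStructure.eq_span_of_isUnit_δ (hI : IsCartierDivisor I) {d : A} (hd : d ∈ I)
    (hδ : IsUnit (D.δ d)) : I = Ideal.span {d} := by
  refine le_antisymm (fun x hx ↦ ?_) ((Ideal.span_singleton_le_iff_mem _).2 hd)
  -- The argument is local: a maximal ideal `m` containing the conductor `Q` contains `π` and `I`,
  -- and some `f ∉ m` makes `I` principal after inverting `f`.
  let Q : Ideal A := (Ideal.span {d}).colon {x}
  have hQ (s : A) : s ∈ Q ↔ d ∣ s * x := by
    rw [Submodule.mem_colon_singleton, smul_eq_mul, Ideal.mem_span_singleton]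
  suffices hQt : Q = ⊤ by
    have := (hQ 1).1 (hQt ▸ Submodule.mem_top)
    rwa [one_mul, ← Ideal.mem_span_singleton] at this
  by_contra hne
  obtain ⟨m, hm, hQm⟩ := Ideal.exists_le_maximal Q hne
  have hKm : Ideal.span {algebraMap O A π} ⊔ I ≤ m :=
    hjac.trans (sInf_le ⟨bot_le, hm⟩)
  obtain ⟨s, hs, hloc⟩ := hI
  obtain ⟨f, hfs, hfm⟩ : ∃ f ∈ s, f ∉ m := by
    by_contra! hcon
    exact hm.ne_top (top_le_iff.1 (hs ▸ Ideal.span_le.2 hcon))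
  obtain ⟨g, -, hg⟩ := hloc f hfs
  have hgI : g ∈ I.map (algebraMap A (Localization.Away f)) :=
    hg ▸ Ideal.mem_span_singleton_self g
  obtain ⟨⟨⟨y, hy⟩, ⟨_, k₀, rfl⟩⟩, hyg⟩ :=
    (IsLocalization.mem_map_algebraMap_iff (Submonoid.powers f) _).1 hgI
  simp only at hyg
  have key : ∀ z ∈ I, ∃ (k : ℕ) (c : A), f ^ k * z = c * y := by
    intro z hz
    have h1 : g ∣ algebraMap A (Localization.Away f) z := by
      rw [← Ideal.mem_span_singleton, ← hg]
      exact Ideal.mem_map_of_mem _ hz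
    obtain ⟨r, hr⟩ := h1
    obtain ⟨⟨c, ⟨_, k₁, rfl⟩⟩, hc⟩ := IsLocalization.surj (Submonoid.powers f) r
    simp only at hc
    have h2 : algebraMap A (Localization.Away f) (f ^ k₀ * f ^ k₁ * z) =
        algebraMap A (Localization.Away f) (c * y) := by
      rw [map_mul, map_mul, map_mul, hr, ← hyg, ← hc]
      ring
    obtain ⟨⟨_, k₂, rfl⟩, hk₂⟩ := (IsLocalization.eq_iff_exists (Submonoid.powers f) _).1 h2
    exact ⟨k₂ + k₀ + k₁, f ^ k₂ * c, by simp only at hk₂; linear_combination hk₂⟩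
  obtain ⟨k, c, hc⟩ := key d hd
  obtain ⟨k', c', hc'⟩ := key x hx
  -- Were `c ∈ m`, applying `δ_L` to `f ^ k * d = c * y` modulo `m` would give `f ^ (k * q) * δ_L(d)
  -- ∈ m`, although `δ_L(d)` is a unit. So `d` is a local generator too.
  have hcm : c ∉ m := by
    intro hcm
    have h1 := hKm (D.δ_mul_sub_mem hπ hd (f ^ k))
    have h2 := hKm (D.δ_mul_sub_mem hπ hy c)
    have hq := hπ.two_le_resCard
    have h3 : c ^ resCard π * D.δ y ∈ m :=
      Ideal.mul_mem_right _ _ (Ideal.pow_mem_of_mem _ hcm _ (by omega))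
    rw [← hc] at h2
    have h4 := sub_mem (add_mem h2 h3) h1
    rw [show D.δ (f ^ k * d) - c ^ resCard π * D.δ y + c ^ resCard π * D.δ y -
      (D.δ (f ^ k * d) - (f ^ k) ^ resCard π * D.δ d) =
      D.δ d * (f ^ k) ^ resCard π by ring, m.unit_mul_mem_iff_mem hδ] at h4
    exact hfm (hm.isPrime.mem_of_pow_mem _ (hm.isPrime.mem_of_pow_mem _ h4))
  have h5 : c * f ^ k' ∈ m := hQm ((hQ _).2 ⟨c' * f ^ k, by
    linear_combination c * hc' - c' * hc⟩)
  rcases hm.isPrime.mem_or_mem h5 with h | h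
  · exact hcm h
  · exact hfm (hm.isPrime.mem_of_pow_mem _ h)

end Distinguished

/-! ### Distinguished means primitive, and perfectoid algebras are perfectoid rings. -/

section Primitive

variable {p : ℕ} [Fact p.Prime] {O : Type*} [CommRing O] {π : O} (hπ : IsUniformizer p π)
  {A : Type*} [CommRing A] [Algebra O A] (D : DeltaStructure π A)
include hπ

/-- Modulo `π`, `δ_L` of `y ^ q + π u` is `φ(u)`. -/
theorem DeltaStructure.dvd_δ_sub_φ (htf : ∀ x : A, algebraMap O A π * x = 0 → x = 0) (y u : A) :
    algebraMap O A π ∣ D.δ (y ^ resCard π + algebraMap O A π * u) - D.φ u := by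
  -- Since `π` divides `q` and `q`-th powers are expanded at `π v`, the congruence holds modulo `π ^
  -- 2`. One factor `π` therefore remains after the division hidden in `δ_L`.
  have hpow : ∀ z v : A, ∃ k, (z + algebraMap O A π * v) ^ resCard π =
      z ^ resCard π + algebraMap O A π ^ 2 * k := by
    intro z v
    obtain ⟨k, hk⟩ := Polynomial.powAddExpansion z (algebraMap O A π * v) (resCard π)
    obtain ⟨c, hc⟩ := map_dvd (algebraMap O A) hπ.dvd_resCard
    rw [map_natCast] at hc
    refine ⟨c * z ^ (resCard π - 1) * v + k * v ^ 2, ?_⟩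
    rw [hk, hc]
    ring
  obtain ⟨k₁, hk₁⟩ := hpow (y ^ resCard π) u
  obtain ⟨k₂, hk₂⟩ := hpow (y ^ resCard π) (D.δ y)
  refine ⟨k₂ - k₁, sub_eq_zero.1 (htf _ ?_)⟩
  have h1 : D.φHom hπ (y ^ resCard π + algebraMap O A π * u) =
      D.φHom hπ y ^ resCard π + algebraMap O A π * D.φHom hπ u := by
    rw [map_add, map_pow, map_mul]
    congr 2
    exact D.φ_algebraMap hπ π
  rw [D.φHom_apply hπ (_ + _), D.φHom_apply hπ y, hk₁, hk₂] at h1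
  change _ = _ + algebraMap O A π * D.φ u at h1
  linear_combination h1

/-- An element congruent to `y ^ q` modulo `π` is distinguished iff its second coordinate is a
unit. -/
theorem DeltaStructure.isUnit_δ_iff (hs : IsStrict p (algebraMap O A π)) (hperf : D.IsPerfect)
    (y u : A) : IsUnit (D.δ (y ^ resCard π + algebraMap O A π * u)) ↔ IsUnit u := by
  have hjac := mem_jacobson_of_isAdicComplete hs.complete
  have h1 : D.δ (y ^ resCard π + algebraMap O A π * u) - D.φ u ∈ (⊥ : Ideal A).jacobson :=
    Ideal.mem_of_dvd _ (D.dvd_δ_sub_φ hπ hs.torsionFree y u) hjac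
  have h2 : IsUnit (D.φ u) ↔ IsUnit u :=
    MulEquiv.isUnit_map (RingEquiv.ofBijective (D.φHom hπ) hperf)
  rw [← h2]
  constructor
  · intro h
    refine isUnit_of_sub_mem_jacobson h ?_
    rw [← neg_mem_iff, neg_sub]
    exact h1
  · exact fun h ↦ isUnit_of_sub_mem_jacobson h h1

end Primitive

theorem DerivedCompleteAt.map_ringEquiv {A B : Type*} [CommRing A] [CommRing B] (e : A ≃+* B)
    {f : A} (h : DerivedCompleteAt f) : DerivedCompleteAt (e f) := by
  let E : (ℕ → A) ≃ (ℕ → B) := Equiv.piCongrRight fun _ ↦ e.toEquiv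
  have : (fun (x : ℕ → B) (n : ℕ) ↦ x n - e f * x (n + 1)) =
      E ∘ (fun (x : ℕ → A) (n : ℕ) ↦ x n - f * x (n + 1)) ∘ E.symm := by
    ext x n
    change _ = e (e.symm (x n) - f * e.symm (x (n + 1)))
    simp
  rw [DerivedCompleteAt, this]
  exact E.bijective.comp (h.comp E.symm.bijective)

theorem isPerfectoidRing_of_isPerfectoidAlgebra {p : ℕ} [Fact p.Prime] {O : Type*} [CommRing O]
    {π : O} (hπ : IsUniformizer p π) {R : Type*} [CommRing R] [Algebra O R]
    (h : IsPerfectoidAlgebra π R) : IsPerfectoidRing p R := by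
  obtain ⟨A, _, _, D, I, hprism, hperf, ⟨e⟩⟩ := h
  rcases subsingleton_or_nontrivial A with hA | hA
  · have : Subsingleton R := (e.toEquiv.trans (Equiv.refl _)).subsingleton
    exact isPerfectoidRing_of_subsingleton R
  have hdc : ∀ f ∈ Ideal.span {algebraMap O A π} ⊔ I, DerivedCompleteAt f :=
    hprism.isDerivedComplete
  have hjac : Ideal.span {algebraMap O A π} ⊔ I ≤ (⊥ : Ideal A).jacobson := fun f hf ↦
    mem_jacobson_of_derivedCompleteAt fun c ↦ hdc _ (Ideal.mul_mem_left _ c hf)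
  have hπm : algebraMap O A π ∈ Ideal.span {algebraMap O A π} ⊔ I :=
    Ideal.mem_sup_left (Ideal.mem_span_singleton_self _)
  have hs := D.isStrict hπ (hjac hπm) hperf (hdc _ hπm)
  obtain ⟨d, hd, hδ⟩ := D.exists_isUnit_δ hπ hperf hjac hprism.mem
  have hId := D.eq_span_of_isUnit_δ hπ hjac hprism.isCartierDivisor hd hδ
  have : Fact ¬IsUnit (p : A) := ⟨hs.not_isUnit⟩
  have := hs.isAdicComplete_p
  obtain ⟨a, ha⟩ := hs.tiltEquiv.surjective (Ideal.Quotient.mk _ d)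
  obtain ⟨u, hu⟩ : algebraMap O A π ∣ d - a.untilt := by
    rw [← Ideal.mem_span_singleton, ← Ideal.Quotient.eq, ← ha, hs.tiltEquiv_apply]
  have hdu : d = a.untilt + algebraMap O A π * u := by rw [← hu]; ring
  have huu : IsUnit u := by
    obtain ⟨f, -, hq⟩ := hπ.exists_resCard_eq
    -- A `q`-th root of `a` brings `d` to the shape `y ^ q + π u`, where `δ_L(d)` and `u` are units
    -- simultaneously.
    obtain ⟨b, hb⟩ := (bijective_iterateFrobenius (R := PreTilt A p) (p := p) (n := f)).2 a
    rw [iterateFrobenius_def] at hb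
    rw [← D.isUnit_δ_iff hπ hs hperf b.untilt u, ← map_pow, hq, hb, ← hdu]
    exact hδ
  have hac : IsAdicComplete (Ideal.span {a}) (PreTilt A p) := by
    have h1 : DerivedCompleteAt a := by
      have := ((hdc d (Ideal.mem_sup_right hd)).quotient (algebraMap O A π)).map_ringEquiv
        hs.tiltEquiv.symm
      rwa [← ha, RingEquiv.symm_apply_apply] at this
    -- The tilt is perfect, hence reduced, so its `a`-power torsion is killed by `a` and derived
    -- completeness is classical.
    refine h1.isAdicComplete fun n x hx ↦ ?_
    refine (bijective_iterateFrobenius (R := PreTilt A p) (p := p) (n := n + 1)).1 ?_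
    rw [map_zero, iterateFrobenius_def]
    refine pow_eq_zero_of_le (Nat.lt_pow_self (Fact.out : p.Prime).one_lt).le ?_
    rw [mul_pow, pow_succ a, pow_succ' x]
    linear_combination a * x ^ n * hx
  let θ : A →+* R := (e.symm : (A ⧸ I) →+* R).comp (Ideal.Quotient.mk I)
  refine hs.isPerfectoidRing huu hdu hac (θ := θ)
    (e.symm.surjective.comp Ideal.Quotient.mk_surjective) fun x ↦ ?_
  change e.symm (Ideal.Quotient.mk I x) = 0 ↔ _
  rw [map_eq_zero_iff _ e.symm.injective, Ideal.Quotient.eq_zero_iff_mem, hId,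
    Ideal.mem_span_singleton]

/-! ### The ring of integers of `L`. -/

section IntegersOfLocalField

variable (p : ℕ) [Fact p.Prime] (L : Type*) [Field L] [Algebra ℚ_[p] L]
    [FiniteDimensional ℚ_[p] L] [Algebra ℤ_[p] L] [IsScalarTower ℤ_[p] ℚ_[p] L]

theorem isIntegral_of_spectralNorm_le_one {x : L} (hx : spectralNorm ℚ_[p] L x ≤ 1) :
    IsIntegral ℤ_[p] x := by
  have hint : IsIntegral ℚ_[p] x := Algebra.IsIntegral.isIntegral x
  have h1 : spectralValue (minpoly ℚ_[p] x) ≤ 1 := hx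
  rw [spectralValue_le_one_iff (minpoly.monic hint)] at h1
  have h2 : minpoly ℚ_[p] x ∈ Polynomial.lifts (algebraMap ℤ_[p] ℚ_[p]) := by
    rw [Polynomial.lifts_iff_coeff_lifts]
    exact fun n ↦ ⟨⟨_, h1 n⟩, rfl⟩
  obtain ⟨P, hP, -, hm⟩ := Polynomial.lifts_and_natDegree_eq_and_monic h2 (minpoly.monic hint)
  refine ⟨P, hm, ?_⟩
  have h3 : Polynomial.aeval x (P.map (algebraMap ℤ_[p] ℚ_[p])) = 0 := by
    rw [hP, minpoly.aeval]
  rwa [Polynomial.aeval_map_algebraMap] at h3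

/-- The spectral norm is multiplicative, so `x` or `x⁻¹` has norm at most `1`, and is then integral
because its minimal polynomial has coefficients in `ℤ_[p]`. -/
theorem valuationRing_integralClosure : ValuationRing (integralClosure ℤ_[p] L) := by
  have : IsFractionRing (integralClosure ℤ_[p] L) L :=
    integralClosure.isFractionRing_of_finite_extension ℚ_[p] L
  rw [ValuationRing.iff_isInteger_or_isInteger (integralClosure ℤ_[p] L) L]
  intro x
  have key : ∀ y : L, spectralNorm ℚ_[p] L y ≤ 1 →
      IsLocalization.IsInteger (integralClosure ℤ_[p] L) y := fun y hy ↦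
    ⟨⟨y, isIntegral_of_spectralNorm_le_one p L hy⟩, rfl⟩
  rcases le_total (spectralNorm ℚ_[p] L x) 1 with h | h
  · exact Or.inl (key x h)
  · refine Or.inr (key _ ?_)
    have := map_inv₀ (spectralMulAlgNorm (K := ℚ_[p]) (L := L)) x
    rw [spectralMulAlgNorm_def, spectralMulAlgNorm_def] at this
    rw [this]
    exact inv_le_one_of_one_le₀ h

omit L [Field L] [Algebra ℚ_[p] L] [FiniteDimensional ℚ_[p] L] [Algebra ℤ_[p] L]
  [IsScalarTower ℤ_[p] ℚ_[p] L] in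
theorem hasFiniteQuotients_padicInt : Ring.HasFiniteQuotients ℤ_[p] where
  finiteQuotient {I} hI := by
    obtain ⟨n, rfl⟩ := PadicInt.ideal_eq_span_pow_p hI
    rw [← PadicInt.ker_toZModPow]
    have : NeZero (p ^ n) := ⟨pow_ne_zero _ (Fact.out : p.Prime).ne_zero⟩
    exact Finite.of_injective _ (RingHom.kerLift_injective (PadicInt.toZModPow n))

theorem isUniformizer_integralClosure {π : integralClosure ℤ_[p] L} (hπ : Irreducible π) :
    IsUniformizer p π := by
  have := valuationRing_integralClosure p L
  have : IsDedekindDomain (integralClosure ℤ_[p] L) :=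
    integralClosure.isDedekindDomain ℤ_[p] ℚ_[p] L
  have hfin : Module.Finite ℤ_[p] (integralClosure ℤ_[p] L) :=
    IsIntegralClosure.finite ℤ_[p] ℚ_[p] L (integralClosure ℤ_[p] L)
  have hinjL : Function.Injective (algebraMap ℤ_[p] L) := by
    rw [IsScalarTower.algebraMap_eq ℤ_[p] ℚ_[p] L]
    exact (algebraMap ℚ_[p] L).injective.comp (IsFractionRing.injective ℤ_[p] ℚ_[p])
  have hinj : Function.Injective (algebraMap ℤ_[p] (integralClosure ℤ_[p] L)) :=
    Function.Injective.of_comp (f := algebraMap (integralClosure ℤ_[p] L) L) hinjL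
  have hpr : (p : ℤ_[p]) ≠ 0 := PadicInt.prime_p.ne_zero
  have hp0 : (p : integralClosure ℤ_[p] L) ≠ 0 := by
    rw [← map_natCast (algebraMap ℤ_[p] (integralClosure ℤ_[p] L))]
    exact (map_ne_zero_iff _ hinj).2 hpr
  have hnf : ¬IsField (integralClosure ℤ_[p] L) := by
    intro hF
    let _ := hF.toField
    obtain ⟨y, hy⟩ := hF.mul_inv_cancel hπ.ne_zero
    exact hπ.not_isUnit (IsUnit.of_mul_eq_one y hy)
  have : IsDiscreteValuationRing (integralClosure ℤ_[p] L) :=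
    ((IsDiscreteValuationRing.TFAE _ hnf).out 1 0).1 ‹ValuationRing _›
  have hmax : IsLocalRing.maximalIdeal (integralClosure ℤ_[p] L) = Ideal.span {π} :=
    hπ.maximalIdeal_eq
  have hpu : ¬IsUnit (p : integralClosure ℤ_[p] L) := by
    have : FaithfulSMul ℤ_[p] (integralClosure ℤ_[p] L) :=
      (faithfulSMul_iff_algebraMap_injective _ _).2 hinj
    rw [← map_natCast (algebraMap ℤ_[p] (integralClosure ℤ_[p] L)), isUnit_map_iff]
    exact PadicInt.prime_p.not_isUnit
  obtain ⟨e, w, hw⟩ := IsDiscreteValuationRing.eq_unit_mul_pow_irreducible hp0 hπ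
  have he : e ≠ 0 := by
    rintro rfl
    exact hpu (by rw [hw]; simp)
  have := hasFiniteQuotients_padicInt p
  have := Ring.HasFiniteQuotients.of_module_finite ℤ_[p] (integralClosure ℤ_[p] L)
  exact ⟨hmax ▸ inferInstance, Ring.HasFiniteQuotients.finiteQuotient (by simpa using hπ.ne_zero),
    fun x hx ↦ (mul_eq_zero.1 hx).resolve_left hπ.ne_zero, w, e, w.isUnit, he, hw⟩

theorem small_integralClosure : Small.{0} (integralClosure ℤ_[p] L) := by
  have hfin : Module.Finite ℤ_[p] (integralClosure ℤ_[p] L) :=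
    IsIntegralClosure.finite ℤ_[p] ℚ_[p] L (integralClosure ℤ_[p] L)
  obtain ⟨n, f, hf⟩ := Module.Finite.exists_fin' ℤ_[p] (integralClosure ℤ_[p] L)
  exact small_of_surjective hf

end IntegersOfLocalField

/-! ### Filtrations by powers of an ideal stable under a Frobenius lift. -/

section FrobeniusLift

/-- A bijective lift `F` of the `q`-power map modulo `ϖ` which preserves the ideal `I`. -/
structure IsFrobeniusLift {B : Type*} [CommRing B] (ϖ : B) (q : ℕ) (F : B →+* B) (I : Ideal B) :
    Prop where
  torsionFree : ∀ x : B, ϖ * x = 0 → x = 0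
  two_le : 2 ≤ q
  dvd_choose : ∀ i ∈ Finset.Ioo 0 q, ϖ ∣ (q.choose i : B)
  bijective : Function.Bijective F
  map_ϖ : F ϖ = ϖ
  dvd_sub : ∀ x, ϖ ∣ F x - x ^ q
  mem_iff : ∀ x, F x ∈ I ↔ x ∈ I
  ϖ_mem : ϖ ∈ I

variable {B : Type*} [CommRing B] {ϖ : B} {q : ℕ} {F : B →+* B} {I : Ideal B}
  (h : IsFrobeniusLift ϖ q F I)
include h

theorem IsFrobeniusLift.eq_of_mul_eq {x y : B} (hxy : ϖ * x = ϖ * y) : x = y :=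
  sub_eq_zero.1 (h.torsionFree _ (by rw [mul_sub, hxy, sub_self]))

theorem IsFrobeniusLift.mem_pow_iff (n : ℕ) (x : B) : F x ∈ I ^ n ↔ x ∈ I ^ n := by
  have hmap : I.map F = I := by
    refine le_antisymm (Ideal.map_le_iff_le_comap.2 fun x hx ↦ (h.mem_iff x).2 hx) fun y hy ↦ ?_
    obtain ⟨x, rfl⟩ := h.bijective.2 y
    exact Ideal.mem_map_of_mem F ((h.mem_iff x).1 hy)
  have : I ^ n = (I ^ n).map F := by rw [Ideal.map_pow, hmap]
  constructor
  · intro hx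
    rw [this, Ideal.mem_map_iff_of_surjective F h.bijective.2] at hx
    obtain ⟨y, hy, hxy⟩ := hx
    rwa [← h.bijective.1 hxy]
  · intro hx
    rw [this]
    exact Ideal.mem_map_of_mem F hx

/-- The operator `(F x - x ^ q) / ϖ` lowers the `I`-adic filtration by at most one. -/
theorem IsFrobeniusLift.mem_pow_of_mul_eq (n : ℕ) {x y : B} (hx : x ∈ I ^ (n + 1))
    (hy : ϖ * y = F x - x ^ q) : y ∈ I ^ n := by
  have hq := h.two_le
  choose δ hδ using h.dvd_sub
  suffices H : ∀ n, ∀ x ∈ I ^ (n + 1), δ x ∈ I ^ n by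
    rw [h.eq_of_mul_eq (hy.trans (hδ x))]
    exact H n x hx
  clear hx hy x y n
  have hδmul (x y : B) : δ (x * y) = δ x * F y + x ^ q * δ y := by
    apply h.eq_of_mul_eq
    rw [← hδ, map_mul]
    linear_combination F y * hδ x + x ^ q * hδ y
  have hδadd (J : Ideal B) (x y : B) (hx : x ∈ J) (hδx : δ x ∈ J) (hδy : δ y ∈ J) :
      δ (x + y) ∈ J := by
    choose c hc using h.dvd_choose
    have h1 : δ (x + y) = δ x + δ y -
        ∑ i ∈ (Finset.Ioo 0 q).attach, c i.1 i.2 * x ^ i.1 * y ^ (q - i.1) := by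
      apply h.eq_of_mul_eq
      have h2 := Finset.sum_attach (Finset.Ioo 0 q) fun i ↦ (q.choose i : B) * x ^ i * y ^ (q - i)
      have h3 : ϖ * ∑ i ∈ (Finset.Ioo 0 q).attach, c i.1 i.2 * x ^ i.1 * y ^ (q - i.1) =
          ∑ i ∈ (Finset.Ioo 0 q).attach, (q.choose i : B) * x ^ i.1 * y ^ (q - i.1) := by
        rw [Finset.mul_sum]
        refine Finset.sum_congr rfl fun i _ ↦ ?_
        rw [hc i.1 i.2]
        ring
      have h4 := add_pow_eq_sum_Ioo x y (n := q) (by omega)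
      rw [mul_sub, h3, h2, ← hδ, map_add]
      linear_combination hδ x + hδ y - h4
    rw [h1]
    refine sub_mem (add_mem hδx hδy) (Ideal.sum_mem _ fun i _ ↦ Ideal.mul_mem_right _ _
      (Ideal.mul_mem_left _ _ (Ideal.pow_mem_of_mem _ hx _ (Finset.mem_Ioo.1 i.2).1)))
  intro n
  induction n with
  | zero => simp
  | succ n ih =>
    intro x hx
    rw [pow_succ] at hx
    refine (Submodule.mul_induction_on (C := fun x ↦ x ∈ I ^ (n + 1) ∧ δ x ∈ I ^ (n + 1)) hx
      (fun x hx y hy ↦ ⟨Ideal.mul_mem_right _ _ hx, ?_⟩)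
      fun x y hx hy ↦ ⟨add_mem hx.1 hy.1, hδadd _ x y hx.1 hx.2 hy.2⟩).2
    rw [hδmul]
    refine add_mem ?_ (Ideal.mul_mem_right _ _ (Ideal.pow_mem_of_mem _ hx _ (by omega)))
    rw [pow_succ]
    exact Ideal.mul_mem_mul (ih x hx) ((h.mem_iff y).2 hy)

/-- Multiplication by `ϖ` is strict for the `I`-adic filtration. -/
theorem IsFrobeniusLift.mem_pow_of_mul_mem (n : ℕ) :
    ∀ x : B, ϖ * x ∈ I ^ (n + 1) → x ∈ I ^ n := by
  have hq := h.two_le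
  induction n with
  | zero => simp
  | succ n ih =>
    intro x hx
    have h1 : x ∈ I ^ n := ih x (Ideal.pow_le_pow_right (Nat.le_succ _) hx)
    obtain ⟨k, rfl⟩ : ∃ k, q = k + 2 := ⟨q - 2, by omega⟩
    -- The left side is the operator `(F - (·) ^ q) / ϖ` applied to `ϖ * x`. Its second term is
    -- already in `I ^ (n + 1)` by the weaker bound on `x`, so `F x`, and hence `x`, is too.
    have h2 : F x - ϖ ^ (k + 1) * x ^ (k + 2) ∈ I ^ (n + 1) := by
      refine h.mem_pow_of_mul_eq (n + 1) hx ?_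
      rw [map_mul, h.map_ϖ]
      ring
    have h3 : ϖ ^ (k + 1) * x ^ (k + 2) ∈ I ^ (n + 1) := by
      have h4 : x * ϖ ∈ I ^ (n + 1) := by
        rw [pow_succ]
        exact Ideal.mul_mem_mul h1 h.ϖ_mem
      have h5 := Ideal.mul_mem_left _ (ϖ ^ k * x ^ (k + 1)) h4
      convert h5 using 1
      ring
    rw [← h.mem_pow_iff]
    have := add_mem h2 h3
    rwa [sub_add_cancel] at this

/-- Each element of `I` is some `F y` with `y ∈ I`, which is `y ^ q` modulo `ϖ` with `q ≥ 2`. Thus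
`I` is idempotent modulo `ϖ`, so `ϖ` alone controls the `I`-adic completion although `I` need not be
finitely generated. -/
theorem IsFrobeniusLift.le_span_sup_pow (n : ℕ) : I ≤ Ideal.span {ϖ} ⊔ I ^ n := by
  have hq := h.two_le
  have h2 : I ≤ Ideal.span {ϖ} ⊔ I ^ 2 := by
    intro x hx
    obtain ⟨y, rfl⟩ := h.bijective.2 x
    obtain ⟨z, hz⟩ := h.dvd_sub y
    rw [show F y = ϖ * z + y ^ q by rw [← hz]; ring]
    exact Submodule.add_mem_sup (Ideal.mul_mem_right _ _ (Ideal.mem_span_singleton_self _))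
      (Ideal.pow_le_pow_right hq (Ideal.pow_mem_pow ((h.mem_iff y).1 hx) q))
  induction n with
  | zero => simp
  | succ n ih =>
    refine h2.trans (sup_le le_sup_left ?_)
    rw [pow_two]
    refine (Ideal.mul_mono_right ih).trans ?_
    rw [Ideal.mul_sup, ← pow_succ']
    exact sup_le_sup_right Ideal.mul_le_right _

theorem IsFrobeniusLift.pow_le_span_sup_pow (m n : ℕ) : I ^ n ≤ Ideal.span {ϖ ^ n} ⊔ I ^ m := by
  induction n with
  | zero => simp
  | succ n ih =>
    rw [pow_succ]
    refine (Ideal.mul_mono ih (h.le_span_sup_pow m)).trans ?_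
    rw [Ideal.sup_mul, Ideal.mul_sup, Ideal.span_singleton_mul_span_singleton, ← pow_succ]
    exact sup_le (sup_le_sup_left Ideal.mul_le_right _) (Ideal.mul_le_left.trans le_sup_right)

end FrobeniusLift

/-! ### The completion is `ϖ`-adic and carries a Frobenius lift. -/

section Completion

open AdicCompletion (evalₐ)

variable {B : Type*} [CommRing B] {I : Ideal B}

theorem exists_seq_of_adicCompletion (x : AdicCompletion I B) :
    ∃ a : ℕ → B, (∀ m n, m ≤ n → a n - a m ∈ I ^ m) ∧
      ∀ n, evalₐ I n x = Ideal.Quotient.mk _ (a n) := by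
  obtain ⟨a, rfl⟩ := AdicCompletion.mk_surjective I B x
  refine ⟨a.val, fun m n hmn ↦ ?_, fun n ↦ AdicCompletion.evalₐ_mk I n a⟩
  have := (a.property hmn).symm
  rwa [SModEq.sub_mem, smul_eq_mul, Ideal.mul_top] at this

theorem exists_adicCompletion_of_seq (a : ℕ → B) (ha : ∀ n, a (n + 1) - a n ∈ I ^ n) :
    ∃ x : AdicCompletion I B, ∀ n, evalₐ I n x = Ideal.Quotient.mk _ (a n) :=
  ⟨AdicCompletion.mk I B (AdicCompletion.AdicCauchySequence.mk I B a fun n ↦ by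
    rw [SModEq.comm, SModEq.sub_mem, smul_eq_mul, Ideal.mul_top]
    exact ha n), fun n ↦ AdicCompletion.evalₐ_mk I n _⟩

theorem evalₐ_eq_of_le {x : AdicCompletion I B} {m n : ℕ} (hmn : m ≤ n) {b : B}
    (hb : evalₐ I n x = Ideal.Quotient.mk _ b) : evalₐ I m x = Ideal.Quotient.mk _ b := by
  obtain ⟨a, ha, hx⟩ := exists_seq_of_adicCompletion x
  rw [hx, Ideal.Quotient.eq] at hb ⊢
  have := sub_mem (Ideal.pow_le_pow_right hmn hb) (ha m n hmn)
  rwa [sub_sub_sub_cancel_left] at this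

theorem evalₐ_algebraMap (n : ℕ) (b : B) :
    evalₐ I n (algebraMap B (AdicCompletion I B) b) = Ideal.Quotient.mk _ b :=
  AdicCompletion.evalₐ_of I n b

variable {ϖ : B} {q : ℕ} {F : B →+* B} (h : IsFrobeniusLift ϖ q F I)
include h

theorem IsFrobeniusLift.mem_pow_of_pow_mul_mem (n k : ℕ) :
    ∀ x : B, ϖ ^ n * x ∈ I ^ (n + k) → x ∈ I ^ k := by
  induction n with
  | zero => intro x hx; simpa using hx
  | succ n ih =>
    intro x hx
    apply ih
    apply h.mem_pow_of_mul_mem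
    rw [← mul_assoc, ← pow_succ']
    convert hx using 2
    ring

theorem IsFrobeniusLift.torsionFree_completion (x : AdicCompletion I B)
    (hx : algebraMap B (AdicCompletion I B) ϖ * x = 0) : x = 0 := by
  obtain ⟨a, ha, hxa⟩ := exists_seq_of_adicCompletion x
  refine AdicCompletion.ext_evalₐ fun n ↦ ?_
  have h1 := congrArg (evalₐ I (n + 1)) hx
  rw [map_mul, evalₐ_algebraMap, hxa, map_zero, ← map_mul, Ideal.Quotient.eq_zero_iff_mem] at h1
  rw [evalₐ_eq_of_le (Nat.le_succ n) (hxa (n + 1)), map_zero, Ideal.Quotient.eq_zero_iff_mem]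
  exact h.mem_pow_of_mul_mem n _ h1

/-- Elements of `I ^ n` are multiples of `ϖ ^ n` up to arbitrarily deep terms, and strictness of
multiplication by `ϖ` makes the quotients a Cauchy sequence. This makes the completion `ϖ`-adically
complete. -/
theorem IsFrobeniusLift.evalₐ_eq_zero_iff (n : ℕ) (x : AdicCompletion I B) :
    evalₐ I n x = 0 ↔ algebraMap B (AdicCompletion I B) ϖ ^ n ∣ x := by
  constructor
  · intro hx
    obtain ⟨a, ha, hxa⟩ := exists_seq_of_adicCompletion x
    have h1 (k : ℕ) : ∃ y, a (n + k) - ϖ ^ n * y ∈ I ^ (n + k) := by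
      have h2 : a (n + k) ∈ I ^ n := by
        rw [← Ideal.Quotient.eq_zero_iff_mem, ← hx]
        exact (evalₐ_eq_of_le (Nat.le_add_right n k) (hxa (n + k))).symm
      obtain ⟨_, h3, z, hz, hyz⟩ := Submodule.mem_sup.1 (h.pow_le_span_sup_pow (n + k) n h2)
      obtain ⟨y, rfl⟩ := Ideal.mem_span_singleton.1 h3
      exact ⟨y, by rw [← hyz, add_sub_cancel_left]; exact hz⟩
    choose y hy using h1
    obtain ⟨z, hz⟩ := exists_adicCompletion_of_seq y fun k ↦ by
      apply h.mem_pow_of_pow_mul_mem n k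
      have h2 := sub_mem (add_mem (ha (n + k) (n + (k + 1)) (by omega)) (hy k))
        (Ideal.pow_le_pow_right (by omega) (hy (k + 1)))
      convert h2 using 1
      ring
    refine ⟨z, AdicCompletion.ext_evalₐ fun k ↦ ?_⟩
    rw [map_mul, map_pow, evalₐ_algebraMap, hz,
      evalₐ_eq_of_le (Nat.le_add_left k n) (hxa (n + k)), ← map_pow, ← map_mul, Ideal.Quotient.eq]
    exact Ideal.pow_le_pow_right (Nat.le_add_left k n) (hy k)
  · rintro ⟨y, rfl⟩
    rw [map_mul, map_pow, evalₐ_algebraMap, ← map_pow,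
      Ideal.Quotient.eq_zero_iff_mem.2 (Ideal.pow_mem_pow h.ϖ_mem n), zero_mul]

theorem IsFrobeniusLift.isAdicComplete_completion :
    IsAdicComplete (Ideal.span {algebraMap B (AdicCompletion I B) ϖ}) (AdicCompletion I B) := by
  refine isAdicComplete_span_iff.2 ⟨fun x hx ↦ ?_, fun g ↦ ?_⟩
  · refine AdicCompletion.ext_evalₐ fun n ↦ ?_
    rw [(h.evalₐ_eq_zero_iff n x).2 (hx n), map_zero]
  · let s : ℕ → AdicCompletion I B := fun n ↦
      ∑ k ∈ Finset.range n, algebraMap B (AdicCompletion I B) ϖ ^ k * g k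
    choose b hb using fun n ↦ Ideal.Quotient.mk_surjective (evalₐ I n (s n))
    obtain ⟨y, hy⟩ := exists_adicCompletion_of_seq b fun n ↦ by
      rw [← Ideal.Quotient.eq, hb, ← evalₐ_eq_of_le (Nat.le_succ n) (hb (n + 1)).symm,
        ← sub_eq_zero, ← map_sub, h.evalₐ_eq_zero_iff]
      simp only [s, Finset.sum_range_succ, add_sub_cancel_left]
      exact Dvd.intro _ rfl
    exact ⟨y, fun n ↦ by rw [← h.evalₐ_eq_zero_iff, map_sub, hy, hb, sub_self]⟩

/-- The Frobenius lift on the quotients by powers of the ideal. -/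
def IsFrobeniusLift.φAux (n : ℕ) : AdicCompletion I B →+* B ⧸ I ^ n :=
  (Ideal.quotientMap (I ^ n) F fun x hx ↦ (h.mem_pow_iff n x).2 hx).comp
    (evalₐ I n : AdicCompletion I B →+* B ⧸ I ^ n)

theorem IsFrobeniusLift.φAux_apply {n : ℕ} {x : AdicCompletion I B} {b : B}
    (hb : evalₐ I n x = Ideal.Quotient.mk _ b) : h.φAux n x = Ideal.Quotient.mk _ (F b) := by
  rw [φAux, RingHom.comp_apply, RingHom.coe_coe, hb]
  rfl

theorem IsFrobeniusLift.factorPow_comp_φAux {m n : ℕ} (hmn : m ≤ n) :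
    (Ideal.Quotient.factorPow I hmn).comp (h.φAux n) = h.φAux m := by
  ext x
  obtain ⟨a, -, ha⟩ := exists_seq_of_adicCompletion x
  rw [RingHom.comp_apply, h.φAux_apply (ha n), h.φAux_apply (evalₐ_eq_of_le hmn (ha n))]
  rfl

/-- The extension of the Frobenius lift to the completion. -/
def IsFrobeniusLift.φ : AdicCompletion I B →+* AdicCompletion I B :=
  AdicCompletion.liftRingHom I h.φAux fun hmn ↦ h.factorPow_comp_φAux hmn

theorem IsFrobeniusLift.evalₐ_φ {n : ℕ} {x : AdicCompletion I B} {b : B}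
    (hb : evalₐ I n x = Ideal.Quotient.mk _ b) : evalₐ I n (h.φ x) = Ideal.Quotient.mk _ (F b) :=
  (AdicCompletion.evalₐ_liftRingHom I h.φAux (fun hmn ↦ h.factorPow_comp_φAux hmn) n x).trans
    (h.φAux_apply hb)

theorem IsFrobeniusLift.φ_algebraMap (b : B) :
    h.φ (algebraMap B (AdicCompletion I B) b) = algebraMap B (AdicCompletion I B) (F b) :=
  AdicCompletion.ext_evalₐ fun n ↦ by
    rw [h.evalₐ_φ (evalₐ_algebraMap n b), evalₐ_algebraMap]

theorem IsFrobeniusLift.dvd_φ_sub_pow (x : AdicCompletion I B) :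
    algebraMap B (AdicCompletion I B) ϖ ∣ h.φ x - x ^ q := by
  obtain ⟨a, -, ha⟩ := exists_seq_of_adicCompletion x
  rw [← pow_one (algebraMap B (AdicCompletion I B) ϖ), ← h.evalₐ_eq_zero_iff, map_sub, map_pow,
    h.evalₐ_φ (ha 1), ha, ← map_pow, ← map_sub, Ideal.Quotient.eq_zero_iff_mem, pow_one]
  exact Ideal.mem_of_dvd _ (h.dvd_sub _) h.ϖ_mem

theorem IsFrobeniusLift.bijective_φ : Function.Bijective h.φ := by
  constructor
  · rw [injective_iff_map_eq_zero]
    intro x hx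
    obtain ⟨a, -, ha⟩ := exists_seq_of_adicCompletion x
    refine AdicCompletion.ext_evalₐ fun n ↦ ?_
    have h1 := h.evalₐ_φ (ha n)
    rw [hx, map_zero, eq_comm, Ideal.Quotient.eq_zero_iff_mem, h.mem_pow_iff] at h1
    rw [ha, map_zero, Ideal.Quotient.eq_zero_iff_mem.2 h1]
  · intro y
    obtain ⟨a, ha, hy⟩ := exists_seq_of_adicCompletion y
    choose c hc using fun n ↦ h.bijective.2 (a n)
    obtain ⟨x, hx⟩ := exists_adicCompletion_of_seq c fun n ↦ by
      rw [← h.mem_pow_iff, map_sub, hc, hc]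
      exact ha n (n + 1) n.le_succ
    exact ⟨x, AdicCompletion.ext_evalₐ fun n ↦ by rw [h.evalₐ_φ (hx n), hc, hy]⟩

end Completion

section DeltaOfFrobenius

/-- A `δ_L`-structure on a `π`-torsion free algebra from a lift of the `q`-Frobenius. -/
def DeltaStructure.ofFrobenius {p : ℕ} [Fact p.Prime] {O : Type*} [CommRing O] {π : O}
    (hπ : IsUniformizer p π) {A : Type*} [CommRing A] [Algebra O A]
    (htf : ∀ x : A, algebraMap O A π * x = 0 → x = 0) (φ : A →+* A)
    (hφ : ∀ α, φ (algebraMap O A α) = algebraMap O A α)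
    (hdvd : ∀ x, algebraMap O A π ∣ φ x - x ^ resCard π) : DeltaStructure π A :=
  have hcancel {x y : A} (hxy : algebraMap O A π * x = algebraMap O A π * y) : x = y :=
    sub_eq_zero.1 (htf _ (by rw [mul_sub, hxy, sub_self]))
  have hδ (x : A) := (hdvd x).choose_spec
  { δ := fun x ↦ (hdvd x).choose
    δ_algebraMap := fun α ↦ hcancel (by
      rw [← hδ, hφ, ← map_mul, hπ.mul_divBy_sub_pow, map_sub, map_pow])
    δ_mul := fun x y ↦ hcancel (by
      have h1 := hδ x
      have h2 := hδ y
      rw [← hδ, map_mul]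
      linear_combination h1 * φ y + x ^ resCard π * h2 + algebraMap O A π *
        (hdvd x).choose * h2)
    δ_add := fun x y ↦ hcancel (by
      have h3 : algebraMap O A π * ∑ i ∈ Finset.Ioo 0 (resCard π),
          algebraMap O A (divBy π ((resCard π).choose i : O)) * x ^ i * y ^ (resCard π - i) =
          ∑ i ∈ Finset.Ioo 0 (resCard π), ((resCard π).choose i : A) * x ^ i *
            y ^ (resCard π - i) := by
        rw [Finset.mul_sum]
        refine Finset.sum_congr rfl fun i hi ↦ ?_
        rw [← mul_assoc, ← mul_assoc, ← map_mul, hπ.mul_divBy_choose hi, map_natCast]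
      have h4 := add_pow_eq_sum_Ioo x y (n := resCard π) (by
        have := hπ.two_le_resCard; omega)
      have h1 := hδ x
      have h2 := hδ y
      rw [mul_sub, h3, ← hδ, map_add]
      linear_combination h1 + h2 - h4) }

theorem DeltaStructure.ofFrobenius_φ {p : ℕ} [Fact p.Prime] {O : Type*} [CommRing O] {π : O}
    (hπ : IsUniformizer p π) {A : Type*} [CommRing A] [Algebra O A]
    (htf : ∀ x : A, algebraMap O A π * x = 0 → x = 0) (φ : A →+* A)
    (hφ : ∀ α, φ (algebraMap O A α) = algebraMap O A α)
    (hdvd : ∀ x, algebraMap O A π ∣ φ x - x ^ resCard π) (x : A) :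
    (DeltaStructure.ofFrobenius hπ htf φ hφ hdvd).φ x = φ x := by
  have h := (hdvd x).choose_spec
  change x ^ resCard π + algebraMap O A π * (hdvd x).choose = φ x
  linear_combination -h

end DeltaOfFrobenius

/-! ### Ramified Witt vectors as a completed monoid algebra. -/

section MonoidAlgebraLift

variable {p : ℕ} [Fact p.Prime] {O O' S : Type*} [CommRing O] [CommRing O'] [Algebra O O']
  [CommRing S] {π : O}

/-- The homomorphism `O'[S] → S` which restricts to the identity of `S`. -/
def augmentation (κ : O' →+* S) : MonoidAlgebra O' S →+* S :=
  MonoidAlgebra.liftNCRingHom κ (MonoidHom.id S) fun _ _ ↦ Commute.all _ _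

@[simp]
theorem augmentation_single (κ : O' →+* S) (s : S) (c : O') :
    augmentation κ (MonoidAlgebra.single s c) = κ c * s :=
  MonoidAlgebra.liftNCRingHom_single _ _ _ s c

/-- The endomorphism of `O'[S]` induced by the `q`-power map of `S`. -/
def powMap (O' S : Type*) [CommRing O'] [CommRing S] (q : ℕ) :
    MonoidAlgebra O' S →+* MonoidAlgebra O' S :=
  MonoidAlgebra.mapDomainRingHom O' (powMonoidHom q)

@[simp]
theorem powMap_single (q : ℕ) (s : S) (c : O') :
    powMap O' S q (MonoidAlgebra.single s c) = MonoidAlgebra.single (s ^ q) c := by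
  simp [powMap]

omit [Fact p.Prime] in
theorem bijective_powMap [PerfectRing S p] (f : ℕ) : Function.Bijective (powMap O' S (p ^ f)) := by
  let e := MonoidAlgebra.mapDomainRingEquiv O' (powMulEquiv (M := S) (p ^ f))
  have h : powMap O' S (p ^ f) = e.toRingHom :=
    MonoidAlgebra.ringHom_ext (fun c ↦ by simp [e]) fun s ↦ by simp [e]
  rw [h]
  exact e.bijective

theorem powMap_algebraMap (q : ℕ) (α : O) :
    powMap O' S q (algebraMap O _ α) = algebraMap O _ α := by
  simp

theorem IsUniformizer.dvd_powMap_sub (hπ : IsUniformizer p π)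
    (hO : Function.Bijective (algebraMap O O')) (x : MonoidAlgebra O' S) :
    algebraMap O (MonoidAlgebra O' S) π ∣ powMap O' S (resCard π) x - x ^ resCard π := by
  induction x using MonoidAlgebra.induction_on with
  | of s => simp
  | add x y hx hy =>
    obtain ⟨f, hf, hq⟩ := hπ.exists_resCard_eq
    rw [hq] at hx hy ⊢
    obtain ⟨r, hr⟩ := exists_add_pow_prime_pow_eq (Fact.out : p.Prime) x y f
    obtain ⟨c, hc⟩ := hπ.dvd
    have h1 := congrArg (algebraMap O (MonoidAlgebra O' S)) hc
    rw [map_natCast, map_mul] at h1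
    rw [map_add, hr, h1]
    convert (hx.add hy).sub (Dvd.intro (algebraMap O (MonoidAlgebra O' S) c * x * y * r) rfl)
      using 1
    ring
  | smul c x hx =>
    obtain ⟨α, rfl⟩ := hO.2 c
    rw [algebraMap_smul, Algebra.smul_def, mul_pow, map_mul]
    have h2 := congrArg (algebraMap O (MonoidAlgebra O' S)) (hπ.mul_divBy_sub_pow α)
    rw [map_mul, map_sub, map_pow] at h2
    rw [powMap_algebraMap]
    convert (hx.mul_left (algebraMap O _ α)).add ((Dvd.intro _ h2).mul_right (x ^ resCard π))
      using 1
    ring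

variable [CharP S p] {κ : O' →+* S}

theorem IsUniformizer.augmentation_powMap (hπ : IsUniformizer p π)
    (hO : Function.Bijective (algebraMap O O')) (hκ : κ (algebraMap O O' π) = 0)
    (x : MonoidAlgebra O' S) :
    augmentation κ (powMap O' S (resCard π) x) = augmentation κ x ^ resCard π := by
  obtain ⟨f, hf, hq⟩ := hπ.exists_resCard_eq
  have h : (augmentation κ).comp (powMap O' S (resCard π)) =
      (iterateFrobenius S p f).comp (augmentation κ) := by
    refine MonoidAlgebra.ringHom_ext (fun c ↦ ?_) fun s ↦ ?_
    · obtain ⟨α, rfl⟩ := hO.2 c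
      have h2 := congrArg (fun a ↦ κ (algebraMap O O' a)) (hπ.mul_divBy_sub_pow α)
      simp only [map_mul, hκ, zero_mul, map_sub, map_pow] at h2
      simpa [iterateFrobenius_def, hq] using sub_eq_zero.1 h2.symm
    · simp [iterateFrobenius_def, hq]
  simpa [iterateFrobenius_def, hq] using RingHom.congr_fun h x

variable [PerfectRing S p]

theorem IsUniformizer.isFrobeniusLift (hπ : IsUniformizer p π)
    (hO : Function.Bijective (algebraMap O O')) (hκ : κ (algebraMap O O' π) = 0) :
    IsFrobeniusLift (algebraMap O (MonoidAlgebra O' S) π) (resCard π) (powMap O' S (resCard π))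
      (RingHom.ker (augmentation κ)) where
  torsionFree x hx := by
    rw [← Algebra.smul_def] at hx
    ext s
    obtain ⟨α, hα⟩ := hO.2 (x.coeff s)
    have h1 : π • x.coeff s = 0 := congrArg (fun y ↦ MonoidAlgebra.coeff y s) hx
    rw [← hα, Algebra.smul_def, ← map_mul] at h1
    have h2 : π * α = 0 := hO.1 (by rw [h1, map_zero])
    simp [← hα, hπ.torsionFree α h2]
  two_le := hπ.two_le_resCard
  dvd_choose i hi := by
    have := congrArg (algebraMap O (MonoidAlgebra O' S)) (hπ.mul_divBy_choose hi)
    rw [map_mul, map_natCast] at this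
    exact Dvd.intro _ this
  bijective := by
    obtain ⟨f, -, hq⟩ := hπ.exists_resCard_eq
    rw [hq]
    exact bijective_powMap f
  map_ϖ := powMap_algebraMap _ _
  dvd_sub := hπ.dvd_powMap_sub hO
  mem_iff x := by
    obtain ⟨f, -, hq⟩ := hπ.exists_resCard_eq
    rw [RingHom.mem_ker, RingHom.mem_ker, hπ.augmentation_powMap hO hκ, hq]
    have hp : p ^ f ≠ 0 := pow_ne_zero f (Fact.out : p.Prime).ne_zero
    have hinj := (PerfectRing.bijective_frobenius (R := S) (p := p ^ f)).1
    exact ⟨fun h ↦ hinj (h.trans (zero_pow hp).symm), fun h ↦ by rw [h, zero_pow hp]⟩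
  ϖ_mem := by simp [RingHom.mem_ker, hκ]

/-- The canonical map from the completion of `O'[S]` to `S`. -/
def completionResidue (κ : O' →+* S) :
    AdicCompletion (RingHom.ker (augmentation κ)) (MonoidAlgebra O' S) →+* S :=
  (Ideal.Quotient.lift (RingHom.ker (augmentation κ) ^ 1) (augmentation κ) fun x hx ↦ by
    rwa [pow_one, RingHom.mem_ker] at hx).comp (AdicCompletion.evalₐ (RingHom.ker (augmentation κ)) 1).toRingHom

theorem completionResidue_apply
    {x : AdicCompletion (RingHom.ker (augmentation κ)) (MonoidAlgebra O' S)}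
    {b : MonoidAlgebra O' S} (hb : AdicCompletion.evalₐ _ 1 x = Ideal.Quotient.mk _ b) :
    completionResidue κ x = augmentation κ b := by
  rw [completionResidue, RingHom.comp_apply, AlgHom.toRingHom_eq_coe, RingHom.coe_coe, hb,
    Ideal.Quotient.lift_mk]

theorem completionResidue_algebraMap (b : MonoidAlgebra O' S) :
    completionResidue κ (algebraMap _ _ b) = augmentation κ b :=
  completionResidue_apply (evalₐ_algebraMap 1 b)

theorem IsUniformizer.completionResidue_eq_zero_iff (hπ : IsUniformizer p π)
    (hO : Function.Bijective (algebraMap O O')) (hκ : κ (algebraMap O O' π) = 0)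
    (x : AdicCompletion (RingHom.ker (augmentation κ)) (MonoidAlgebra O' S)) :
    completionResidue κ x = 0 ↔ algebraMap O _ π ∣ x := by
  obtain ⟨a, -, ha⟩ := exists_seq_of_adicCompletion x
  rw [IsScalarTower.algebraMap_apply O (MonoidAlgebra O' S), ← pow_one (algebraMap _ _ _),
    ← (hπ.isFrobeniusLift hO hκ).evalₐ_eq_zero_iff, ha, completionResidue_apply (ha 1),
    Ideal.Quotient.eq_zero_iff_mem, pow_one, RingHom.mem_ker]

omit [Fact p.Prime] [CharP S p] in
theorem bijective_pow_quotient {A : Type*} [CommRing A] {ϖ : A} {r : A →+* S}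
    (hr : Function.Surjective r) (hker : ∀ x, r x = 0 ↔ ϖ ∣ x) :
    Function.Bijective fun x : A ⧸ Ideal.span {ϖ} ↦ x ^ p := by
  have hI : RingHom.ker r = Ideal.span {ϖ} := by
    ext x
    rw [RingHom.mem_ker, hker, Ideal.mem_span_singleton]
  rw [← hI]
  let e := RingHom.quotientKerEquivOfSurjective hr
  have : (fun x : A ⧸ RingHom.ker r ↦ x ^ p) = e.symm ∘ (fun s ↦ s ^ p) ∘ e := by
    ext x
    simp
  rw [this]
  exact e.symm.bijective.comp (PerfectRing.bijective_frobenius.comp e.bijective)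

theorem IsUniformizer.isStrict_completion (hπ : IsUniformizer p π)
    (hO : Function.Bijective (algebraMap O O')) (hκ : κ (algebraMap O O' π) = 0) :
    IsStrict p (algebraMap O
      (AdicCompletion (RingHom.ker (augmentation κ)) (MonoidAlgebra O' S)) π) where
  torsionFree := by
    rw [IsScalarTower.algebraMap_apply O (MonoidAlgebra O' S)]
    exact (hπ.isFrobeniusLift hO hκ).torsionFree_completion
  complete := by
    rw [IsScalarTower.algebraMap_apply O (MonoidAlgebra O' S)]
    exact (hπ.isFrobeniusLift hO hκ).isAdicComplete_completion
  exists_eq := by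
    obtain ⟨w, e, hw, he, hp⟩ := hπ.exists_eq
    exact ⟨_, e, hw.map (algebraMap O _), he, by rw [← map_pow, ← map_mul, ← hp, map_natCast]⟩
  perfect := bijective_pow_quotient (r := completionResidue κ)
    (fun s ↦ ⟨algebraMap _ _ (MonoidAlgebra.of O' S s), by
      rw [completionResidue_algebraMap]; simp⟩)
    (hπ.completionResidue_eq_zero_iff hO hκ)

variable {R : Type*} [CommRing R] [Algebra O R]

/-- The homomorphism `O'[S] → R` given by a multiplicative map `S → R`. -/
def monoidAlgebraLift (hO : Function.Bijective (algebraMap O O')) (m : S →* R) :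
    MonoidAlgebra O' S →+* R :=
  MonoidAlgebra.liftNCRingHom ((algebraMap O R).comp
    (RingEquiv.ofBijective _ hO).symm.toRingHom) m fun _ _ ↦ Commute.all _ _

theorem monoidAlgebraLift_algebraMap (hO : Function.Bijective (algebraMap O O')) (m : S →* R)
    (α : O) : monoidAlgebraLift hO m (algebraMap O _ α) = algebraMap O R α := by
  have : (RingEquiv.ofBijective _ hO).symm (algebraMap O O' α) = α :=
    (RingEquiv.ofBijective _ hO).symm_apply_apply α
  simp [monoidAlgebraLift, this]

theorem mk_monoidAlgebraLift (hO : Function.Bijective (algebraMap O O')) {m : S →* R} {J : Ideal R}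
    {m₀ : S →+* R ⧸ J} (hm₀ : ∀ α, m₀ (κ (algebraMap O O' α)) = Ideal.Quotient.mk J (algebraMap O R α))
    (hm : ∀ s, Ideal.Quotient.mk J (m s) = m₀ s) (x : MonoidAlgebra O' S) :
    Ideal.Quotient.mk J (monoidAlgebraLift hO m x) = m₀ (augmentation κ x) := by
  suffices h : (Ideal.Quotient.mk J).comp (monoidAlgebraLift hO m) = m₀.comp (augmentation κ) from
    RingHom.congr_fun h x
  refine MonoidAlgebra.ringHom_ext (fun c ↦ ?_) fun s ↦ ?_
  · obtain ⟨α, rfl⟩ := hO.2 c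
    have := (RingEquiv.ofBijective _ hO).symm_apply_apply α
    simp only [RingEquiv.ofBijective_apply] at this
    simp [monoidAlgebraLift, this, hm₀]
  · simp [monoidAlgebraLift, hm]

/-- The map `m` is only multiplicative, but modulo `π` it is the ring homomorphism `m₀`. So the
induced map on the monoid algebra sends the augmentation ideal into `(π)` and extends to the
completion. -/
theorem exists_completionLift (hO : Function.Bijective (algebraMap O O'))
    (hc : IsAdicComplete (Ideal.span {algebraMap O R π}) R) {m : S →* R}
    {m₀ : S →+* R ⧸ Ideal.span {algebraMap O R π}}
    (hm₀ : ∀ α, m₀ (κ (algebraMap O O' α)) = Ideal.Quotient.mk _ (algebraMap O R α))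
    (hm : ∀ s, Ideal.Quotient.mk _ (m s) = m₀ s) :
    ∃ θ : AdicCompletion (RingHom.ker (augmentation κ)) (MonoidAlgebra O' S) →ₐ[O] R,
      ∀ x, Ideal.Quotient.mk _ (θ x) = m₀ (completionResidue κ x) := by
  set I := RingHom.ker (augmentation κ)
  set J := Ideal.span {algebraMap O R π}
  set θ₀ := monoidAlgebraLift hO m
  have hθ₀ := mk_monoidAlgebraLift hO hm₀ hm
  have hIJ : I.map θ₀ ≤ J := Ideal.map_le_iff_le_comap.2 fun x hx ↦ by
    rw [Ideal.mem_comap, ← Ideal.Quotient.eq_zero_iff_mem, hθ₀, RingHom.mem_ker.1 hx, map_zero]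
  have hpow (n : ℕ) : I ^ n ≤ (J ^ n).comap θ₀ := by
    rw [← Ideal.map_le_iff_le_comap, Ideal.map_pow]
    exact Ideal.pow_right_mono hIJ n
  let f (n : ℕ) : AdicCompletion I (MonoidAlgebra O' S) →+* R ⧸ J ^ n :=
    (Ideal.quotientMap (J ^ n) θ₀ (hpow n)).comp (AdicCompletion.evalₐ I n).toRingHom
  have hf {n x b} (hb : AdicCompletion.evalₐ I n x = Ideal.Quotient.mk _ b) :
      f n x = Ideal.Quotient.mk _ (θ₀ b) := by
    simp only [f]
    rw [RingHom.comp_apply, AlgHom.toRingHom_eq_coe, RingHom.coe_coe, hb, Ideal.quotientMap_mk]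
  have hfac {m n : ℕ} (hmn : m ≤ n) : (Ideal.Quotient.factorPow J hmn).comp (f n) = f m := by
    ext x
    obtain ⟨a, -, ha⟩ := exists_seq_of_adicCompletion x
    rw [RingHom.comp_apply, hf (ha n), hf (evalₐ_eq_of_le hmn (ha n))]
    rfl
  let θ := IsAdicComplete.liftRingHom J f hfac
  have hθ (n x) : Ideal.Quotient.mk (J ^ n) (θ x) = f n x :=
    IsAdicComplete.mk_liftRingHom J f hfac n x
  refine ⟨{ θ with commutes' := fun α ↦ ?_ }, fun x ↦ ?_⟩
  · change θ _ = _
    refine sub_eq_zero.1 ((isAdicComplete_span_iff.1 hc).1 _ fun n ↦ ?_)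
    rw [← Ideal.mem_span_singleton, ← Ideal.span_singleton_pow, ← Ideal.Quotient.eq, hθ,
      ← monoidAlgebraLift_algebraMap hO m α]
    exact hf (evalₐ_algebraMap n _)
  · change Ideal.Quotient.mk J (θ x) = _
    obtain ⟨a, -, ha⟩ := exists_seq_of_adicCompletion x
    have h1 := hθ 1 x
    rw [hf (ha 1), Ideal.Quotient.eq, pow_one, ← Ideal.Quotient.eq] at h1
    rw [h1, hθ₀, completionResidue_apply (ha 1)]

end MonoidAlgebraLift

section StrictLift

/-- The ring of ramified Witt vectors of a perfect ring `S` over `O`, with its universal property. -/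
theorem IsUniformizer.exists_strict_lift.{u, v} {p : ℕ} [Fact p.Prime] {O : Type v} [CommRing O]
    [Small.{u} O] {π : O} (hπ : IsUniformizer p π) {S : Type u} [CommRing S] [CharP S p]
    [PerfectRing S p] (κ : O →+* S) (hκ : κ π = 0) :
    ∃ (A : Type u) (_ : CommRing A) (_ : Algebra O A) (D : DeltaStructure π A) (r : A →+* S),
      D.IsPerfect ∧ IsStrict p (algebraMap O A π) ∧ Function.Surjective r ∧
      (∀ x, r x = 0 ↔ algebraMap O A π ∣ x) ∧
      ∀ (R : Type u) [CommRing R] [Algebra O R] (m : S →* R)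
        (m₀ : S →+* R ⧸ Ideal.span {algebraMap O R π}),
        IsAdicComplete (Ideal.span {algebraMap O R π}) R →
        (∀ α, m₀ (κ α) = Ideal.Quotient.mk _ (algebraMap O R α)) →
        (∀ s, Ideal.Quotient.mk _ (m s) = m₀ s) →
        ∃ θ : A →ₐ[O] R, ∀ x, Ideal.Quotient.mk _ (θ x) = m₀ (r x) := by
  -- Coefficients in a copy of `O` in the universe of `S` keep the monoid algebra in that universe.
  let e : O ≃ₐ[O] Shrink.{u} O := (Shrink.algEquiv O O).symm
  have he : ⇑(algebraMap O (Shrink.{u} O)) = e := by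
    funext α
    exact (e.commutes α).symm
  have hO : Function.Bijective (algebraMap O (Shrink.{u} O)) := by
    rw [he]
    exact e.bijective
  let κ' : Shrink.{u} O →+* S := κ.comp e.symm
  have hκ' (α : O) : κ' (algebraMap O _ α) = κ α := by
    rw [he]
    simp [κ']
  have hκπ : κ' (algebraMap O _ π) = 0 := (hκ' π).trans hκ
  have hF := hπ.isFrobeniusLift hO hκπ
  have hs := hπ.isStrict_completion hO hκπ
  refine ⟨_, inferInstance, inferInstance, DeltaStructure.ofFrobenius hπ hs.torsionFree hF.φ
    (fun α ↦ ?_) (fun x ↦ ?_), completionResidue κ', ?_, hs, ?_,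
    hπ.completionResidue_eq_zero_iff hO hκπ, fun R _ _ m m₀ hc h1 h2 ↦ ?_⟩
  · have := hF.φ_algebraMap (algebraMap O _ α)
    rwa [powMap_algebraMap, ← IsScalarTower.algebraMap_apply] at this
  · rw [IsScalarTower.algebraMap_apply O (MonoidAlgebra (Shrink.{u} O) S)]
    exact hF.dvd_φ_sub_pow x
  · rw [DeltaStructure.IsPerfect, funext (DeltaStructure.ofFrobenius_φ hπ _ _ _ _)]
    exact hF.bijective_φ
  · exact fun s ↦ ⟨algebraMap _ _ (MonoidAlgebra.of _ S s), by
      rw [completionResidue_algebraMap]; simp⟩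
  · exact exists_completionLift hO hc (fun α ↦ by rw [hκ', h1]) h2

end StrictLift

/-! ### Units and derived completeness in perfections. -/

section Nilpotent

theorem DerivedCompleteAt.of_isNilpotent {C : Type*} [CommRing C] {f : C} (hf : IsNilpotent f) :
    DerivedCompleteAt f := by
  obtain ⟨N, hN⟩ := hf
  constructor
  · intro x y hxy
    have h1 (n : ℕ) : x n - y n = f * (x (n + 1) - y (n + 1)) := by
      have := congrFun hxy n
      simp only at this
      linear_combination this
    have h2 (m n : ℕ) : x n - y n = f ^ m * (x (n + m) - y (n + m)) := by
      induction m with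
      | zero => simp
      | succ m ih => rw [ih, h1 (n + m), pow_succ, mul_assoc, add_assoc]
    ext n
    rw [← sub_eq_zero, h2 N n, hN, zero_mul]
  · intro y
    refine ⟨fun n ↦ ∑ k ∈ Finset.range N, f ^ k * y (n + k), ?_⟩
    ext n
    have h1 := Finset.sum_range_sub (fun k ↦ f ^ k * y (n + k)) N
    rw [Finset.sum_sub_distrib] at h1
    have h2 : f * ∑ k ∈ Finset.range N, f ^ k * y (n + 1 + k) =
        ∑ k ∈ Finset.range N, f ^ (k + 1) * y (n + (k + 1)) := by
      rw [Finset.mul_sum]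
      refine Finset.sum_congr rfl fun k _ ↦ ?_
      rw [pow_succ', mul_assoc, add_assoc, add_comm 1 k]
    simp only [hN, zero_mul, pow_zero, one_mul, add_zero, zero_sub] at h1
    simp only
    rw [h2]
    linear_combination -h1

theorem isUnit_of_isUnit_of_isNilpotent_sub {C : Type*} [CommRing C] {x y : C} (hy : IsUnit y)
    (h : IsNilpotent (x - y)) : IsUnit x := by
  have := IsNilpotent.isUnit_add_left_of_commute h hy (Commute.all _ _)
  rwa [add_sub_cancel] at this

theorem isUnit_of_isUnit_map {C D : Type*} [CommRing C] [CommRing D] {g : C →+* D}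
    (hg : Function.Surjective g) (hN : ∀ x, g x = 0 → IsNilpotent x) {x : C} (hx : IsUnit (g x)) :
    IsUnit x := by
  obtain ⟨y, hy⟩ := hx.exists_right_inv
  obtain ⟨y, rfl⟩ := hg y
  refine isUnit_of_mul_isUnit_left (y := y)
    (isUnit_of_isUnit_of_isNilpotent_sub isUnit_one (hN _ ?_))
  rw [map_sub, map_mul, hy, map_one, sub_self]

variable {p : ℕ} [Fact p.Prime] {C : Type*} [CommRing C] [CharP C p]

theorem isNilpotent_coeff {s : Perfection C p} (hs : IsNilpotent (Perfection.coeff C p 0 s))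
    (n : ℕ) : IsNilpotent (Perfection.coeff C p n s) := by
  induction n with
  | zero => exact hs
  | succ n ih =>
    rw [← Perfection.coeff_pow_p'] at ih
    exact ih.of_pow

theorem isUnit_of_isUnit_coeff {s : Perfection C p} (hs : IsUnit (Perfection.coeff C p 0 s)) :
    IsUnit s := by
  have h (n : ℕ) : IsUnit (Perfection.coeff C p n s) := by
    induction n with
    | zero => exact hs
    | succ n ih =>
      rw [← Perfection.coeff_pow_p'] at ih
      exact (isUnit_pow_iff (Fact.out : p.Prime).ne_zero).1 ih
  choose b hb using fun n ↦ (h n).exists_right_inv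
  let t : Perfection C p := ⟨b, fun n ↦ by
    refine (h n).mul_left_cancel ?_
    rw [hb, ← Perfection.coeff_pow_p', ← mul_pow, hb, one_pow]⟩
  refine IsUnit.of_mul_eq_one t (Perfection.ext fun n ↦ ?_)
  rw [map_mul, map_one]
  exact hb n

theorem mem_jacobson_of_isNilpotent_coeff {s : Perfection C p}
    (hs : IsNilpotent (Perfection.coeff C p 0 s)) : s ∈ (⊥ : Ideal (Perfection C p)).jacobson := by
  rw [Ideal.mem_jacobson_bot]
  intro y
  refine isUnit_of_isUnit_coeff (isUnit_of_isUnit_of_isNilpotent_sub isUnit_one ?_)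
  rw [map_add, map_one, add_sub_cancel_right, map_mul]
  exact (Commute.all _ _).isNilpotent_mul_right hs

/-- Every coordinate of `s` is nilpotent, so the system is uniquely solvable in each coordinate;
uniqueness makes the solutions compatible with Frobenius. -/
theorem derivedCompleteAt_of_isNilpotent_coeff {s : Perfection C p}
    (hs : IsNilpotent (Perfection.coeff C p 0 s)) : DerivedCompleteAt s := by
  have hn (n : ℕ) := DerivedCompleteAt.of_isNilpotent (isNilpotent_coeff hs n)
  constructor
  · intro x y hxy
    have h1 (n : ℕ) : (fun k ↦ Perfection.coeff C p n (x k)) =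
        fun k ↦ Perfection.coeff C p n (y k) := by
      refine (hn n).1 (funext fun k ↦ ?_)
      simp only [← map_mul, ← map_sub]
      exact congrArg _ (congrFun hxy k)
    ext k n
    exact congrFun (h1 n) k
  · intro y
    choose X hX using fun n ↦ (hn n).2 fun k ↦ Perfection.coeff C p n (y k)
    have hpow (n : ℕ) : (fun k ↦ X (n + 1) k ^ p) = X n := by
      refine (hn n).1 ?_
      rw [hX]
      ext k
      have := congrFun (hX (n + 1)) k
      simp only at this ⊢
      rw [← Perfection.coeff_pow_p' (y k), ← this, sub_pow_char, mul_pow, Perfection.coeff_pow_p']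
    let x : ℕ → Perfection C p := fun k ↦ ⟨fun n ↦ X n k, fun n ↦ congrFun (hpow n) k⟩
    refine ⟨x, ?_⟩
    ext k n
    simp only
    rw [map_sub, map_mul]
    exact congrFun (hX n) k

end Nilpotent

section Surjective

theorem surjective_of_approx {A R : Type*} [CommRing A] [CommRing R] {ϖ : A} {θ : A →+* R}
    (hA : IsAdicComplete (Ideal.span {ϖ}) A) (hR : ∀ x : R, (∀ n, θ ϖ ^ n ∣ x) → x = 0)
    (h : ∀ y, ∃ x, θ ϖ ∣ y - θ x) : Function.Surjective θ := by
  intro y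
  choose X Z hXZ using h
  let z : ℕ → R := fun m ↦ Z^[m] y
  have hz (m : ℕ) : z (m + 1) = Z (z m) := Function.iterate_succ_apply' _ _ _
  obtain ⟨x, hx⟩ := (isAdicComplete_span_iff.1 hA).2 fun m ↦ X (z m)
  have hsum (m : ℕ) : θ (∑ k ∈ Finset.range m, ϖ ^ k * X (z k)) = y - θ ϖ ^ m * z m := by
    induction m with
    | zero => simp [z]
    | succ m ih =>
      rw [Finset.sum_range_succ, map_add, ih, map_mul, map_pow, hz]
      linear_combination -θ ϖ ^ m * hXZ (z m)
  refine ⟨x, sub_eq_zero.1 (hR _ fun m ↦ ?_)⟩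
  have h1 := map_dvd θ (hx m)
  rw [map_sub, hsum, map_pow] at h1
  have h2 : θ x - y = -(y - θ ϖ ^ m * z m - θ x) - θ ϖ ^ m * z m := by ring
  rw [h2]
  exact h1.neg_right.sub (Dvd.intro _ rfl)

end Surjective

/-! ### Elements with compatible `p`-power roots, and the coefficient action on tilts. -/

section Untilt

variable {p : ℕ} [Fact p.Prime] {R : Type*} [CommRing R] [Fact ¬IsUnit (p : R)]
  [IsAdicComplete (Ideal.span {(p : R)}) R]

theorem exists_dvd_sub_untilt
    (hF : Function.Surjective fun x : R ⧸ Ideal.span {(p : R)} ↦ x ^ p) (y : R) :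
    ∃ s : PreTilt R p, (p : R) ∣ y - s.untilt := by
  have hF' : Function.Surjective (frobenius (ModP R p) p) := hF
  obtain ⟨s, hs⟩ := Perfection.coeff_surjective hF' 0 (Ideal.Quotient.mk _ y)
  refine ⟨s, ?_⟩
  rw [← Ideal.mem_span_singleton, ← Ideal.Quotient.eq]
  exact hs.symm.trans (PreTilt.mk_untilt_eq_coeff_zero s).symm

/-- In a perfectoid ring, `p` has a unit multiple with compatible `p`-power roots. -/
theorem IsPerfectoidRing.exists_untilt_eq_p (hR : IsPerfectoidRing p R) :
    ∃ (s : PreTilt R p) (v : R), IsUnit v ∧ s.untilt = p * v := by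
  obtain ⟨ϖ, ⟨c, hc⟩, hϖ⟩ := hR.exists_complete
  have hjac := mem_jacobson_of_isAdicComplete hϖ
  have hp := (Fact.out : p.Prime).two_le
  obtain ⟨b, z, hz⟩ := exists_dvd_sub_untilt hR.surjective_frobenius ϖ
  obtain ⟨k, hk⟩ := Nat.exists_eq_add_of_le hp
  -- Here `b.untilt` equals `ϖ` modulo `p`, and `p` is divisible by `ϖ ^ 2`, so the two differ by a
  -- unit factor.
  have h1 : b.untilt = ϖ * (1 - ϖ * (ϖ ^ k * c * z)) := by
    have h0 : ϖ ^ p = ϖ ^ (2 + k) := by rw [← hk]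
    rw [hc, h0] at hz
    linear_combination -hz
  have h2 : IsUnit (1 - ϖ * (ϖ ^ k * c * z)) :=
    isUnit_one_sub_of_mem_jacobson (Ideal.mul_mem_right _ _ hjac)
  obtain ⟨v, hv⟩ := h2.exists_right_inv
  have h3 : ϖ = b.untilt * v := by rw [h1]; linear_combination -ϖ * hv
  -- The equality `p = b.untilt ^ p * (v ^ p * c)` leaves a cofactor that must be approximated by an
  -- untilt modulo `p`.
  obtain ⟨y, w, hw⟩ := exists_dvd_sub_untilt hR.surjective_frobenius (v ^ p * c)
  refine ⟨b ^ p * y, 1 - b.untilt ^ p * w, isUnit_one_sub_of_mem_jacobson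
    (Ideal.mul_mem_right _ _ (Ideal.pow_mem_of_mem _ ?_ _ (by omega))), ?_⟩
  · rw [h1]
    exact Ideal.mul_mem_right _ _ hjac
  · have h4 : (p : R) = b.untilt ^ p * (v ^ p * c) := by
      rw [← mul_assoc, ← mul_pow, ← h3]
      exact hc
    rw [map_mul, map_pow]
    linear_combination -h4 - b.untilt ^ p * hw

/-- In a perfectoid ring, every element with a power associated to `p` has a unit multiple with
compatible `p`-power roots. -/
theorem IsPerfectoidRing.exists_untilt_eq (hR : IsPerfectoidRing p R) {t w : R} (hw : IsUnit w)
    {e : ℕ} (he : e ≠ 0) (hp : (p : R) = w * t ^ e)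
    (ht : t ∈ (⊥ : Ideal R).jacobson) :
    ∃ (s : PreTilt R p) (v : R), IsUnit v ∧ s.untilt = t * v := by
  obtain rfl | ⟨k, rfl⟩ : e = 1 ∨ ∃ k, e = k + 2 := by
    rcases e with _ | _ | k
    · exact (he rfl).elim
    · exact Or.inl rfl
    · exact Or.inr ⟨k, rfl⟩
  -- For `e = 1` an approximation modulo `p` is only one modulo `t`, too weak for a unit factor,
  -- hence the separate result for `p`.
  · obtain ⟨s, v, hv, hs⟩ := hR.exists_untilt_eq_p
    exact ⟨s, w * v, hw.mul hv, by rw [hs, hp]; ring⟩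
  · obtain ⟨s, z, hz⟩ := exists_dvd_sub_untilt hR.surjective_frobenius t
    refine ⟨s, 1 - t * (t ^ k * w * z),
      isUnit_one_sub_of_mem_jacobson (Ideal.mul_mem_right _ _ ht), ?_⟩
    rw [hp] at hz
    linear_combination -hz

end Untilt

section Coefficients

variable {p : ℕ} [Fact p.Prime] {O : Type*} [CommRing O] {π : O}

/-- The residue field of `O` acts on the tilt of an `O`-algebra. -/
theorem IsUniformizer.exists_ringHom_preTilt (hπ : IsUniformizer p π) {R : Type*} [CommRing R]
    [Algebra O R] [Fact ¬IsUnit (p : R)] (ht : algebraMap O R π ∣ (p : R)) :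
    ∃ κ : O →+* PreTilt R p, κ π = 0 ∧
      ∀ α, reduction ht (PreTilt.coeff 0 (κ α)) = Ideal.Quotient.mk _ (algebraMap O R α) := by
  have : Fact ¬IsUnit (p : O) := ⟨fun h ↦ (Fact.out : ¬IsUnit (p : R)) (by
    rw [← map_natCast (algebraMap O R)]
    exact h.map _)⟩
  have := hπ.isMaximal
  have := hπ.finite
  let _ : Field (O ⧸ Ideal.span {π}) := Ideal.Quotient.field _
  obtain ⟨w, e, hw, -, hp⟩ := hπ.exists_eq
  have hk : (p : O) ∣ π ^ e := by
    obtain ⟨v, hv⟩ := hw.exists_right_inv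
    exact ⟨v, by rw [hp]; linear_combination -π ^ e * hv⟩
  have hchar : CharP (O ⧸ Ideal.span {π}) p := by
    refine (CharP.charP_iff_prime_eq_zero Fact.out).2 ?_
    rw [← map_natCast (Ideal.Quotient.mk (Ideal.span {π})), Ideal.Quotient.eq_zero_iff_mem,
      Ideal.mem_span_singleton]
    exact hπ.dvd
  -- The residue field embeds into `O / p` by Teichmüller representatives; being perfect, it then
  -- maps to the perfection of `R / p`.
  obtain ⟨σ, hσ⟩ := exists_section_of_perfect (p := p) (reduction_surjective hπ.dvd)
    (pow_eq_zero_of_reduction_eq_zero hπ.dvd hk)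
    (PerfectRing.bijective_frobenius (R := O ⧸ Ideal.span {π}) (p := p))
  let f : O ⧸ Ideal.span {π} →+* ModP R p := (modPMap p (algebraMap O R)).comp σ
  let κ : O ⧸ Ideal.span {π} →+* PreTilt R p :=
    Perfection.lift p (O ⧸ Ideal.span {π}) (ModP R p) f
  have hκ (x) : PreTilt.coeff 0 (κ x) = f x :=
    RingHom.congr_fun ((Perfection.lift p (O ⧸ Ideal.span {π}) (ModP R p)).symm_apply_apply f) x
  refine ⟨κ.comp (Ideal.Quotient.mk _), ?_, fun α ↦ ?_⟩
  · rw [RingHom.comp_apply, Ideal.Quotient.eq_zero_iff_mem.2 (Ideal.mem_span_singleton_self π),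
      map_zero]
  · rw [RingHom.comp_apply, hκ]
    obtain ⟨β, hβ⟩ := Ideal.Quotient.mk_surjective (σ (Ideal.Quotient.mk _ α))
    have h1 : π ∣ β - α := by
      rw [← Ideal.mem_span_singleton, ← Ideal.Quotient.eq, ← reduction_mk hπ.dvd, hβ, hσ]
    change reduction ht (modPMap p (algebraMap O R) (σ _)) = _
    rw [← hβ, modPMap_mk, reduction_mk, Ideal.Quotient.eq, Ideal.mem_span_singleton, ← map_sub]
    exact map_dvd _ h1

end Coefficients

/-! ### Comparing `R` with a strict lift of its tilt. -/

section TiltOfLift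

variable {p : ℕ} [Fact p.Prime] {A R S : Type*} [CommRing A] [CommRing R] {ϖ : A} {t : R}
  [Fact ¬IsUnit (p : A)] [Fact ¬IsUnit (p : R)] [IsAdicComplete (Ideal.span {(p : A)}) A]

/-- A lift `θ : A → R` of `A / ϖ = R♭ → R / t` induces an isomorphism on tilts. -/
theorem IsStrict.tiltMap_eq (ht : t ∣ (p : R)) {k : ℕ} (hk : (p : R) ∣ t ^ k) {r : A →+* PreTilt R p}
    (hϖ : r ϖ = 0) (h : IsStrict p ϖ) {θ : A →+* R}
    (hθ : ∀ x, Ideal.Quotient.mk _ (θ x) = reduction ht (PreTilt.coeff 0 (r x)))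
    (a : PreTilt A p) : tiltMap p θ a = r a.untilt := by
  let ι : PreTilt A p →+* PreTilt R p := (Ideal.Quotient.lift (Ideal.span {ϖ}) r fun x hx ↦ by
    obtain ⟨y, rfl⟩ := Ideal.mem_span_singleton.1 hx
    rw [map_mul, hϖ, zero_mul]).comp h.tiltEquiv
  have hι (a : PreTilt A p) : ι a = r a.untilt := by
    simp only [ι]
    rw [RingHom.comp_apply, RingEquiv.coe_toRingHom, h.tiltEquiv_apply, Ideal.Quotient.lift_mk]
  rw [← hι]
  refine RingHom.congr_fun (Perfection.hom_ext p fun x ↦ ?_) a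
  refine RingHom.congr_fun (f := (PreTilt.coeff 0).comp (tiltMap p θ))
    (g := (PreTilt.coeff 0).comp ι) (ringHom_eq_of_comp_eq
      (pow_eq_zero_of_reduction_eq_zero ht hk) fun x ↦ ?_) x
  rw [RingHom.comp_apply, RingHom.comp_apply, coeff_zero_tiltMap, reduction_mk, hθ, hι]

theorem IsStrict.bijective_tiltMap_of_lift (ht : t ∣ (p : R)) {k : ℕ} (hk : (p : R) ∣ t ^ k)
    {r : A →+* PreTilt R p} (hr : Function.Surjective r) (hker : ∀ x, r x = 0 ↔ ϖ ∣ x)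
    (h : IsStrict p ϖ) {θ : A →+* R}
    (hθ : ∀ x, Ideal.Quotient.mk _ (θ x) = reduction ht (PreTilt.coeff 0 (r x))) :
    Function.Bijective (tiltMap p θ) := by
  have key := h.tiltMap_eq ht hk ((hker ϖ).2 dvd_rfl) hθ
  constructor
  · rw [injective_iff_map_eq_zero]
    intro a ha
    rw [key, hker, ← Ideal.mem_span_singleton, ← Ideal.Quotient.eq_zero_iff_mem,
      ← h.tiltEquiv_apply, map_eq_zero_iff _ h.tiltEquiv.injective] at ha
    exact ha
  · intro s
    obtain ⟨x, rfl⟩ := hr s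
    obtain ⟨a, ha⟩ := h.tiltEquiv.surjective (Ideal.Quotient.mk _ x)
    refine ⟨a, ?_⟩
    rw [h.tiltEquiv_apply, Ideal.Quotient.eq, Ideal.mem_span_singleton, ← hker, map_sub,
      sub_eq_zero] at ha
    rw [key, ha]

end TiltOfLift

section Kernel

open WittVector

variable {p : ℕ} [Fact p.Prime] {A R : Type*} [CommRing A] [CommRing R] {ϖ : A}
  [Fact ¬IsUnit (p : A)] [Fact ¬IsUnit (p : R)]

theorem mem_jacobson_of_isNilpotent_tiltMap {θ : A →+* R} (hθ : Function.Bijective (tiltMap p θ))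
    {a : PreTilt A p} (ha : IsNilpotent (PreTilt.coeff 0 (tiltMap p θ a))) :
    a ∈ (⊥ : Ideal (PreTilt A p)).jacobson := by
  have h1 : tiltMap p θ a ∈ (⊥ : Ideal (PreTilt R p)).jacobson :=
    mem_jacobson_of_isNilpotent_coeff ha
  rw [Ideal.mem_jacobson_bot] at h1 ⊢
  intro y
  have h2 := h1 (tiltMap p θ y)
  rw [← map_mul, ← map_one (tiltMap p θ), ← map_add] at h2
  exact (MulEquiv.isUnit_map (RingEquiv.ofBijective _ hθ)).1 h2

variable [IsAdicComplete (Ideal.span {(p : A)}) A] [IsAdicComplete (Ideal.span {(p : R)}) R]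

/-- If the kernel of Fontaine's map of `R` is principal, then the kernel of `A → R` is generated by
any primitive element of degree one that it contains. -/
theorem IsStrict.ker_eq_of_isPrincipal (h : IsStrict p ϖ) {θ : A →+* R}
    (hb : Function.Bijective (tiltMap p θ))
    (hprin : (RingHom.ker (fontaineTheta R p)).IsPrincipal) {a : PreTilt A p} {d u : A}
    (ha : a ∈ (⊥ : Ideal (PreTilt A p)).jacobson) (hu : IsUnit u) (hd : d = a.untilt + ϖ * u)
    (hθd : θ d = 0) (y : A) : θ y = 0 ↔ d ∣ y := by
  obtain ⟨ξ, hξ⟩ := (isPrincipal_ker_fontaineTheta_iff hb).1 hprin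
  obtain ⟨h1, x, hx⟩ := h.quotient_primitive ha hu hd
  have hθ {z : A} (hz : d ∣ z) : θ z = 0 := by
    obtain ⟨c, rfl⟩ := hz
    rw [map_mul, hθd, zero_mul]
  -- As `ξ` maps to `0` in `R`, its leading Teichmüller term maps to a multiple of `p`, which
  -- vanishes in `R / p`.
  have hξjac : ξ.coeff 0 ∈ (⊥ : Ideal (PreTilt A p)).jacobson := by
    refine mem_jacobson_of_isNilpotent_tiltMap hb (θ := θ) ?_
    have h2 : PreTilt.coeff 0 (tiltMap p θ (ξ.coeff 0)) = 0 := by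
      obtain ⟨y, hy⟩ := exists_eq_teichmuller_add ξ
      have h3 := (hξ ξ).2 dvd_rfl
      rw [hy, map_add, map_mul, map_natCast, fontaineTheta_teichmuller, map_add, map_mul,
        map_natCast] at h3
      rw [coeff_zero_tiltMap, Ideal.Quotient.eq_zero_iff_mem, Ideal.mem_span_singleton]
      exact ⟨-θ (fontaineTheta A p y), by linear_combination h3⟩
    rw [h2]
    exact IsNilpotent.zero
  -- From `x = ξ * g` and `p - [a ^ m] Z = x * k` the distinguished element is `g * k * ξ`, which
  -- forces `g` to be a unit.
  have hxξ : x ∣ ξ := by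
    obtain ⟨m, hm, Z, hZ⟩ := h.exists_dvd_fontaineTheta_p_sub ha hu hd
    obtain ⟨k, hk⟩ := (hx _).1 hZ
    obtain ⟨g, hg⟩ := (hξ x).1 (hθ ((hx x).2 dvd_rfl))
    have h4 : IsUnit (g * k) := isUnit_of_p_sub_eq_mul (Ideal.pow_mem_of_mem _ ha m
      (Nat.pos_of_ne_zero hm)) hξjac (hk.trans (by rw [hg]; ring))
    obtain ⟨g', hg'⟩ := (isUnit_of_mul_isUnit_left h4).exists_right_inv
    exact ⟨g', by rw [hg]; linear_combination -ξ * hg'⟩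
  refine ⟨fun hy ↦ ?_, hθ⟩
  obtain ⟨j, hj⟩ := h1 y
  have h5 := hθ hj
  rw [map_sub, hy, zero_sub, neg_eq_zero, hξ] at h5
  exact (dvd_iff_dvd_of_dvd_sub hj).2 ((hx j).2 (hxξ.trans h5))

end Kernel

/-! ### The prism attached to a perfectoid ring. -/

section Prism

theorem isCartierDivisor_span_singleton {A : Type*} [CommRing A] {d : A}
    (hd : ∀ y, d * y = 0 → y = 0) : IsCartierDivisor (Ideal.span {d}) := by
  refine ⟨{1}, Ideal.span_singleton_one, fun f _ ↦ ⟨algebraMap A (Localization.Away f) d, ?_, ?_⟩⟩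
  · refine IsLocalization.map_nonZeroDivisors_le (Submonoid.powers f) _
      (Submonoid.mem_map_of_mem _ ?_)
    rw [mem_nonZeroDivisors_iff_right]
    intro y hy
    exact hd y (by rw [mul_comm, hy])
  · rw [Ideal.map_span, Set.image_singleton]

theorem isPerfectoidAlgebra_of_subsingleton {O : Type*} [CommRing O] (π : O) (R : Type*)
    [CommRing R] [Algebra O R] [Subsingleton R] : IsPerfectoidAlgebra π R := by
  have hbij {X Y : Type _} [Subsingleton X] [Nonempty X] [Subsingleton Y] (f : X → Y) :
      Function.Bijective f :=
    ⟨Function.injective_of_subsingleton f, fun y ↦ ⟨Classical.arbitrary X, Subsingleton.elim _ _⟩⟩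
  refine ⟨R, inferInstance, inferInstance, ⟨fun _ ↦ 0, fun _ ↦ Subsingleton.elim _ _,
    fun _ _ ↦ Subsingleton.elim _ _, fun _ _ ↦ Subsingleton.elim _ _⟩, ⊥,
    ⟨⟨∅, Subsingleton.elim _ _, by simp⟩, fun f _ ↦ hbij _, ?_⟩, hbij _,
    ⟨(AlgEquiv.quotientBot O R).symm⟩⟩
  exact Ideal.mem_sup_left (Subsingleton.elim (algebraMap O R π) 0 ▸ zero_mem (⊥ : Ideal R))

variable {p : ℕ} [Fact p.Prime] {O : Type*} [CommRing O] {π : O} (hπ : IsUniformizer p π)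
  {A : Type*} [CommRing A] [Algebra O A] {D : DeltaStructure π A} [Fact ¬IsUnit (p : A)]
  [IsAdicComplete (Ideal.span {(p : A)}) A]
include hπ

/-- Modulo `π` the ideal `(π, d)` becomes the ideal of multiples of `a` in the tilt, so derived
completeness is checked there. A unit `u` makes `δ_L(d)` a unit, and `φ(d) = d ^ q + π δ_L(d)` can
be solved for `π`. -/
theorem DeltaStructure.isPrism_span_singleton (hperf : D.IsPerfect)
    (hs : IsStrict p (algebraMap O A π)) {a : PreTilt A p} {d u : A} (hu : IsUnit u)
    (hd : d = a.untilt + algebraMap O A π * u) (ha : ∀ c, DerivedCompleteAt (a * c)) :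
    IsPrism D (Ideal.span {d}) where
  isCartierDivisor := isCartierDivisor_span_singleton fun y hy ↦
    (isAdicComplete_span_iff.1 hs.complete).1 y fun n ↦
      hs.pow_dvd_of_pow_succ_dvd_primitive_mul hu hd n y (hy ▸ dvd_zero _)
  isDerivedComplete f hf := by
    obtain ⟨_, h1, _, h2, rfl⟩ := Submodule.mem_sup.1 hf
    obtain ⟨x, rfl⟩ := Ideal.mem_span_singleton.1 h1
    obtain ⟨y, rfl⟩ := Ideal.mem_span_singleton.1 h2
    refine DerivedCompleteAt.of_quotient hs.complete hs.torsionFree ?_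
    obtain ⟨c, hc⟩ := hs.tiltEquiv.surjective (Ideal.Quotient.mk _ y)
    have h3 : Ideal.Quotient.mk _ (algebraMap O A π * x + d * y) = hs.tiltEquiv (a * c) := by
      rw [map_mul, hc, hs.tiltEquiv_apply, ← map_mul, Ideal.Quotient.eq, Ideal.mem_span_singleton,
        hd]
      exact ⟨x + u * y, by ring⟩
    rw [h3]
    exact (ha c).map_ringEquiv hs.tiltEquiv
  mem := by
    obtain ⟨f, -, hq⟩ := hπ.exists_resCard_eq
    obtain ⟨b, hb⟩ := (bijective_iterateFrobenius (R := PreTilt A p) (p := p) (n := f)).2 a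
    rw [iterateFrobenius_def] at hb
    have hδ : IsUnit (D.δ d) := by
      rw [← D.isUnit_δ_iff hπ hs hperf b.untilt u, ← map_pow, hq, hb, ← hd] at hu
      exact hu
    obtain ⟨v, hv⟩ := hδ.exists_right_inv
    have h1 : algebraMap O A π = d * (-v * d ^ (resCard π - 1)) + v * D.φ d := by
      have h2 : d ^ resCard π = d * d ^ (resCard π - 1) := by
        rw [← pow_succ', Nat.sub_add_cancel (by have := hπ.two_le_resCard; omega)]
      rw [DeltaStructure.φ, h2]
      linear_combination -algebraMap O A π * hv
    rw [h1]
    exact add_mem (Ideal.mem_sup_left (Ideal.mul_mem_right _ _ (Ideal.mem_span_singleton_self d)))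
      (Ideal.mem_sup_right (Ideal.mul_mem_left _ _ (Ideal.subset_span
        ⟨d, Ideal.mem_span_singleton_self d, rfl⟩)))

end Prism

theorem isPerfectoidAlgebra_of_isPerfectoidRing.{u, v} {p : ℕ} [Fact p.Prime] {O : Type v}
    [CommRing O] [Small.{0} O] {π : O} (hπ : IsUniformizer p π) {R : Type u} [CommRing R]
    [Algebra O R] (hR : IsPerfectoidRing p R) : IsPerfectoidAlgebra π R := by
  have : Small.{u} O := small_map (equivShrink.{0} O)
  have hRp : IsAdicComplete (Ideal.span {(p : R)}) R := by
    obtain ⟨ϖ, hϖp, hϖ⟩ := hR.exists_complete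
    exact isAdicComplete_of_dvd ((dvd_pow_self _ (Fact.out : p.Prime).ne_zero).trans hϖp) hϖ
  by_cases hpR : IsUnit (p : R)
  · have := subsingleton_of_isUnit hpR hRp
    exact isPerfectoidAlgebra_of_subsingleton π R
  have : Fact ¬IsUnit (p : R) := ⟨hpR⟩
  set t := algebraMap O R π with ht_def
  obtain ⟨w, e, hw, he, hp⟩ : ∃ (w : R) (e : ℕ), IsUnit w ∧ e ≠ 0 ∧ (p : R) = w * t ^ e := by
    obtain ⟨w, e, hw, he, hp⟩ := hπ.exists_eq
    exact ⟨_, e, hw.map (algebraMap O R), he, by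
      rw [ht_def, ← map_pow, ← map_mul, ← hp, map_natCast]⟩
  have ht : t ∣ (p : R) := hp ▸ (dvd_pow_self t he).mul_left w
  have hk : (p : R) ∣ t ^ e := by
    obtain ⟨w', hw'⟩ := hw.exists_right_inv
    exact ⟨w', by rw [hp]; linear_combination -t ^ e * hw'⟩
  have htc : IsAdicComplete (Ideal.span {t}) R := isAdicComplete_of_dvd_pow he ht hk hRp
  have htn : ∀ v : R, IsNilpotent (Ideal.Quotient.mk (Ideal.span {(p : R)}) (t * v)) := fun v ↦
    ⟨e, by
      rw [← map_pow, mul_pow, Ideal.Quotient.eq_zero_iff_mem, Ideal.mem_span_singleton]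
      exact hk.mul_right _⟩
  obtain ⟨κ, hκπ, hκ⟩ := hπ.exists_ringHom_preTilt ht
  obtain ⟨A, _, _, D, r, hperf, hs, hr, hker, hlift⟩ := hπ.exists_strict_lift κ hκπ
  obtain ⟨θ, hθ⟩ := hlift R PreTilt.untilt ((reduction ht).comp (PreTilt.coeff 0)) htc hκ
    fun s ↦ congrArg (reduction ht) (PreTilt.mk_untilt_eq_coeff_zero s)
  have hθπ : θ (algebraMap O A π) = t := θ.commutes π
  have hred : Function.Surjective fun x ↦ reduction ht (PreTilt.coeff 0 (r x)) :=
    (reduction_surjective ht).comp ((Perfection.coeff_surjective (R := ModP R p) (p := p)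
      hR.surjective_frobenius 0).comp hr)
  have hsurj : Function.Surjective θ := by
    refine surjective_of_approx (θ := (θ : A →+* R)) hs.complete ?_ fun y ↦ ?_
    · rw [RingHom.coe_coe, hθπ]
      exact (isAdicComplete_span_iff.1 htc).1
    · obtain ⟨x, hx⟩ := hred (Ideal.Quotient.mk _ y)
      refine ⟨x, ?_⟩
      rw [RingHom.coe_coe, hθπ, ← Ideal.mem_span_singleton, ← Ideal.Quotient.eq, hθ]
      exact hx.symm
  have : Fact ¬IsUnit (p : A) := ⟨fun h ↦ hpR (by
    rw [← map_natCast θ]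
    exact h.map _)⟩
  have := hs.isAdicComplete_p
  have hb := hs.bijective_tiltMap_of_lift ht hk hr hker (θ := (θ : A →+* R)) hθ
  obtain ⟨s, v, hv, hsv⟩ := hR.exists_untilt_eq hw he hp (mem_jacobson_of_isAdicComplete htc)
  obtain ⟨a, rfl⟩ := hb.2 s
  obtain ⟨u, rfl⟩ := hsurj v
  -- Units lift along `A → A / π = R♭`, then along the zeroth coordinate `R♭ → R / p`, then along
  -- the nilpotent thickening `R / p → R / π`, where `θ u` is a unit.
  have hu : IsUnit u := by
    refine isUnit_of_isUnit_mk (mem_jacobson_of_isAdicComplete hs.complete) ?_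
    have h1 : IsUnit (r u) := by
      refine isUnit_of_isUnit_coeff (isUnit_of_isUnit_map (reduction_surjective ht)
        (fun x hx ↦ ⟨_, pow_eq_zero_of_reduction_eq_zero ht hk x hx⟩) ?_)
      have := hv.map (Ideal.Quotient.mk (Ideal.span {t}))
      rw [hθ] at this
      exact this
    obtain ⟨z, hz⟩ := h1.exists_right_inv
    obtain ⟨z, rfl⟩ := hr z
    refine IsUnit.of_mul_eq_one (Ideal.Quotient.mk _ z) ?_
    rw [← map_mul, ← map_one (Ideal.Quotient.mk _), Ideal.Quotient.eq, Ideal.mem_span_singleton,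
      ← hker, map_sub, map_mul, hz, map_one, sub_self]
  have huntilt : θ a.untilt = t * θ u := by
    rw [← hsv, ← WittVector.fontaineTheta_teichmuller, ← WittVector.fontaineTheta_teichmuller,
      ← WittVector.map_teichmuller]
    exact (fontaineTheta_map_tiltMap (θ : A →+* R) _).symm
  have hnil (c : PreTilt A p) :
      IsNilpotent (PreTilt.coeff 0 (tiltMap p (θ : A →+* R) (a * c))) := by
    rw [coeff_zero_tiltMap, map_mul, map_mul, RingHom.coe_coe, huntilt, mul_assoc]
    exact htn _
  have hajac : a ∈ (⊥ : Ideal (PreTilt A p)).jacobson :=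
    mem_jacobson_of_isNilpotent_tiltMap hb (by simpa using hnil 1)
  have hac (c : PreTilt A p) : DerivedCompleteAt (a * c) := by
    have h1 : DerivedCompleteAt (tiltMap p (θ : A →+* R) (a * c)) :=
      derivedCompleteAt_of_isNilpotent_coeff (hnil c)
    have h2 := h1.map_ringEquiv (RingEquiv.ofBijective _ hb).symm
    rwa [← RingEquiv.ofBijective_apply _ hb, RingEquiv.symm_apply_apply] at h2
  -- Since `θ a.untilt = π * θ u`, this primitive element lies in the kernel of `θ`.
  obtain ⟨d, hd⟩ : ∃ d, d = a.untilt + algebraMap O A π * -u := ⟨_, rfl⟩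
  have hkerθ := hs.ker_eq_of_isPrincipal hb (hR.isPrincipal_ker_theta hpR) hajac hu.neg hd (by
    rw [hd, RingHom.coe_coe, map_add, map_mul, huntilt, hθπ, map_neg]
    ring)
  have hI : RingHom.ker θ = Ideal.span {d} := by
    ext y
    rw [Ideal.mem_span_singleton, ← hkerθ]
    rfl
  exact ⟨A, _, _, D, Ideal.span {d}, D.isPrism_span_singleton hπ hperf hs hu.neg hd hac, hperf,
    ⟨(Ideal.quotientKerAlgEquivOfSurjective hsurj).symm.trans (Ideal.quotientEquivAlgOfEq O hI)⟩⟩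

end LTypical
end

theorem mainTheorem6 (p : ℕ) [Fact p.Prime] (L : Type*) [Field L] [Algebra ℚ_[p] L]
    [FiniteDimensional ℚ_[p] L] [Algebra ℤ_[p] L] [IsScalarTower ℤ_[p] ℚ_[p] L]
    (π : integralClosure ℤ_[p] L) (hπ : Irreducible π)
    (R : Type*) [CommRing R] [Algebra (integralClosure ℤ_[p] L) R] :
    LTypical.IsPerfectoidAlgebra π R ↔ LTypical.IsPerfectoidRing p R := by
  have hu := LTypical.isUniformizer_integralClosure p L hπ
  have := LTypical.small_integralClosure p L
  exact ⟨LTypical.isPerfectoidRing_of_isPerfectoidAlgebra hu,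
    LTypical.isPerfectoidAlgebra_of_isPerfectoidRing hu⟩
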